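/- Notation. For a nonzero Schwartz window $g\in\mathcal S(\mathbb R^n)$ and $f\in\mathcal S'(\mathbb R^n)$ let $V_gf(x,\xi)=\langle f,M_\xi T_xg\rangle$ be the short-time Fourier transform, where $T_xg(t)=g(t-x)$, $M_\xi g(t)=e^{2\pi i\xi\cdot t}g(t)$ and $\langle\cdot,\cdot\rangle$ extends $\int f\bar g$. The same notation $V_\varphi f(x,\xi)=\int f(t)\overline{\varphi(t-x)}e^{-2\pi i\xi\cdot t}\,dt$ is used, in the weak sense, when $f$ is Schwartz and the window $\varphi$ is a tempered distribution. For a weight $m$ on $\mathbb R^{2n}$ and $p,q\in[1,\infty]$, $M^{p,q}_m(\mathbb R^n)$ is the space of all $f\in\mathcal S'(\mathbb R^n)$ with finite norm $$\|f\|_{M^{p,q}_m}=\Big\|\,\xi\mapsto\|V_gf(\cdot,\xi)\,m(\cdot,\xi)\|_{L^p(\mathbb R^n)}\Big\|_{L^q(\mathbb R^n)}$$ (for a fixed nonzero $g\in\mathcal S(\mathbb R^n)$), and $M^p_m=M^{p,p}_m$. Write $v_s(x,\xi)=(1+|x|^2+|\xi|^2)^{s/2}$ for $x,\xi\in\mathbb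 R^d$, and $(1\otimes v_s)(z,\zeta)=(1+|\zeta|^2)^{s/2}$ for $z,\zeta\in\mathbb R^{2d}$. Let $p'$ denote the conjugate exponent of $p$. The localization operator $A_a^{\varphi_1,\varphi_2}f=\int_{\mathbb R^{2d}}a(x,\xi)\,V_{\varphi_1}f(x,\xi)\,M_\xi T_x\varphi_2\,dx\,d\xi$ is understood weakly: $\langle A_a^{\varphi_1,\varphi_2}f,g\rangle=\langle a,\overline{V_{\varphi_1}f}\,V_{\varphi_2}g\rangle$ for $f,g\in\mathcal S(\mathbb R^d)$, where $\langle a,F\rangle=\|\Psi\|_2^{-2}\iint V_\Psi a\,\overline{V_\Psi F}$ is the duality of modulation spaces (absolutely convergent, for every nonzero window $\Psi\in\mathcal S(\mathbb R^{2d})$). For general $f\in M^{p_1,q_1}_{v_s}(\mathbb R^d)$ (where $\mathcal S$ need not be dense) it is given by $$\langle A_a^{\varphi_1,\varphi_2}f,g\rangle=\|\gamma\|_2^{-2}\iint V_\gamma f(x,\xi)\,\langle A_a^{\varphi_1,\varphi_2}(M_\xi T_x\gamma),g\rangle\,dx\,d\xi ,\qquad g\in\mathcal S(\mathbb R^d),$$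 absolutely convergent, for every nonzero $\gamma\in\mathcal S(\mathbb R^d)$. Theorem 5.2. Let $s\ge 0$, and let $p_1,q_1,p_2,q_2,p,q\in[1,\infty]$ satisfy $$\min\Big\{\frac1{p_1}+\frac1{p_2'},\ \frac1{q_1}+\frac1{q_2'}\Big\}\ \ge\ \frac1{p'}+\frac1{q'}\qquad\text{and}\qquad q\le\min\{p_1',q_1',p_2,q_2\}.$$ Let $r\in[1,2]$. If $a\in M^{p,q}_{1\otimes v_{-s}}(\mathbb R^{2d})$ and $\varphi_1,\varphi_2\in M^r_{v_{2s}}(\mathbb R^d)$, then the localization operator $A_a^{\varphi_1,\varphi_2}$ is well defined as a linear operator on $M^{p_1,q_1}_{v_s}(\mathbb R^d)$ and is bounded from $M^{p_1,q_1}_{v_s}(\mathbb R^d)$ to $M^{p_2,q_2}_{v_s}(\mathbb R^d)$, with $$\|A_a^{\varphi_1,\varphi_2}f\|_{M^{p_2,q_2}_{v_s}}\le C\,\|a\|_{M^{p,q}_{1\otimes v_{-s}}}\|\varphi_1\|_{M^r_{v_{2s}}}\|\varphi_2\|_{M^r_{v_{2s}}}\|f\|_{M^{p_1,q_1}_{v_s}},$$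 where $C$ depends only on $d$, $s$, the exponents and the windows used to define the norms, not on $a,\varphi_1,\varphi_2,f$. -/

import Mathlib

open MeasureTheory SchwartzMap Real
open scoped ENNReal NNReal InnerProductSpace ComplexConjugate

noncomputable section

namespace TimeFrequency

theorem hasTemperateGrowth_expI :
    Function.HasTemperateGrowth (fun t : ℝ => Complex.exp (t * Complex.I)) := by
  have hd : ∀ n : ℕ, iteratedDeriv n (fun t : ℝ => Complex.exp (t * Complex.I)) =
      fun t : ℝ => Complex.I ^ n * Complex.exp (t * Complex.I) := by
    intro n
    induction n with
    | zero => simp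
    | succ n ih =>
      rw [iteratedDeriv_succ, ih]
      funext t
      have h1 : HasDerivAt (fun t : ℝ => (t : ℂ) * Complex.I) (1 * Complex.I) t :=
        (Complex.ofRealCLM.hasDerivAt (x := t)).mul_const _
      rw [(h1.cexp.const_mul _).deriv]
      ring
  refine ⟨(Complex.ofRealCLM.contDiff.mul contDiff_const).cexp, fun n => ⟨0, 1, fun x => ?_⟩⟩
  rw [norm_iteratedFDeriv_eq_norm_iteratedDeriv, hd]
  simp [Complex.norm_exp_ofReal_mul_I]

section General

variable {V : Type*} [NormedAddCommGroup V] [InnerProductSpace ℝ V]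

/-- The character `t ↦ e^{2πi ξ·t}`. -/
def character (ξ t : V) : ℂ := Complex.exp ((2 * π * ⟪ξ, t⟫_ℝ : ℝ) * Complex.I)

theorem hasTemperateGrowth_character (ξ : V) : (character ξ).HasTemperateGrowth := by
  have h : Function.HasTemperateGrowth (fun t : V => 2 * π * ⟪ξ, t⟫_ℝ) := by fun_prop
  exact hasTemperateGrowth_expI.comp h

/-- Translation `T_x f(t) = f(t - x)` of Schwartz functions. -/
def translateS (x : V) (f : 𝓢(V, ℂ)) : 𝓢(V, ℂ) := compSubConstCLM ℂ x f

/-- Modulation `M_ξ f(t) = e^{2πi ξ·t} f(t)` of Schwartz functions. -/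
def modulateS (ξ : V) (f : 𝓢(V, ℂ)) : 𝓢(V, ℂ) := smulLeftCLM ℂ (character ξ) f

/-- Pointwise complex conjugation of Schwartz functions. -/
def conjS (f : 𝓢(V, ℂ)) : 𝓢(V, ℂ) := postcompCLM (Complex.conjCLE : ℂ →L[ℝ] ℂ) f

theorem translateS_apply (x : V) (f : 𝓢(V, ℂ)) (t : V) : translateS x f t = f (t - x) := rfl

theorem modulateS_apply (ξ : V) (f : 𝓢(V, ℂ)) (t : V) :
    modulateS ξ f t = character ξ t * f t := by
  simp [modulateS, smulLeftCLM_apply_apply (hasTemperateGrowth_character ξ)]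

theorem conjS_apply (f : 𝓢(V, ℂ)) (t : V) : conjS f t = conj (f t) := rfl

/-- The sesquilinear bracket `⟨f, g⟩` on `𝓢' × 𝓢` extending `∫ f(t) conj(g(t)) dt`. -/
def bracket (f : 𝓢'(V, ℂ)) (g : 𝓢(V, ℂ)) : ℂ := f (conjS g)

/-- The short-time Fourier transform `V_g f(x, ξ) = ⟨f, M_ξ T_x g⟩` of a tempered distribution `f`
with Schwartz window `g`. -/
def stft (g : 𝓢(V, ℂ)) (f : 𝓢'(V, ℂ)) (x ξ : V) : ℂ := bracket f (modulateS ξ (translateS x g))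

/-- The short-time Fourier transform `V_φ f(x, ξ) = ∫ f(t) conj(φ(t - x)) e^{-2πi ξ·t} dt` of a
Schwartz function `f`, where the window `φ` is a tempered distribution: since the adjoint of
`M_ξ T_x` is `T_{-x} M_{-ξ}`, this is the complex conjugate of `⟨φ, T_{-x} M_{-ξ} f⟩`. -/
def stftDistWindow (φ : 𝓢'(V, ℂ)) (f : 𝓢(V, ℂ)) (x ξ : V) : ℂ :=
  conj (bracket φ (translateS (-x) (modulateS (-ξ) f)))

/-- The weight `v_s(x, ξ) = (1 + |x|² + |ξ|²)^{s/2}`. -/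
def vWeight (s : ℝ) (x ξ : V) : ℝ := (1 + ‖x‖ ^ 2 + ‖ξ‖ ^ 2) ^ (s / 2)

/-- The weight `(1 ⊗ v_s)(z, ζ) = (1 + |ζ|²)^{s/2}`. -/
def oneTensorWeight (s : ℝ) (_z ζ : V) : ℝ := (1 + ‖ζ‖ ^ 2) ^ (s / 2)

variable [FiniteDimensional ℝ V] [MeasurableSpace V] [BorelSpace V]

/-- The short-time Fourier transform of a function `F` with Schwartz window `Φ`. -/
def stftFun (Φ : 𝓢(V, ℂ)) (F : V → ℂ) (z ζ : V) : ℂ :=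
  ∫ w, F w * conj (modulateS ζ (translateS z Φ) w)

/-- The weighted mixed Lebesgue norm of `L^{p,q}_m`: the `L^p` norm in the first variable (position),
followed by the `L^q` norm in the second variable (frequency). -/
def mixedNorm (p q : ℝ≥0∞) (m : V → V → ℝ) (F : V → V → ℂ) : ℝ≥0∞ :=
  eLpNorm (fun ξ => eLpNorm (fun x => (m x ξ : ℂ) * F x ξ) p volume) q volume

/-- The norm of `f` in the modulation space `M^{p,q}_m`, computed with the window `g`. -/
def modulationNorm (g : 𝓢(V, ℂ)) (p q : ℝ≥0∞) (m : V → V → ℝ) (f : 𝓢'(V, ℂ)) : ℝ≥0∞ :=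
  mixedNorm p q m (stft g f)

/-- The modulation space `M^{p,q}_m`, defined with the window `g`. -/
def modulationSpace (g : 𝓢(V, ℂ)) (p q : ℝ≥0∞) (m : V → V → ℝ) : Set 𝓢'(V, ℂ) :=
  {f | modulationNorm g p q m f < ∞}

/-- `IsExtendedPairing a F c` says that the sesquilinear pairing `⟨a, F⟩` of a tempered distribution
`a` with a (not necessarily Schwartz) function `F` is well defined, in the sense of the duality of
modulation spaces, and equal to `c`: for every Schwartz window `Ψ`, the integral
`∬ V_Ψ a · conj(V_Ψ F)` converges absolutely and has the value `‖Ψ‖₂² c`. For Schwartz `F` this is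
the usual bracket, by the orthogonality relations of the short-time Fourier transform. -/
def IsExtendedPairing (a : 𝓢'(V, ℂ)) (F : V → ℂ) (c : ℂ) : Prop :=
  ∀ Ψ : 𝓢(V, ℂ),
    Integrable (fun w : V × V => stft Ψ a w.1 w.2 * conj (stftFun Ψ F w.1 w.2)) ∧
    ∫ w : V × V, stft Ψ a w.1 w.2 * conj (stftFun Ψ F w.1 w.2) = (∫ t, ‖Ψ t‖ ^ 2 : ℝ) * c

end General

/-- `ℝ^d`. -/
abbrev Space (d : ℕ) : Type := EuclideanSpace ℝ (Fin d)

/-- The time-frequency plane `ℝ^{2d} = ℝ^d × ℝ^d`, with its Euclidean structure. -/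
abbrev PhaseSpace (d : ℕ) : Type := WithLp 2 (Space d × Space d)

variable {d : ℕ}

/-- The function `conj(V_{φ₁} f) · V_{φ₂} g` on the time-frequency plane. -/
def stftProduct (φ₁ φ₂ : 𝓢'(Space d, ℂ)) (f g : 𝓢(Space d, ℂ)) (w : PhaseSpace d) : ℂ :=
  conj (stftDistWindow φ₁ f w.fst w.snd) * stftDistWindow φ₂ g w.fst w.snd

/-- `T` is the localization operator
`A_a^{φ₁,φ₂} f = ∫ a(x, ξ) V_{φ₁} f(x, ξ) M_ξ T_x φ₂ dx dξ`, understood weakly on `T.domain`.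

On Schwartz functions, `⟨T f, g⟩ = ⟨a, conj(V_{φ₁} f) V_{φ₂} g⟩` for all Schwartz `g`. On the other
elements `f` of the domain (in which the Schwartz functions need not be dense), `T f` is obtained by
applying `T` under the integral to the expansion `‖γ‖₂² f = ∫ V_γ f(x, ξ) M_ξ T_x γ dx dξ` of `f`
into time-frequency shifts of an arbitrary Schwartz window `γ`, the integral being absolutely
convergent when tested against Schwartz functions. These conditions determine `T` on its domain. -/
structure IsLocalizationOperator (a : 𝓢'(PhaseSpace d, ℂ)) (φ₁ φ₂ : 𝓢'(Space d, ℂ))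
    (T : 𝓢'(Space d, ℂ) →ₗ.[ℂ] 𝓢'(Space d, ℂ)) : Prop where
  schwartz_mem : ∀ f : 𝓢(Space d, ℂ), (f : 𝓢'(Space d, ℂ)) ∈ T.domain
  weak_formula : ∀ f g : 𝓢(Space d, ℂ),
    IsExtendedPairing a (stftProduct φ₁ φ₂ f g) (bracket (T ⟨f, schwartz_mem f⟩) g)
  expansion : ∀ (f : T.domain) (γ g : 𝓢(Space d, ℂ)),
    Integrable (fun w : Space d × Space d => stft γ (f : 𝓢'(Space d, ℂ)) w.1 w.2 *
      bracket (T ⟨modulateS w.2 (translateS w.1 γ), schwartz_mem _⟩) g) ∧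
    ∫ w : Space d × Space d, stft γ (f : 𝓢'(Space d, ℂ)) w.1 w.2 *
      bracket (T ⟨modulateS w.2 (translateS w.1 γ), schwartz_mem _⟩) g =
      (∫ t, ‖γ t‖ ^ 2 : ℝ) * bracket (T f) g

end TimeFrequency

end

/-! The operator is transported to the time-frequency plane, where it becomes an integral operator
whose kernel can be estimated by a Young-type inequality. Let γ be the Gaussian on ℝ^d, G the
Gaussian on ℝ^{2d}, and J(ζ₁, ζ₂) = (ζ₂, -ζ₁). Up to a constant, ⟨A f, g⟩ is the integral of k(u,w)
V_γ f(u) conj(V_γ g(w)), where k(u,w) is the integral over z of V_G a(z, J(w-u)) conj(V_{π(-z)γ}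
φ₁(u)) V_{π(-z)γ} φ₂(w), with π(x,ξ) = M_ξ T_x.

This formula rests on the fact that |V_γ γ|² is a multiple of G (`exists_norm_sq_stft_gaussian`). A
translate of G therefore splits into two ambiguity functions, one for each factor of conj(V_{φ₁} f)
V_{φ₂} g. The Fourier transform of such a half is, by the orthogonality relations, a pointwise
product of two short-time Fourier transforms (`integral_ambiguityProduct`), and Parseval's identity
joins the halves (`exists_stftFun_gaussian_eq`). Since the formula is proved for tempered φ₁, φ₂ and
a, the orthogonality relations are needed for distributions, which is the purpose of
`integral_apply_tempered`.

With ζ = w - u, |k| is at most a constant times ∫ |V_G a(z, Jζ)| |V_γ φ₁(u-z)| |V_γ φ₂(u+ζ-z)| dz.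
For fixed ζ this is a convolution in u, so its L^P norm in u is at most ‖V_G a(·, Jζ)‖_P times the
correlation of |V_γ φ₁| and |V_γ φ₂| at ζ. Writing v_s = v_{-s} v_{2s} and distributing v_{2s}(ζ)
over the two windows, the Cauchy-Schwarz inequality and M^r ⊂ M² bound v_s(ζ) times the correlation
by v_{-s}(ζ) (`phaseWeight_mul_lintegral_le`). So v_s(ζ) k(u, u+ζ) lies in L^q in ζ of L^P in u as
soon as a is in M^{P,q} with weight 1 ⊗ v_{-s}.

For q ≤ P such kernels map L^α to L^β whenever 1/P + 1/α ≤ 1 ≤ 1/q + 1/α and 1/β + 1 = 1/P + 1/q +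
1/α (`lpNorm_twistedOp_le`). The endpoints α = P' and α = q' follow from the inequalities of
Minkowski and Hölder; positivity gives the intermediate cases by a pointwise geometric mean. The
bound extends to mixed norms (`mixedLpNorm_twistedOp_le`). The choice P = max(p,q), together with
the embeddings of modulation spaces with increasing exponents, reaches the whole stated range
(`exists_exponents`).

It remains to see that the kernel does define the operator. Off-diagonal decay of V_γ(π(w)g),
recorded as `smear`, makes the form a tempered distribution, bounds its modulation norm, and
justifies the uses of Fubini behind the expansion into time-frequency shifts
(`IsBoundedKernel.kernelForm_expansion`) and behind the passage from G to an arbitrary window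
(`integral_stft_mul_conj_stft_change_window`). -/

open MeasureTheory SchwartzMap Real
open scoped ENNReal NNReal InnerProductSpace ComplexConjugate

noncomputable section

namespace TimeFrequency

set_option linter.unusedSectionVars false

/-! ### Joint continuity and polynomial growth of time-frequency shifts on Schwartz space. -/

section SchwartzShifts

open Filter Topology Complex
open scoped FourierTransform

variable {V : Type*} [NormedAddCommGroup V] [InnerProductSpace ℝ V]

/-- The directed family of Schwartz seminorms `max_{k, l ≤ n} p_{k,l}`. -/
def supSeminorm (V : Type*) [NormedAddCommGroup V] [InnerProductSpace ℝ V] (n : ℕ) :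
    Seminorm ℂ 𝓢(V, ℂ) :=
  (Finset.Iic (n, n)).sup (schwartzSeminormFamily ℂ V ℂ)

theorem continuous_supSeminorm (n : ℕ) : Continuous (supSeminorm V n) := by
  have h : ∀ s : Finset (ℕ × ℕ), Continuous (s.sup (schwartzSeminormFamily ℂ V ℂ) : Seminorm ℂ 𝓢(V, ℂ)) := by
    intro s
    refine Finset.sup_induction (p := fun q : Seminorm ℂ 𝓢(V, ℂ) => Continuous q) ?_ ?_ ?_
    · exact continuous_const
    · intro a ha b hb
      exact ha.sup hb
    · intro i _
      exact (schwartz_withSeminorms ℂ V ℂ).continuous_seminorm i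
  exact h _

theorem seminorm_le_supSeminorm {k l n : ℕ} (hk : k ≤ n) (hl : l ≤ n) (φ : 𝓢(V, ℂ)) :
    SchwartzMap.seminorm ℂ k l φ ≤ supSeminorm V n φ :=
  Seminorm.le_def.1 (Finset.le_sup (f := schwartzSeminormFamily ℂ V ℂ)
    (Finset.mem_Iic.2 (Prod.mk_le_mk.2 ⟨hk, hl⟩))) φ

theorem supSeminorm_le {n : ℕ} {φ : 𝓢(V, ℂ)} {M : ℝ} (hM : 0 ≤ M)
    (h : ∀ k ≤ n, ∀ l ≤ n, ∀ t, ‖t‖ ^ k * ‖iteratedFDeriv ℝ l φ t‖ ≤ M) :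
    supSeminorm V n φ ≤ M := by
  refine Seminorm.finset_sup_apply_le hM fun i hi => ?_
  have := Finset.mem_Iic.1 hi
  exact φ.seminorm_le_bound ℂ i.1 i.2 hM (h i.1 this.1 i.2 this.2)

theorem exists_le_supSeminorm (p : Seminorm ℂ 𝓢(V, ℂ)) (hp : Continuous p) :
    ∃ (n : ℕ) (C : ℝ), 0 ≤ C ∧ ∀ φ, p φ ≤ C * supSeminorm V n φ := by
  obtain ⟨s, C, -, h⟩ := Seminorm.bound_of_continuous (schwartz_withSeminorms ℂ V ℂ) p hp
  refine ⟨s.sup (fun i => max i.1 i.2), C, C.2, fun φ => ?_⟩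
  refine (h φ).trans ?_
  refine mul_le_mul_of_nonneg_left ?_ C.2
  refine Seminorm.finset_sup_apply_le (apply_nonneg _ _) fun i hi => ?_
  have h1 : max i.1 i.2 ≤ s.sup (fun i => max i.1 i.2) :=
    Finset.le_sup (f := fun i : ℕ × ℕ => max i.1 i.2) hi
  exact seminorm_le_supSeminorm ((le_max_left _ _).trans h1) ((le_max_right _ _).trans h1) φ

theorem one_add_norm_pow_mul_le (n k l : ℕ) (hk : k ≤ n) (hl : l ≤ n) (φ : 𝓢(V, ℂ)) (t : V) :
    (1 + ‖t‖) ^ k * ‖iteratedFDeriv ℝ l φ t‖ ≤ 2 ^ n * supSeminorm V n φ :=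
  one_add_le_sup_seminorm_apply (𝕜 := ℂ) (m := (n, n)) hk hl φ t

theorem one_add_norm_le_mul (x t : V) : 1 + ‖t‖ ≤ (1 + ‖x‖) * (1 + ‖t - x‖) := by
  have : ‖t‖ ≤ ‖x‖ + ‖t - x‖ := by simpa using norm_add_le x (t - x)
  nlinarith [norm_nonneg x, norm_nonneg (t - x), mul_nonneg (norm_nonneg x) (norm_nonneg (t - x))]

theorem iteratedFDeriv_translateS (x : V) (φ : 𝓢(V, ℂ)) (l : ℕ) (t : V) :
    iteratedFDeriv ℝ l (translateS x φ) t = iteratedFDeriv ℝ l φ (t - x) :=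
  iteratedFDeriv_comp_sub l x t

theorem supSeminorm_translateS_le (n : ℕ) (x : V) (φ : 𝓢(V, ℂ)) :
    supSeminorm V n (translateS x φ) ≤ (1 + ‖x‖) ^ n * (2 ^ n * supSeminorm V n φ) := by
  have h0 : 0 ≤ supSeminorm V n φ := apply_nonneg _ _
  refine supSeminorm_le (by positivity) fun k hk l hl t => ?_
  rw [iteratedFDeriv_translateS]
  calc ‖t‖ ^ k * ‖iteratedFDeriv ℝ l φ (t - x)‖
      ≤ ((1 + ‖x‖) * (1 + ‖t - x‖)) ^ k * ‖iteratedFDeriv ℝ l φ (t - x)‖ := by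
        gcongr
        linarith [one_add_norm_le_mul x t]
    _ = (1 + ‖x‖) ^ k * ((1 + ‖t - x‖) ^ k * ‖iteratedFDeriv ℝ l φ (t - x)‖) := by
        rw [mul_pow]; ring
    _ ≤ (1 + ‖x‖) ^ n * (2 ^ n * supSeminorm V n φ) := by
        refine mul_le_mul ?_ (one_add_norm_pow_mul_le n k l hk hl φ _) (by positivity)
          (by positivity)
        exact pow_le_pow_right₀ (by linarith [norm_nonneg x]) hk

/-- Mean value inequality on the segment from b to a. Every point y of it is within distance 1 of a,
so 1 + ‖a‖ ≤ 2 (1 + ‖y‖); this is the source of the factor 2^k. -/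
theorem norm_iteratedFDeriv_sub_le (φ : 𝓢(V, ℂ)) (k l : ℕ) (a b : V) (hab : ‖a - b‖ ≤ 1) :
    (1 + ‖a‖) ^ k * ‖iteratedFDeriv ℝ l φ a - iteratedFDeriv ℝ l φ b‖ ≤
      2 ^ k * (2 ^ (k + l + 1) * supSeminorm V (k + l + 1) φ) * ‖a - b‖ := by
  set M := 2 ^ (k + l + 1) * supSeminorm V (k + l + 1) φ with hM
  have hM0 : 0 ≤ M := mul_nonneg (by positivity) (apply_nonneg _ _)
  have hpos : 0 < (1 + ‖a‖) ^ k := by positivity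
  have key : ∀ y ∈ segment ℝ b a, ‖fderiv ℝ (iteratedFDeriv ℝ l φ) y‖ ≤ 2 ^ k * M / (1 + ‖a‖) ^ k := by
    intro y hy
    rw [norm_fderiv_iteratedFDeriv, le_div_iff₀ hpos]
    have hya : ‖a - y‖ ≤ 1 := by
      have := norm_sub_le_of_mem_segment hy
      rw [norm_sub_rev]
      rw [norm_sub_rev] at hab
      have h2 := (mem_segment_iff_wbtw.1 hy).dist_add_dist
      rw [dist_eq_norm, dist_eq_norm, dist_eq_norm] at h2
      linarith [norm_nonneg (b - y)]
    have h1 : 1 + ‖a‖ ≤ 2 * (1 + ‖y‖) := by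
      have := one_add_norm_le_mul y a
      nlinarith [norm_nonneg y]
    calc ‖iteratedFDeriv ℝ (l + 1) φ y‖ * (1 + ‖a‖) ^ k
        ≤ ‖iteratedFDeriv ℝ (l + 1) φ y‖ * (2 * (1 + ‖y‖)) ^ k := by gcongr
      _ = 2 ^ k * ((1 + ‖y‖) ^ k * ‖iteratedFDeriv ℝ (l + 1) φ y‖) := by rw [mul_pow]; ring
      _ ≤ 2 ^ k * M := by
        gcongr
        exact one_add_norm_pow_mul_le _ k (l + 1) (by omega) (by omega) φ y
  have hd : ∀ y ∈ segment ℝ b a, DifferentiableAt ℝ (iteratedFDeriv ℝ l φ) y := fun y _ =>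
    ((φ.smooth ⊤).differentiable_iteratedFDeriv (mod_cast ENat.natCast_lt_top l)) y
  have := (convex_segment b a).norm_image_sub_le_of_norm_fderiv_le hd key
    (left_mem_segment ℝ b a) (right_mem_segment ℝ b a)
  calc (1 + ‖a‖) ^ k * ‖iteratedFDeriv ℝ l φ a - iteratedFDeriv ℝ l φ b‖
      ≤ (1 + ‖a‖) ^ k * (2 ^ k * M / (1 + ‖a‖) ^ k * ‖a - b‖) := by gcongr
    _ = 2 ^ k * M * ‖a - b‖ := by field_simp

/-- Translation is locally Lipschitz at the price of one more derivative. The index 2n + 1 dominates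
n + l + 1 for all l ≤ n. -/
theorem supSeminorm_translateS_sub_le (n : ℕ) (φ : 𝓢(V, ℂ)) (x x₀ : V) (h : ‖x - x₀‖ ≤ 1) :
    supSeminorm V n (translateS x φ - translateS x₀ φ) ≤
      (1 + ‖x₀‖) ^ n * (2 ^ n * (2 ^ (2 * n + 1) * supSeminorm V (2 * n + 1) φ)) * ‖x - x₀‖ := by
  have h0 : ∀ m, 0 ≤ supSeminorm V m φ := fun m => apply_nonneg _ _
  refine supSeminorm_le (by have := h0 (2 * n + 1); positivity) fun k hk l hl t => ?_
  have e1 : iteratedFDeriv ℝ l (⇑(translateS x φ - translateS x₀ φ)) t =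
      iteratedFDeriv ℝ l φ (t - x) - iteratedFDeriv ℝ l φ (t - x₀) := by
    rw [← iteratedFDeriv_translateS, ← iteratedFDeriv_translateS]
    have : (⇑(translateS x φ - translateS x₀ φ) : V → ℂ) =
      (⇑(translateS x φ) : V → ℂ) - ⇑(translateS x₀ φ) := rfl
    rw [this, iteratedFDeriv_sub_apply ((translateS x φ).smooth l).contDiffAt
      ((translateS x₀ φ).smooth l).contDiffAt]
  have hab : ‖(t - x₀) - (t - x)‖ = ‖x - x₀‖ := by congr 1; abel
  have hmono : supSeminorm V (n + l + 1) φ ≤ supSeminorm V (2 * n + 1) φ := by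
    refine supSeminorm_le (h0 _) fun k' hk' l' hl' t' => ?_
    exact (φ.le_seminorm ℂ k' l' t').trans (seminorm_le_supSeminorm (by omega) (by omega) φ)
  have hk2 := norm_iteratedFDeriv_sub_le φ n l (t - x₀) (t - x) (by rw [hab]; exact h)
  rw [hab] at hk2
  rw [e1, norm_sub_rev]
  calc ‖t‖ ^ k * ‖iteratedFDeriv ℝ l φ (t - x₀) - iteratedFDeriv ℝ l φ (t - x)‖
      ≤ ((1 + ‖x₀‖) * (1 + ‖t - x₀‖)) ^ n *
        ‖iteratedFDeriv ℝ l φ (t - x₀) - iteratedFDeriv ℝ l φ (t - x)‖ := by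
        gcongr
        calc ‖t‖ ^ k ≤ (1 + ‖t‖) ^ k := by gcongr; linarith
          _ ≤ (1 + ‖t‖) ^ n := pow_le_pow_right₀ (by linarith [norm_nonneg t]) hk
          _ ≤ _ := by gcongr; exact one_add_norm_le_mul x₀ t
    _ = (1 + ‖x₀‖) ^ n * ((1 + ‖t - x₀‖) ^ n *
        ‖iteratedFDeriv ℝ l φ (t - x₀) - iteratedFDeriv ℝ l φ (t - x)‖) := by
        rw [mul_pow]; ring
    _ ≤ (1 + ‖x₀‖) ^ n * (2 ^ n * (2 ^ (n + l + 1) * supSeminorm V (n + l + 1) φ) * ‖x - x₀‖) := by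
        gcongr
    _ ≤ (1 + ‖x₀‖) ^ n * (2 ^ n * (2 ^ (2 * n + 1) * supSeminorm V (2 * n + 1) φ) * ‖x - x₀‖) := by
        have := h0 (n + l + 1)
        gcongr
        · norm_num
        · omega
    _ = _ := by ring

theorem tendsto_of_supSeminorm {ι : Type*} {f : Filter ι} {u : ι → 𝓢(V, ℂ)} {φ : 𝓢(V, ℂ)}
    (h : ∀ n, Tendsto (fun i => supSeminorm V n (u i - φ)) f (𝓝 0)) : Tendsto u f (𝓝 φ) := by
  rw [(schwartz_withSeminorms ℂ V ℂ).tendsto_nhds]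
  intro i ε hε
  filter_upwards [(h (max i.1 i.2)).eventually (gt_mem_nhds hε)] with j hj
  exact (seminorm_le_supSeminorm (le_max_left _ _) (le_max_right _ _) _).trans_lt hj

theorem continuous_translateS : Continuous (fun w : V × 𝓢(V, ℂ) => translateS w.1 w.2) := by
  rw [continuous_iff_continuousAt]
  rintro ⟨x₀, φ₀⟩
  refine tendsto_of_supSeminorm fun n => ?_
  have hx : Tendsto (fun w : V × 𝓢(V, ℂ) => ‖w.1 - x₀‖) (𝓝 (x₀, φ₀)) (𝓝 0) := by
    have : Continuous (fun w : V × 𝓢(V, ℂ) => ‖w.1 - x₀‖) := by fun_prop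
    simpa using this.tendsto (x₀, φ₀)
  have hφ : Tendsto (fun w : V × 𝓢(V, ℂ) => supSeminorm V n (w.2 - φ₀)) (𝓝 (x₀, φ₀)) (𝓝 0) := by
    have : Continuous (fun w : V × 𝓢(V, ℂ) => supSeminorm V n (w.2 - φ₀)) :=
      (continuous_supSeminorm n).comp (continuous_snd.sub continuous_const)
    simpa using this.tendsto (x₀, φ₀)
  have hN : Tendsto (fun w : V × 𝓢(V, ℂ) => (1 + ‖w.1‖) ^ n) (𝓝 (x₀, φ₀))
      (𝓝 ((1 + ‖x₀‖) ^ n)) := by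
    have : Continuous (fun w : V × 𝓢(V, ℂ) => (1 + ‖w.1‖) ^ n) := by fun_prop
    simpa using this.tendsto (x₀, φ₀)
  have hlim := (hN.mul (hφ.const_mul (2 ^ n))).add (hx.const_mul
    ((1 + ‖x₀‖) ^ n * (2 ^ n * (2 ^ (2 * n + 1) * supSeminorm V (2 * n + 1) φ₀))))
  simp only [mul_zero, add_zero] at hlim
  refine tendsto_of_tendsto_of_tendsto_of_le_of_le' tendsto_const_nhds hlim
    (Eventually.of_forall fun w => apply_nonneg _ _) ?_
  filter_upwards [hx.eventually (gt_mem_nhds zero_lt_one)] with w hw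
  -- The change of the function is controlled by the polynomial growth of translations, the change
  -- of the translation parameter by the Lipschitz bound for the fixed φ₀.
  have e : translateS w.1 w.2 - translateS x₀ φ₀ =
      translateS w.1 (w.2 - φ₀) + (translateS w.1 φ₀ - translateS x₀ φ₀) := by
    simp [translateS, map_sub]
  change supSeminorm V n (translateS w.1 w.2 - translateS x₀ φ₀) ≤ _
  rw [e]
  refine (map_add_le_add _ _ _).trans (add_le_add ?_ ?_)
  · exact supSeminorm_translateS_le n w.1 _
  · exact supSeminorm_translateS_sub_le n φ₀ w.1 x₀ hw.le

theorem norm_character (ξ t : V) : ‖character ξ t‖ = 1 := by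
  rw [character, Complex.norm_exp_ofReal_mul_I]

variable [FiniteDimensional ℝ V] [MeasurableSpace V] [BorelSpace V]

theorem fourier_modulateS (ξ : V) (φ : 𝓢(V, ℂ)) : 𝓕 (modulateS ξ φ) = translateS ξ (𝓕 φ) := by
  ext w
  rw [translateS_apply, fourier_coe, fourier_coe, Real.fourier_eq', Real.fourier_eq']
  refine integral_congr_ae (Eventually.of_forall fun t => ?_)
  simp only [modulateS_apply, smul_eq_mul, character]
  rw [← mul_assoc, ← Complex.exp_add]
  congr 2
  rw [inner_sub_right, real_inner_comm ξ t]
  push_cast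
  ring

/-- Conjugation by the Fourier transform lets modulations inherit continuity and growth bounds from
translations, so no derivative of a character has to be estimated. -/
theorem modulateS_eq (ξ : V) (φ : 𝓢(V, ℂ)) : modulateS ξ φ = 𝓕⁻ (translateS ξ (𝓕 φ)) := by
  rw [← fourier_modulateS, FourierTransform.fourierInv_fourier_eq]

theorem fourier_translateS (x : V) (φ : 𝓢(V, ℂ)) : 𝓕 (translateS x φ) = modulateS (-x) (𝓕 φ) := by
  ext w
  rw [modulateS_apply, fourier_coe, fourier_coe, Real.fourier_eq', Real.fourier_eq',
    ← integral_const_mul, ← integral_add_right_eq_self _ x]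
  refine integral_congr_ae (Eventually.of_forall fun t => ?_)
  simp only [translateS_apply, smul_eq_mul, character, add_sub_cancel_right]
  rw [← mul_assoc, ← Complex.exp_add]
  congr 2
  rw [inner_add_left, inner_neg_left]
  push_cast
  ring

theorem continuous_modulateS : Continuous (fun w : V × 𝓢(V, ℂ) => modulateS w.1 w.2) := by
  simp only [modulateS_eq]
  have h1 : Continuous (fun φ : 𝓢(V, ℂ) => 𝓕 φ) := (fourierTransformCLM ℂ).continuous
  have h2 : Continuous (fun φ : 𝓢(V, ℂ) => 𝓕⁻ φ) := FourierTransform.continuous_fourierInv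
  exact h2.comp (continuous_translateS.comp (continuous_fst.prodMk (h1.comp continuous_snd)))

/-- The time-frequency shift `π(x, ξ) = M_ξ T_x` of Schwartz functions. -/
def shiftS (w : V × V) (φ : 𝓢(V, ℂ)) : 𝓢(V, ℂ) := modulateS w.2 (translateS w.1 φ)

theorem continuous_shiftS : Continuous (fun w : (V × V) × 𝓢(V, ℂ) => shiftS w.1 w.2) := by
  have h1 : Continuous (fun w : (V × V) × 𝓢(V, ℂ) => translateS w.1.1 w.2) :=
    continuous_translateS.comp ((continuous_fst.comp continuous_fst).prodMk continuous_snd)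
  exact continuous_modulateS.comp ((continuous_snd.comp continuous_fst).prodMk h1)

theorem exists_supSeminorm_translateS_le (p : Seminorm ℂ 𝓢(V, ℂ)) (hp : Continuous p) :
    ∃ (n : ℕ) (q : Seminorm ℂ 𝓢(V, ℂ)), Continuous q ∧
      ∀ x φ, p (translateS x φ) ≤ (1 + ‖x‖) ^ n * q φ := by
  obtain ⟨n, C, hC, h⟩ := exists_le_supSeminorm p hp
  refine ⟨n, (C * 2 ^ n).toNNReal • supSeminorm V n, ?_, fun x φ => ?_⟩
  · exact (continuous_supSeminorm n).const_smul _
  · refine (h _).trans ?_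
    refine (mul_le_mul_of_nonneg_left (supSeminorm_translateS_le n x φ) hC).trans (le_of_eq ?_)
    rw [_root_.smul_apply, NNReal.smul_def, Real.coe_toNNReal _ (by positivity), smul_eq_mul]
    ring

/-- Polynomial growth in w is what the rapid decay of the short-time Fourier transform of a Schwartz
function can absorb; integrals of shifts against such transforms then converge in every seminorm. -/
theorem exists_seminorm_shiftS_le (p : Seminorm ℂ 𝓢(V, ℂ)) (hp : Continuous p) :
    ∃ (n : ℕ) (q : Seminorm ℂ 𝓢(V, ℂ)), Continuous q ∧
      ∀ (w : V × V) φ, p (shiftS w φ) ≤ (1 + ‖w.1‖) ^ n * (1 + ‖w.2‖) ^ n * q φ := by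
  have h1 : Continuous (fun φ : 𝓢(V, ℂ) => 𝓕 φ) := (fourierTransformCLM ℂ).continuous
  have h2 : Continuous (fun φ : 𝓢(V, ℂ) => 𝓕⁻ φ) := FourierTransform.continuous_fourierInv
  let L1 : 𝓢(V, ℂ) →ₗ[ℂ] 𝓢(V, ℂ) := (FourierTransform.fourierCLE ℂ 𝓢(V, ℂ)).toLinearMap
  let L2 : 𝓢(V, ℂ) →ₗ[ℂ] 𝓢(V, ℂ) := (FourierTransform.fourierCLE ℂ 𝓢(V, ℂ)).symm.toLinearMap
  obtain ⟨n, q, hq, hn⟩ := exists_supSeminorm_translateS_le (p.comp L2) (hp.comp h2)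
  obtain ⟨m, q', hq', hm⟩ := exists_supSeminorm_translateS_le (q.comp L1) (hq.comp h1)
  refine ⟨n + m, q', hq', fun w φ => ?_⟩
  have hx : 1 ≤ 1 + ‖w.1‖ := by linarith [norm_nonneg w.1]
  have hξ : 1 ≤ 1 + ‖w.2‖ := by linarith [norm_nonneg w.2]
  have h0 : 0 ≤ q' φ := apply_nonneg _ _
  calc p (shiftS w φ) = (p.comp L2) (translateS w.2 (𝓕 (translateS w.1 φ))) := by
        rw [shiftS, modulateS_eq]; rfl
    _ ≤ (1 + ‖w.2‖) ^ n * q (𝓕 (translateS w.1 φ)) := hn _ _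
    _ ≤ (1 + ‖w.2‖) ^ n * ((1 + ‖w.1‖) ^ m * q' φ) := by
        gcongr
        exact hm _ _
    _ ≤ (1 + ‖w.2‖) ^ (n + m) * ((1 + ‖w.1‖) ^ (n + m) * q' φ) := by
        gcongr <;> omega
    _ = _ := by ring

theorem shiftS_apply (w : V × V) (φ : 𝓢(V, ℂ)) (t : V) :
    shiftS w φ t = character w.2 t * φ (t - w.1) := by
  rw [shiftS, modulateS_apply, translateS_apply]

theorem continuous_conjS : Continuous (conjS : 𝓢(V, ℂ) → 𝓢(V, ℂ)) :=
  (postcompCLM (Complex.conjCLE : ℂ →L[ℝ] ℂ)).continuous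

theorem continuous_bracket (F : 𝓢'(V, ℂ)) : Continuous (bracket F) :=
  F.continuous.comp continuous_conjS

theorem stft_eq (g : 𝓢(V, ℂ)) (F : 𝓢'(V, ℂ)) (x ξ : V) :
    stft g F x ξ = bracket F (shiftS (x, ξ) g) := rfl

theorem continuous_stft (g : 𝓢(V, ℂ)) (F : 𝓢'(V, ℂ)) :
    Continuous (fun w : V × V => stft g F w.1 w.2) :=
  (continuous_bracket F).comp (continuous_shiftS.comp (continuous_id.prodMk continuous_const))

end SchwartzShifts

/-! ### Phase rules, decay of the transform of Schwartz functions, growth for distributions. -/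

section Decay

open Filter Topology Complex
open scoped FourierTransform

variable {V : Type*} [NormedAddCommGroup V] [InnerProductSpace ℝ V]
  [FiniteDimensional ℝ V] [MeasurableSpace V] [BorelSpace V]

theorem character_add_right (ξ s t : V) :
    character ξ (s + t) = character ξ s * character ξ t := by
  rw [character, character, character, ← Complex.exp_add, inner_add_right]
  congr 1
  push_cast
  ring

theorem character_neg_left (ξ t : V) : character (-ξ) t = conj (character ξ t) := by
  rw [character, character, ← Complex.exp_conj, inner_neg_left, map_mul, Complex.conj_ofReal,
    Complex.conj_I]
  congr 1
  push_cast
  ring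

theorem character_add_left (ξ η t : V) :
    character (ξ + η) t = character ξ t * character η t := by
  rw [character, character, character, ← Complex.exp_add, inner_add_left]
  congr 1
  push_cast
  ring

theorem character_comm (ξ t : V) : character ξ t = character t ξ := by
  rw [character, character, real_inner_comm]

theorem character_neg_right (ξ t : V) : character ξ (-t) = conj (character ξ t) := by
  rw [character_comm, character_neg_left, character_comm]

theorem continuous_character : Continuous (fun w : V × V => character w.1 w.2) := by
  unfold character
  fun_prop

theorem translateS_modulateS (x ξ : V) (φ : 𝓢(V, ℂ)) :
    translateS x (modulateS ξ φ) = conj (character ξ x) • shiftS (x, ξ) φ := by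
  ext t
  simp only [translateS_apply, modulateS_apply, smul_apply, smul_eq_mul, shiftS_apply]
  rw [sub_eq_add_neg, character_add_right, character_neg_right]
  ring

theorem conjS_shiftS (w : V × V) (φ : 𝓢(V, ℂ)) :
    conjS (shiftS w φ) = shiftS (w.1, -w.2) (conjS φ) := by
  ext t
  simp [conjS_apply, shiftS_apply, character_neg_left]

theorem stft_coe (γ g : 𝓢(V, ℂ)) (x ξ : V) :
    stft γ (g : 𝓢'(V, ℂ)) x ξ = ∫ t, conj (shiftS (x, ξ) γ t) * g t := by
  rw [stft_eq, bracket, SchwartzMap.coe_apply]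
  rfl

theorem bracket_coe (f g : 𝓢(V, ℂ)) :
    bracket (f : 𝓢'(V, ℂ)) g = ∫ t, conj (g t) * f t := by
  rw [bracket, SchwartzMap.coe_apply]
  rfl

theorem bracket_coe_fourier (f g : 𝓢(V, ℂ)) :
    bracket (f : 𝓢'(V, ℂ)) g = bracket ((𝓕 f : 𝓢(V, ℂ)) : 𝓢'(V, ℂ)) (𝓕 g) := by
  have := integral_inner_fourier_fourier g f
  simp only [RCLike.inner_apply'] at this
  rw [bracket_coe, bracket_coe]
  exact this.symm

theorem bracket_smul_right (F : 𝓢'(V, ℂ)) (c : ℂ) (g : 𝓢(V, ℂ)) :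
    bracket F (c • g) = conj c * bracket F g := by
  have : conjS (c • g) = conj c • conjS g := by
    ext t
    simp [conjS_apply]
  rw [bracket, this, map_smul, smul_eq_mul, bracket]

/-- Parseval's identity rotates the time-frequency plane, so decay in ξ is decay in position for the
Fourier transforms of γ and g. -/
theorem norm_stft_coe_fourier (γ g : 𝓢(V, ℂ)) (x ξ : V) :
    ‖stft γ (g : 𝓢'(V, ℂ)) x ξ‖ =
      ‖stft (𝓕 γ) ((𝓕 g : 𝓢(V, ℂ)) : 𝓢'(V, ℂ)) ξ (-x)‖ := by
  rw [stft_eq, bracket_coe_fourier, shiftS, fourier_modulateS, fourier_translateS,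
    translateS_modulateS, bracket_smul_right, ← stft_eq, norm_mul, Complex.conj_conj,
    norm_character, one_mul]

theorem integrable_one_add_norm_pow_mul (φ : 𝓢(V, ℂ)) (N : ℕ) :
    Integrable (fun t => (1 + ‖t‖) ^ N * ‖φ t‖) := by
  have h1 : Integrable (fun t => 2 ^ (N - 1) * (‖φ t‖ + ‖t‖ ^ N * ‖φ t‖)) :=
    (φ.integrable.norm.add (φ.integrable_pow_mul volume N)).const_mul _
  refine h1.mono' (by fun_prop) (Eventually.of_forall fun t => ?_)
  rw [Real.norm_of_nonneg (by positivity)]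
  calc (1 + ‖t‖) ^ N * ‖φ t‖ ≤ (2 ^ (N - 1) * (1 ^ N + ‖t‖ ^ N)) * ‖φ t‖ := by
        gcongr
        exact add_pow_le zero_le_one (norm_nonneg t) N
    _ = _ := by ring

theorem one_add_norm_pow_mul_norm_stft_le (γ g : 𝓢(V, ℂ)) (N : ℕ) (x ξ : V) :
    (1 + ‖x‖) ^ N * ‖stft γ (g : 𝓢'(V, ℂ)) x ξ‖ ≤
      (∫ t, (1 + ‖t‖) ^ N * ‖γ t‖) * (2 ^ N * supSeminorm V N g) := by
  rw [stft_coe, ← integral_mul_const,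
    ← integral_sub_right_eq_self (fun t => (1 + ‖t‖) ^ N * ‖γ t‖ * (2 ^ N * supSeminorm V N g)) x]
  have hpos : 0 ≤ (1 + ‖x‖) ^ N := by positivity
  calc (1 + ‖x‖) ^ N * ‖∫ t, conj (shiftS (x, ξ) γ t) * g t‖
      ≤ (1 + ‖x‖) ^ N * ∫ t, ‖conj (shiftS (x, ξ) γ t) * g t‖ := by
        gcongr
        exact norm_integral_le_integral_norm _
    _ = ∫ t, (1 + ‖x‖) ^ N * ‖conj (shiftS (x, ξ) γ t) * g t‖ := by
        rw [integral_const_mul]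
    _ ≤ _ := by
        refine integral_mono_of_nonneg (Eventually.of_forall fun t => by positivity) ?_
          (Eventually.of_forall fun t => ?_)
        · exact ((integrable_one_add_norm_pow_mul γ N).comp_sub_right x).mul_const _
        · simp only [norm_mul, RCLike.norm_conj, shiftS_apply, norm_character, one_mul]
          have h1 : (1 + ‖x‖) ^ N ≤ ((1 + ‖t‖) * (1 + ‖t - x‖)) ^ N := by
            have := one_add_norm_le_mul t x
            rw [norm_sub_rev] at this
            gcongr
          have h2 := one_add_norm_pow_mul_le N N 0 le_rfl (by omega) g t
          rw [norm_iteratedFDeriv_zero] at h2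
          calc (1 + ‖x‖) ^ N * (‖γ (t - x)‖ * ‖g t‖)
              ≤ ((1 + ‖t‖) * (1 + ‖t - x‖)) ^ N * (‖γ (t - x)‖ * ‖g t‖) := by gcongr
            _ = (1 + ‖t - x‖) ^ N * ‖γ (t - x)‖ * ((1 + ‖t‖) ^ N * ‖g t‖) := by
              rw [mul_pow]; ring
            _ ≤ _ := by gcongr

theorem exists_seminorm_stft_le (γ : 𝓢(V, ℂ)) (N : ℕ) :
    ∃ q : Seminorm ℂ 𝓢(V, ℂ), Continuous q ∧ ∀ (g : 𝓢(V, ℂ)) (x ξ : V),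
      (1 + ‖x‖) ^ N * (1 + ‖ξ‖) ^ N * ‖stft γ (g : 𝓢'(V, ℂ)) x ξ‖ ≤ q g := by
  let L : 𝓢(V, ℂ) →ₗ[ℂ] 𝓢(V, ℂ) := (FourierTransform.fourierCLE ℂ 𝓢(V, ℂ)).toLinearMap
  have hL : Continuous L := (fourierTransformCLM ℂ).continuous
  -- Twice the required order in each variable separately: a product of two N-th powers is at most
  -- the sum of their squares.
  set M := 2 * N
  set A : ℝ := (∫ t, (1 + ‖t‖) ^ M * ‖γ t‖) * 2 ^ M
  set B : ℝ := (∫ t, (1 + ‖t‖) ^ M * ‖(𝓕 γ : 𝓢(V, ℂ)) t‖) * 2 ^ M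
  have hA : 0 ≤ A := mul_nonneg (integral_nonneg fun t => by positivity) (by positivity)
  have hB : 0 ≤ B := mul_nonneg (integral_nonneg fun t => by positivity) (by positivity)
  refine ⟨A.toNNReal • supSeminorm V M + B.toNNReal • (supSeminorm V M).comp L, ?_,
    fun g x ξ => ?_⟩
  · exact ((continuous_supSeminorm M).const_smul _).add
      (((continuous_supSeminorm M).comp hL).const_smul _)
  · have h1 : (1 + ‖x‖) ^ M * ‖stft γ (g : 𝓢'(V, ℂ)) x ξ‖ ≤ A * supSeminorm V M g := by
      refine (one_add_norm_pow_mul_norm_stft_le γ g M x ξ).trans (le_of_eq ?_)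
      ring
    have h2 : (1 + ‖ξ‖) ^ M * ‖stft γ (g : 𝓢'(V, ℂ)) x ξ‖ ≤ B * supSeminorm V M (𝓕 g) := by
      rw [norm_stft_coe_fourier]
      refine (one_add_norm_pow_mul_norm_stft_le (𝓕 γ) (𝓕 g) M ξ (-x)).trans (le_of_eq ?_)
      ring
    have e : (A.toNNReal • supSeminorm V M + B.toNNReal • (supSeminorm V M).comp L) g =
        A * supSeminorm V M g + B * supSeminorm V M (𝓕 g) := by
      rw [_root_.add_apply, _root_.smul_apply, _root_.smul_apply, NNReal.smul_def, NNReal.smul_def,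
        Real.coe_toNNReal _ hA, Real.coe_toNNReal _ hB]
      rfl
    rw [e]
    have h3 : (1 + ‖x‖) ^ N * (1 + ‖ξ‖) ^ N ≤ (1 + ‖x‖) ^ M + (1 + ‖ξ‖) ^ M := by
      have hx : 0 ≤ (1 + ‖x‖) ^ N := by positivity
      have hξ : 0 ≤ (1 + ‖ξ‖) ^ N := by positivity
      rw [show M = N * 2 by omega, pow_mul, pow_mul]
      nlinarith [sq_nonneg ((1 + ‖x‖) ^ N - (1 + ‖ξ‖) ^ N)]
    calc _ ≤ ((1 + ‖x‖) ^ M + (1 + ‖ξ‖) ^ M) * ‖stft γ (g : 𝓢'(V, ℂ)) x ξ‖ := by gcongr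
      _ ≤ _ := by rw [add_mul]; exact add_le_add h1 h2

/-- The decay profile `(1 + |x|)^{-N}`. -/
def decay (N : ℕ) (x : V) : ℝ := ((1 + ‖x‖) ^ N)⁻¹

theorem decay_pos (N : ℕ) (x : V) : 0 < decay N x := by
  unfold decay
  positivity

theorem continuous_decay (N : ℕ) : Continuous (decay N : V → ℝ) := by
  unfold decay
  exact (by fun_prop : Continuous fun x : V => (1 + ‖x‖) ^ N).inv₀ fun x => by positivity

theorem integrable_decay {N : ℕ} (hN : Module.finrank ℝ V < N) : Integrable (decay N : V → ℝ) := by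
  have := integrable_one_add_norm (E := V) (μ := volume) (r := N) (by exact_mod_cast hN)
  refine this.congr (Eventually.of_forall fun x => ?_)
  simp only [decay]
  rw [Real.rpow_neg (by positivity), Real.rpow_natCast]

theorem exists_norm_stft_coe_le_decay (γ : 𝓢(V, ℂ)) (N : ℕ) :
    ∃ q : Seminorm ℂ 𝓢(V, ℂ), Continuous q ∧ ∀ (g : 𝓢(V, ℂ)) (x ξ : V),
      ‖stft γ (g : 𝓢'(V, ℂ)) x ξ‖ ≤ q g * (decay N x * decay N ξ) := by
  obtain ⟨q, hq, h⟩ := exists_seminorm_stft_le γ N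
  refine ⟨q, hq, fun g x ξ => ?_⟩
  have := h g x ξ
  rw [decay, decay, ← mul_inv, ← div_eq_mul_inv, le_div_iff₀ (by positivity)]
  linarith

theorem norm_le_exists_seminorm (F : 𝓢'(V, ℂ)) (γ : 𝓢(V, ℂ)) :
    ∃ (n : ℕ) (C : ℝ), 0 ≤ C ∧ ∀ x ξ : V,
      ‖stft γ F x ξ‖ ≤ C * ((1 + ‖x‖) ^ n * (1 + ‖ξ‖) ^ n) := by
  obtain ⟨n, q, -, h⟩ := exists_seminorm_shiftS_le
    ((normSeminorm ℂ ℂ).comp (F : 𝓢(V, ℂ) →L[ℂ] ℂ).toLinearMap) (F.continuous.norm)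
  refine ⟨n, q (conjS γ), apply_nonneg _ _, fun x ξ => ?_⟩
  rw [stft_eq, bracket, conjS_shiftS]
  have := h (x, -ξ) (conjS γ)
  rw [norm_neg] at this
  rw [mul_comm]
  exact this

end Decay

/-! ### Applying a tempered distribution under the integral sign. -/

section WeakIntegral

open Filter Topology BoundedContinuousFunction
open scoped LineDeriv

variable {V : Type*} [NormedAddCommGroup V] [InnerProductSpace ℝ V]

/-- The Banach space of bounded continuous functions with values in `l`-linear forms. -/
def BoundedForms (V : Type*) [NormedAddCommGroup V] [InnerProductSpace ℝ V] (l : ℕ) : Type _ :=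
  V →ᵇ (V [×l]→L[ℝ] ℂ)

instance (l : ℕ) : NormedAddCommGroup (BoundedForms V l) :=
  inferInstanceAs (NormedAddCommGroup (V →ᵇ (V [×l]→L[ℝ] ℂ)))

instance (l : ℕ) : NormedSpace ℂ (BoundedForms V l) :=
  inferInstanceAs (NormedSpace ℂ (V →ᵇ (V [×l]→L[ℝ] ℂ)))

instance (l : ℕ) : CompleteSpace (BoundedForms V l) :=
  inferInstanceAs (CompleteSpace (V →ᵇ (V [×l]→L[ℝ] ℂ)))

/-- The evaluation of a bounded continuous function with values in `l`-linear forms. -/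
def BoundedForms.eval {l : ℕ} (x : V) (m : Fin l → V) : BoundedForms V l →L[ℂ] ℂ :=
  LinearMap.mkContinuous
    { toFun := fun f => (show V →ᵇ (V [×l]→L[ℝ] ℂ) from f) x m
      map_add' := fun _ _ => rfl
      map_smul' := fun _ _ => rfl } (∏ i, ‖m i‖) fun f => by
    rw [mul_comm]
    exact (ContinuousMultilinearMap.le_opNorm _ m).trans (mul_le_mul_of_nonneg_right
      (BoundedContinuousFunction.norm_coe_le_norm (show V →ᵇ (V [×l]→L[ℝ] ℂ) from f) x)
      (Finset.prod_nonneg fun i _ => norm_nonneg (m i)))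

theorem BoundedForms.ext {l : ℕ} {f g : BoundedForms V l}
    (h : ∀ x m, BoundedForms.eval x m f = BoundedForms.eval x m g) : f = g :=
  BoundedContinuousFunction.ext fun x => ContinuousMultilinearMap.ext fun m => h x m

/-- The bounded continuous function `x ↦ ‖x‖^k D^l φ(x)`. -/
def weightedDeriv (i : ℕ × ℕ) : 𝓢(V, ℂ) →ₗ[ℂ] BoundedForms V i.2 where
  toFun φ := BoundedContinuousFunction.ofNormedAddCommGroup
    (fun x => ‖x‖ ^ i.1 • iteratedFDeriv ℝ i.2 φ x)
    ((continuous_norm.pow _).smul ((φ.smooth i.2).continuous_iteratedFDeriv le_rfl))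
    (SchwartzMap.seminorm ℂ i.1 i.2 φ) (fun x => by
      rw [norm_smul, norm_pow, norm_norm]
      exact φ.le_seminorm ℂ i.1 i.2 x)
  map_add' φ ψ := by
    refine BoundedContinuousFunction.ext fun x => ?_
    have : (⇑(φ + ψ) : V → ℂ) = (⇑φ : V → ℂ) + ⇑ψ := rfl
    change ‖x‖ ^ i.1 • iteratedFDeriv ℝ i.2 (⇑(φ + ψ)) x =
      ‖x‖ ^ i.1 • iteratedFDeriv ℝ i.2 φ x + ‖x‖ ^ i.1 • iteratedFDeriv ℝ i.2 ψ x
    rw [this, iteratedFDeriv_add_apply (φ.smooth i.2).contDiffAt (ψ.smooth i.2).contDiffAt, smul_add]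
  map_smul' c φ := by
    refine BoundedContinuousFunction.ext fun x => ?_
    have : (⇑(c • φ) : V → ℂ) = c • (⇑φ : V → ℂ) := rfl
    change ‖x‖ ^ i.1 • iteratedFDeriv ℝ i.2 (⇑(c • φ)) x =
      c • (‖x‖ ^ i.1 • iteratedFDeriv ℝ i.2 φ x)
    rw [this, iteratedFDeriv_const_smul_apply (φ.smooth i.2).contDiffAt, smul_comm]

theorem eval_weightedDeriv (i : ℕ × ℕ) (φ : 𝓢(V, ℂ)) (x : V) (m : Fin i.2 → V) :
    BoundedForms.eval x m (weightedDeriv i φ) = ‖x‖ ^ i.1 • (∂^{m} φ : 𝓢(V, ℂ)) x := by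
  rw [iteratedLineDerivOp_eq_iteratedFDeriv]
  rfl

theorem norm_weightedDeriv_le (i : ℕ × ℕ) (φ : 𝓢(V, ℂ)) :
    ‖weightedDeriv i φ‖ ≤ SchwartzMap.seminorm ℂ i.1 i.2 φ :=
  BoundedContinuousFunction.norm_ofNormedAddCommGroup_le _ (apply_nonneg _ _) fun x => by
    rw [norm_smul, norm_pow, norm_norm]
    exact φ.le_seminorm ℂ i.1 i.2 x

theorem seminorm_le_norm_weightedDeriv (i : ℕ × ℕ) (φ : 𝓢(V, ℂ)) :
    SchwartzMap.seminorm ℂ i.1 i.2 φ ≤ ‖weightedDeriv i φ‖ := by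
  refine φ.seminorm_le_bound ℂ i.1 i.2 (norm_nonneg (weightedDeriv i φ)) fun x => ?_
  have : ‖‖x‖ ^ i.1 • iteratedFDeriv ℝ i.2 φ x‖ ≤ ‖weightedDeriv i φ‖ :=
    BoundedContinuousFunction.norm_coe_le_norm
      (show V →ᵇ (V [×i.2]→L[ℝ] ℂ) from weightedDeriv i φ) x
  rwa [norm_smul, norm_pow, norm_norm] at this

theorem continuous_weightedDeriv (i : ℕ × ℕ) :
    Continuous (weightedDeriv i : 𝓢(V, ℂ) → BoundedForms V i.2) := by
  rw [continuous_iff_continuousAt]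
  intro φ
  refine (tendsto_iff_norm_sub_tendsto_zero (b := weightedDeriv i φ)).2 ?_
  have h : Continuous fun ψ : 𝓢(V, ℂ) => SchwartzMap.seminorm ℂ i.1 i.2 (ψ - φ) :=
    ((schwartz_withSeminorms ℂ V ℂ).continuous_seminorm i).comp (continuous_id.sub continuous_const)
  have h0 := h.tendsto φ
  simp only [sub_self, map_zero] at h0
  refine squeeze_zero (fun _ => norm_nonneg _) (fun ψ => ?_) h0
  rw [← map_sub (weightedDeriv i)]
  exact norm_weightedDeriv_le i (ψ - φ)

variable {W : Type*} [TopologicalSpace W] [MeasurableSpace W] [OpensMeasurableSpace W]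
  [SecondCountableTopology W] {μ : Measure W} {c : W → ℂ} {Θ : W → 𝓢(V, ℂ)} {φ : 𝓢(V, ℂ)}

theorem integrable_mul_continuous (hc : Continuous c) (hΘ : Continuous Θ)
    (hint : ∀ k l, Integrable (fun w => ‖c w‖ * SchwartzMap.seminorm ℂ k l (Θ w)) μ)
    {E : Type*} [NormedAddCommGroup E] [NormedSpace ℂ E] (L : 𝓢(V, ℂ) → E) (hL : Continuous L)
    {k l : ℕ} {C : ℝ} (hC : ∀ ψ, ‖L ψ‖ ≤ C * SchwartzMap.seminorm ℂ k l ψ) :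
    Integrable (fun w => c w • L (Θ w)) μ := by
  refine ((hint k l).const_mul C).mono' (hc.smul (hL.comp hΘ)).aestronglyMeasurable
    (Eventually.of_forall fun w => ?_)
  rw [norm_smul]
  calc ‖c w‖ * ‖L (Θ w)‖ ≤ ‖c w‖ * (C * SchwartzMap.seminorm ℂ k l (Θ w)) := by
        gcongr
        exact hC _
    _ = _ := by ring

theorem continuous_iteratedLineDerivOp_apply {n : ℕ} (m : Fin n → V) (x : V) :
    Continuous fun ψ : 𝓢(V, ℂ) => (∂^{m} ψ) x := by
  have h1 : Continuous fun ψ : 𝓢(V, ℂ) => (∂^{m} ψ : 𝓢(V, ℂ)) :=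
    (LineDeriv.iteratedLineDerivOpCLM ℂ 𝓢(V, ℂ) m).continuous
  have h2 : Continuous fun ψ : 𝓢(V, ℂ) => ψ x := (TemperedDistribution.delta x).continuous
  exact h2.comp h1

theorem norm_iteratedLineDerivOp_apply_le {n : ℕ} (m : Fin n → V) (x : V) (ψ : 𝓢(V, ℂ)) :
    ‖(∂^{m} ψ : 𝓢(V, ℂ)) x‖ ≤ (∏ i, ‖m i‖) * SchwartzMap.seminorm ℂ 0 n ψ := by
  rw [iteratedLineDerivOp_eq_iteratedFDeriv, mul_comm]
  refine ((iteratedFDeriv ℝ n ψ x).le_opNorm m).trans ?_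
  gcongr
  exact ψ.norm_iteratedFDeriv_le_seminorm ℂ n x

/-- Induction on the number of directions. Both sides of the identity for `Fin.tail m` are
differentiated along the line through x in direction `m 0`; the seminorm of order n + 1 dominates,
and uniqueness of derivatives concludes. -/
theorem integral_iteratedLineDerivOp (hc : Continuous c) (hΘ : Continuous Θ)
    (hint : ∀ k l, Integrable (fun w => ‖c w‖ * SchwartzMap.seminorm ℂ k l (Θ w)) μ)
    (hpt : ∀ x, ∫ w, c w • Θ w x ∂μ = φ x) {n : ℕ} (m : Fin n → V) (x : V) :
    ∫ w, c w • (∂^{m} (Θ w) : 𝓢(V, ℂ)) x ∂μ = (∂^{m} φ : 𝓢(V, ℂ)) x := by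
  have hI : ∀ {n : ℕ} (m : Fin n → V) (x : V),
      Integrable (fun w => c w • (∂^{m} (Θ w) : 𝓢(V, ℂ)) x) μ := fun m x =>
    integrable_mul_continuous hc hΘ hint (fun ψ => (∂^{m} ψ : 𝓢(V, ℂ)) x)
      (continuous_iteratedLineDerivOp_apply m x) (norm_iteratedLineDerivOp_apply_le m x)
  induction n generalizing x with
  | zero => simpa using hpt x
  | succ n ih =>
    have hd : ∀ (ψ : 𝓢(V, ℂ)) (ε : ℝ), HasDerivAt
        (fun ε : ℝ => (∂^{Fin.tail m} ψ : 𝓢(V, ℂ)) (x + ε • m 0))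
        ((∂^{m} ψ : 𝓢(V, ℂ)) (x + ε • m 0)) ε := by
      intro ψ ε
      rw [LineDeriv.iteratedLineDerivOp_succ_left, lineDerivOp_apply_eq_fderiv]
      have h1 := (∂^{Fin.tail m} ψ : 𝓢(V, ℂ)).hasFDerivAt (x + ε • m 0)
      have h2 : HasDerivAt (fun ε : ℝ => x + ε • m 0) (m 0) ε := by
        simpa using ((hasDerivAt_id ε).smul_const (m 0)).const_add x
      exact h1.comp_hasDerivAt ε h2
    have key := (hasDerivAt_integral_of_dominated_loc_of_deriv_le (μ := μ) (x₀ := (0 : ℝ))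
      (s := Set.univ)
      (F := fun (ε : ℝ) w => c w • (∂^{Fin.tail m} (Θ w) : 𝓢(V, ℂ)) (x + ε • m 0))
      (F' := fun (ε : ℝ) w => c w • (∂^{m} (Θ w) : 𝓢(V, ℂ)) (x + ε • m 0))
      (bound := fun w => (∏ i, ‖m i‖) * (‖c w‖ * SchwartzMap.seminorm ℂ 0 (n + 1) (Θ w)))
      Filter.univ_mem
      (Eventually.of_forall fun ε => (hI _ _).aestronglyMeasurable)
      (hI _ _) (hI _ _).aestronglyMeasurable
      (Eventually.of_forall fun w ε _ => by
        rw [norm_smul]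
        calc _ ≤ ‖c w‖ * ((∏ i, ‖m i‖) * SchwartzMap.seminorm ℂ 0 (n + 1) (Θ w)) := by
              gcongr
              exact norm_iteratedLineDerivOp_apply_le m _ _
          _ = _ := by ring)
      ((hint 0 (n + 1)).const_mul _)
      (Eventually.of_forall fun w ε _ => (hd (Θ w) ε).const_smul (c w))).2
    simp only [ih] at key
    have := key.unique (hd φ 0)
    simpa using this

/-- The integral is taken in the Banach space K, the closure of the set of pairs (Jψ, Fψ). On K the
second component is still bounded by C times the first. The integral of c (JΘ, FΘ) and the pair (Jφ,
Fφ) both lie in K and have the same first component, hence the same second one. This avoids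
extending F from the range of J. -/
theorem integral_apply_of_factor {E : Type*} [NormedAddCommGroup E] [NormedSpace ℂ E]
    [CompleteSpace E] (hc : Continuous c) (hΘ : Continuous Θ) (J : 𝓢(V, ℂ) →ₗ[ℂ] E)
    (hJ : Continuous J) (hJΘ : Integrable (fun w => c w • J (Θ w)) μ)
    (hJφ : ∫ w, c w • J (Θ w) ∂μ = J φ) (F : 𝓢'(V, ℂ)) (C : ℝ) (hC : 0 ≤ C)
    (hFJ : ∀ ψ, ‖F ψ‖ ≤ C * ‖J ψ‖) :
    Integrable (fun w => c w • F (Θ w)) μ ∧ ∫ w, c w • F (Θ w) ∂μ = F φ := by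
  let G : 𝓢(V, ℂ) →ₗ[ℂ] E × ℂ := J.prod (F : 𝓢(V, ℂ) →L[ℂ] ℂ).toLinearMap
  have hG : Continuous G := hJ.prodMk F.continuous
  let K : Submodule ℂ (E × ℂ) := (LinearMap.range G).topologicalClosure
  have hK : IsClosed (K : Set (E × ℂ)) := Submodule.isClosed_topologicalClosure _
  have : CompleteSpace K := hK.completeSpace_coe
  have hKle : ∀ z ∈ K, ‖z.2‖ ≤ C * ‖z.1‖ := by
    intro z hz
    have hcl : IsClosed {z : E × ℂ | ‖z.2‖ ≤ C * ‖z.1‖} :=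
      isClosed_le (by fun_prop) (by fun_prop)
    refine closure_minimal ?_ hcl hz
    rintro _ ⟨ψ, rfl⟩
    exact hFJ ψ
  have hmem : ∀ ψ, G ψ ∈ K := fun ψ => Submodule.le_topologicalClosure _ ⟨ψ, rfl⟩
  let f : W → K := fun w => c w • ⟨G (Θ w), hmem _⟩
  have hf : Integrable f μ := by
    have hcont : Continuous f := hc.smul ((hG.comp hΘ).subtype_mk _)
    refine (hJΘ.norm.const_mul (1 + C)).mono' hcont.aestronglyMeasurable
      (Eventually.of_forall fun w => ?_)
    rw [norm_smul, norm_smul]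
    have h3 : 0 ≤ ‖J (Θ w)‖ := norm_nonneg _
    have hle : ‖G (Θ w)‖ ≤ (1 + C) * ‖J (Θ w)‖ := by
      refine max_le ?_ ((hFJ _).trans ?_)
      · change ‖J (Θ w)‖ ≤ _
        nlinarith
      · nlinarith
    calc ‖c w‖ * ‖G (Θ w)‖ ≤ ‖c w‖ * ((1 + C) * ‖J (Θ w)‖) := by gcongr
      _ = _ := by ring
  let sndL : K →L[ℂ] ℂ := (ContinuousLinearMap.snd ℂ E ℂ).comp K.subtypeL
  let fstL : K →L[ℂ] E := (ContinuousLinearMap.fst ℂ E ℂ).comp K.subtypeL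
  have hsnd : sndL (∫ w, f w ∂μ) = ∫ w, c w • F (Θ w) ∂μ := by
    rw [← sndL.integral_comp_comm hf]
    rfl
  have hfst : fstL (∫ w, f w ∂μ) = J φ := by
    rw [← fstL.integral_comp_comm hf, ← hJφ]
    rfl
  refine ⟨sndL.integrable_comp hf, ?_⟩
  have h0 : ‖sndL (∫ w, f w ∂μ) - F φ‖ ≤ C * ‖fstL (∫ w, f w ∂μ) - J φ‖ :=
    hKle _ (K.sub_mem (∫ w, f w ∂μ).2 (hmem φ))
  rw [hfst, sub_self, norm_zero, mul_zero] at h0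
  rw [← hsnd]
  exact sub_eq_zero.1 (norm_le_zero_iff.1 h0)

/-- Evaluations at a point on given directions separate the elements of `BoundedForms`, so the
vector-valued identity reduces to differentiation under a scalar integral. -/
theorem integral_weightedDeriv (hc : Continuous c) (hΘ : Continuous Θ)
    (hint : ∀ k l, Integrable (fun w => ‖c w‖ * SchwartzMap.seminorm ℂ k l (Θ w)) μ)
    (hpt : ∀ x, ∫ w, c w • Θ w x ∂μ = φ x) (i : ℕ × ℕ) :
    Integrable (fun w => c w • weightedDeriv i (Θ w)) μ ∧
      ∫ w, c w • weightedDeriv i (Θ w) ∂μ = weightedDeriv i φ := by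
  have hI : Integrable (fun w => c w • weightedDeriv i (Θ w)) μ :=
    integrable_mul_continuous hc hΘ hint _ (continuous_weightedDeriv i) (C := 1)
      (fun ψ => by rw [one_mul]; exact norm_weightedDeriv_le i ψ)
  refine ⟨hI, ?_⟩
  refine BoundedForms.ext fun x m => ?_
  rw [← ContinuousLinearMap.integral_comp_comm _ hI, eval_weightedDeriv,
    ← integral_iteratedLineDerivOp hc hΘ hint hpt, ← integral_smul]
  refine integral_congr_ae (Eventually.of_forall fun w => ?_)
  change BoundedForms.eval x m (c w • weightedDeriv i (Θ w)) = _
  rw [map_smul, eval_weightedDeriv, smul_comm]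

/-- A tempered distribution can be applied under the integral to a pointwise identity
`∫ c(w) Θ(w) dw = φ` between Schwartz functions, if all seminorms of the integrand are integrable. -/
theorem integral_apply_tempered (hc : Continuous c) (hΘ : Continuous Θ)
    (hint : ∀ k l, Integrable (fun w => ‖c w‖ * SchwartzMap.seminorm ℂ k l (Θ w)) μ)
    (hpt : ∀ x, ∫ w, c w • Θ w x ∂μ = φ x) (F : 𝓢'(V, ℂ)) :
    Integrable (fun w => c w • F (Θ w)) μ ∧ ∫ w, c w • F (Θ w) ∂μ = F φ := by
  obtain ⟨s, C, -, hF⟩ := Seminorm.bound_of_continuous (schwartz_withSeminorms ℂ V ℂ)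
    ((normSeminorm ℂ ℂ).comp (F : 𝓢(V, ℂ) →L[ℂ] ℂ).toLinearMap) (F.continuous.norm)
  replace hF : ∀ ψ, ‖F ψ‖ ≤ C * s.sup (schwartzSeminormFamily ℂ V ℂ) ψ := hF
  -- F is bounded by finitely many Schwartz seminorms; the corresponding weighted derivatives form
  -- one map into a finite product of Banach spaces whose norm controls F.
  let J : 𝓢(V, ℂ) →ₗ[ℂ] ((i : s) → BoundedForms V i.1.2) :=
    LinearMap.pi fun i => weightedDeriv i.1
  have hJΘ : Integrable (fun w => c w • J (Θ w)) μ :=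
    Integrable.of_eval fun (i : s) => (integral_weightedDeriv hc hΘ hint hpt i.1).1
  refine integral_apply_of_factor hc hΘ J
    (continuous_pi fun i => continuous_weightedDeriv i.1) hJΘ ?_ F C C.2 ?_
  · funext i
    exact (eval_integral (fun j : s => (integral_weightedDeriv hc hΘ hint hpt j.1).1) i).trans
      (integral_weightedDeriv hc hΘ hint hpt i.1).2
  · intro ψ
    refine (hF ψ).trans (mul_le_mul_of_nonneg_left ?_ C.2)
    refine Seminorm.finset_sup_apply_le (norm_nonneg (J ψ)) fun i hi => ?_
    exact (seminorm_le_norm_weightedDeriv i ψ).trans (norm_le_pi_norm (J ψ) ⟨i, hi⟩)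

end WeakIntegral

/-! ### Inversion, orthogonality relations and covariance. -/

section Orthogonality

open Filter Topology
open scoped FourierTransform

variable {V : Type*} [NormedAddCommGroup V] [InnerProductSpace ℝ V]
  [FiniteDimensional ℝ V] [MeasurableSpace V] [BorelSpace V]

theorem integrable_decay_prod {N : ℕ} (hN : Module.finrank ℝ V < N) :
    Integrable (fun w : V × V => decay N w.1 * decay N w.2) :=
  (integrable_decay hN).mul_prod (integrable_decay hN)

theorem one_add_norm_pow_mul_decay (n N : ℕ) (x : V) :
    (1 + ‖x‖) ^ n * decay (n + N) x = decay N x := by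
  have : (1 + ‖x‖) ^ n ≠ 0 := by positivity
  rw [decay, decay, pow_add, mul_inv, ← mul_assoc, mul_inv_cancel₀ this, one_mul]

theorem integrable_stft_coe (γ g : 𝓢(V, ℂ)) :
    Integrable (fun w : V × V => stft γ (g : 𝓢'(V, ℂ)) w.1 w.2) := by
  obtain ⟨q, -, h⟩ := exists_norm_stft_coe_le_decay γ (Module.finrank ℝ V + 1)
  exact ((integrable_decay_prod (Nat.lt_succ_self _)).const_mul (q g)).mono'
    (continuous_stft γ _).aestronglyMeasurable (Eventually.of_forall fun w => h g w.1 w.2)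

/-- Multiplication of a Schwartz function by the conjugate of a translated window. -/
def windowed (γ g : 𝓢(V, ℂ)) (x : V) : 𝓢(V, ℂ) :=
  SchwartzMap.smulLeftCLM ℂ (g : V → ℂ) (conjS (translateS x γ))

theorem windowed_apply (γ g : 𝓢(V, ℂ)) (x t : V) :
    windowed γ g x t = g t * conj (γ (t - x)) := by
  rw [windowed, SchwartzMap.smulLeftCLM_apply_apply g.hasTemperateGrowth, conjS_apply,
    translateS_apply, smul_eq_mul]

theorem stft_coe_eq_fourier (γ g : 𝓢(V, ℂ)) (x ξ : V) :
    stft γ (g : 𝓢'(V, ℂ)) x ξ = (𝓕 (windowed γ g x) : 𝓢(V, ℂ)) ξ := by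
  rw [stft_coe, fourier_coe, Real.fourier_eq']
  refine integral_congr_ae (Eventually.of_forall fun t => ?_)
  simp only [shiftS_apply, windowed_apply, smul_eq_mul, map_mul]
  rw [← character_neg_left, character, inner_neg_left, real_inner_comm]
  rw [show 2 * π * -⟪t, ξ⟫_ℝ = -2 * π * ⟪t, ξ⟫_ℝ by ring]
  ring

/-- For fixed x the short-time Fourier transform is the Fourier transform of g times a translated
window. Fourier inversion in ξ recovers that product at t; the remaining integral over x, after the
reflection x ↦ t - x, is the pairing of the windows. -/
theorem integral_stft_mul_shiftS_apply (γ₁ γ₂ g : 𝓢(V, ℂ)) (t : V) :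
    ∫ w : V × V, stft γ₂ (g : 𝓢'(V, ℂ)) w.1 w.2 * shiftS w γ₁ t =
      (∫ s, γ₁ s * conj (γ₂ s)) * g t := by
  have hint : Integrable (fun w : V × V => stft γ₂ (g : 𝓢'(V, ℂ)) w.1 w.2 * shiftS w γ₁ t) := by
    refine (integrable_stft_coe γ₂ g).mul_bdd (c := SchwartzMap.seminorm ℂ 0 0 γ₁) ?_ ?_
    · have h2 : Continuous fun ψ : 𝓢(V, ℂ) => ψ t := (TemperedDistribution.delta t).continuous
      exact (h2.comp (continuous_shiftS.comp
        (continuous_id.prodMk continuous_const))).aestronglyMeasurable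
    · refine Eventually.of_forall fun w => ?_
      rw [shiftS_apply, norm_mul, norm_character, one_mul]
      exact γ₁.norm_le_seminorm ℂ _
  have hint' := hint
  rw [Measure.volume_eq_prod] at hint' ⊢
  rw [integral_prod _ hint', ← integral_mul_const, ← integral_sub_left_eq_self _ volume t]
  refine integral_congr_ae (Eventually.of_forall fun x => ?_)
  simp only [stft_coe_eq_fourier, shiftS_apply]
  have h1 : (𝓕⁻ (𝓕 (windowed γ₂ g (t - x))) : 𝓢(V, ℂ)) t = windowed γ₂ g (t - x) t := by
    rw [FourierTransform.fourierInv_fourier_eq]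
  rw [fourierInv_coe, Real.fourierInv_eq', windowed_apply] at h1
  calc ∫ ξ, (𝓕 (windowed γ₂ g (t - x)) : 𝓢(V, ℂ)) ξ * (character ξ t * γ₁ (t - (t - x)))
      = ∫ ξ, (Complex.exp (↑(2 * π * ⟪ξ, t⟫_ℝ) * Complex.I) •
          (𝓕 (windowed γ₂ g (t - x)) : 𝓢(V, ℂ)) ξ) * γ₁ (t - (t - x)) := by
        refine integral_congr_ae (Eventually.of_forall fun ξ => ?_)
        simp only [character, smul_eq_mul]
        ring
    _ = _ := by
        rw [integral_mul_const, h1, sub_sub_cancel]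
        ring

theorem integrable_stft_mul_seminorm (γ₁ γ₂ g : 𝓢(V, ℂ)) (k l : ℕ) :
    Integrable (fun w : V × V => ‖conj (stft γ₂ (g : 𝓢'(V, ℂ)) w.1 w.2)‖ *
      SchwartzMap.seminorm ℂ k l (conjS (shiftS w γ₁))) := by
  obtain ⟨n, q, -, hq⟩ := exists_seminorm_shiftS_le (SchwartzMap.seminorm ℂ k l)
    ((schwartz_withSeminorms ℂ V ℂ).continuous_seminorm (k, l))
  obtain ⟨q', -, hq'⟩ := exists_norm_stft_coe_le_decay γ₂ (n + (Module.finrank ℝ V + 1))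
  have hcont : Continuous fun w : V × V => ‖conj (stft γ₂ (g : 𝓢'(V, ℂ)) w.1 w.2)‖ *
      SchwartzMap.seminorm ℂ k l (conjS (shiftS w γ₁)) := by
    refine (Complex.continuous_conj.comp (continuous_stft γ₂ _)).norm.mul ?_
    exact ((schwartz_withSeminorms ℂ V ℂ).continuous_seminorm (k, l)).comp
      (continuous_conjS.comp (continuous_shiftS.comp (continuous_id.prodMk continuous_const)))
  refine ((integrable_decay_prod (V := V) (Nat.lt_succ_self _)).const_mul
    (q' g * q (conjS γ₁))).mono' hcont.aestronglyMeasurable (Eventually.of_forall fun w => ?_)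
  have h0 : 0 ≤ SchwartzMap.seminorm ℂ k l (conjS (shiftS w γ₁)) := apply_nonneg _ _
  have h1 : SchwartzMap.seminorm ℂ k l (conjS (shiftS w γ₁)) ≤
      (1 + ‖w.1‖) ^ n * (1 + ‖w.2‖) ^ n * q (conjS γ₁) := by
    rw [conjS_shiftS]
    have := hq (w.1, -w.2) (conjS γ₁)
    rwa [norm_neg] at this
  have h2 : 0 ≤ q' g := apply_nonneg _ _
  have h3 := decay_pos (n + (Module.finrank ℝ V + 1)) w.1
  have h4 := decay_pos (n + (Module.finrank ℝ V + 1)) w.2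
  rw [norm_mul, norm_norm, Real.norm_of_nonneg h0, RCLike.norm_conj]
  calc _ ≤ (q' g * (decay (n + (Module.finrank ℝ V + 1)) w.1 *
        decay (n + (Module.finrank ℝ V + 1)) w.2)) *
        ((1 + ‖w.1‖) ^ n * (1 + ‖w.2‖) ^ n * q (conjS γ₁)) := by
        gcongr
        exact hq' g w.1 w.2
    _ = q' g * q (conjS γ₁) * (((1 + ‖w.1‖) ^ n * decay (n + (Module.finrank ℝ V + 1)) w.1) *
        ((1 + ‖w.2‖) ^ n * decay (n + (Module.finrank ℝ V + 1)) w.2)) := by ring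
    _ = _ := by rw [one_add_norm_pow_mul_decay, one_add_norm_pow_mul_decay]

/-- Orthogonality relations of the short-time Fourier transform, for a tempered distribution. -/
theorem integral_stft_mul_conj_stft (F : 𝓢'(V, ℂ)) (γ₁ γ₂ g : 𝓢(V, ℂ)) :
    Integrable (fun w : V × V => stft γ₁ F w.1 w.2 * conj (stft γ₂ (g : 𝓢'(V, ℂ)) w.1 w.2)) ∧
    ∫ w : V × V, stft γ₁ F w.1 w.2 * conj (stft γ₂ (g : 𝓢'(V, ℂ)) w.1 w.2) =
      bracket (γ₂ : 𝓢'(V, ℂ)) γ₁ * bracket F g := by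
  have hc : Continuous fun w : V × V => conj (stft γ₂ (g : 𝓢'(V, ℂ)) w.1 w.2) :=
    Complex.continuous_conj.comp (continuous_stft γ₂ _)
  have hΘ : Continuous fun w : V × V => conjS (shiftS w γ₁) :=
    continuous_conjS.comp (continuous_shiftS.comp (continuous_id.prodMk continuous_const))
  -- The distribution F is applied under the conjugate of the pointwise inversion formula for g.
  have key := integral_apply_tempered hc hΘ (integrable_stft_mul_seminorm γ₁ γ₂ g)
    (φ := bracket (γ₂ : 𝓢'(V, ℂ)) γ₁ • conjS g) (fun t => by
      have := congrArg conj (integral_stft_mul_shiftS_apply γ₁ γ₂ g t)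
      rw [← integral_conj, map_mul, ← integral_conj] at this
      simp only [map_mul, Complex.conj_conj] at this
      simp only [smul_eq_mul, conjS_apply, smul_apply, bracket_coe]
      exact this) F
  have e : ∀ w : V × V, conj (stft γ₂ (g : 𝓢'(V, ℂ)) w.1 w.2) • F (conjS (shiftS w γ₁)) =
      stft γ₁ F w.1 w.2 * conj (stft γ₂ (g : 𝓢'(V, ℂ)) w.1 w.2) := fun w => mul_comm _ _
  simp only [e] at key
  refine ⟨key.1, key.2.trans ?_⟩
  rw [map_smul, smul_eq_mul, bracket, bracket]

theorem bracket_coe_conj (f g : 𝓢(V, ℂ)) :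
    conj (bracket (f : 𝓢'(V, ℂ)) g) = bracket (g : 𝓢'(V, ℂ)) f := by
  rw [bracket_coe, bracket_coe, ← integral_conj]
  refine integral_congr_ae (Eventually.of_forall fun t => ?_)
  simp [mul_comm]

theorem bracket_coe_self (g : 𝓢(V, ℂ)) : bracket (g : 𝓢'(V, ℂ)) g = ((∫ t, ‖g t‖ ^ 2 : ℝ) : ℂ) := by
  rw [bracket_coe, ← integral_complex_ofReal]
  refine integral_congr_ae (Eventually.of_forall fun t => ?_)
  simp [Complex.conj_mul']

theorem integrable_norm_sq (g : 𝓢(V, ℂ)) : Integrable fun t => ‖g t‖ ^ 2 := by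
  have : MemLp g ((2 : ℕ) : ℝ≥0∞) volume := g.memLp 2
  exact this.integrable_norm_pow two_ne_zero

theorem integral_norm_sq_pos {g : 𝓢(V, ℂ)} (hg : g ≠ 0) : 0 < ∫ t, ‖g t‖ ^ 2 := by
  obtain ⟨t, ht⟩ : ∃ t, g t ≠ 0 := by
    by_contra! h
    exact hg (SchwartzMap.ext h)
  have hc : Continuous fun t => ‖g t‖ ^ 2 := g.continuous.norm.pow 2
  rw [integral_pos_iff_support_of_nonneg (fun t => by positivity) (integrable_norm_sq g)]
  exact hc.isOpen_support.measure_pos volume ⟨t, by simpa using ht⟩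

/-- Covariance with its explicit phase. The exact kernel formula needs the phase; the estimates use
only the modulus. -/
theorem bracket_shiftS_shiftS (w z : V × V) (γ g : 𝓢(V, ℂ)) :
    bracket ((shiftS w g : 𝓢(V, ℂ)) : 𝓢'(V, ℂ)) (shiftS z γ) =
      character (w.2 - z.2) w.1 * stft γ (g : 𝓢'(V, ℂ)) (z.1 - w.1) (z.2 - w.2) := by
  rw [stft_coe, bracket_coe, ← integral_const_mul,
    ← integral_add_right_eq_self (fun t => conj (shiftS z γ t) * shiftS w g t) w.1]
  refine integral_congr_ae (Eventually.of_forall fun t => ?_)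
  simp only [shiftS_apply, map_mul, add_sub_cancel_right]
  rw [show t - (z.1 - w.1) = t + w.1 - z.1 by abel]
  simp only [← character_neg_left]
  rw [character_add_right, character_add_right, show -(z.2 - w.2) = -z.2 + w.2 by abel,
    show w.2 - z.2 = w.2 + -z.2 by abel]
  simp only [character_add_left]
  ring

theorem norm_stft_shiftS (w z : V × V) (γ g : 𝓢(V, ℂ)) :
    ‖stft γ ((shiftS w g : 𝓢(V, ℂ)) : 𝓢'(V, ℂ)) z.1 z.2‖ =
      ‖stft γ (g : 𝓢'(V, ℂ)) (z.1 - w.1) (z.2 - w.2)‖ := by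
  rw [stft_eq, bracket_shiftS_shiftS, norm_mul, norm_character, one_mul]

end Orthogonality

/-! ### Inequalities of Hölder and Minkowski for functions with values in [0, ∞]. -/

section LebesgueNorms

open Filter Topology

variable {α β : Type*} [MeasurableSpace α] [MeasurableSpace β] {μ : Measure α} {ν : Measure β}

theorem lpNorm_eq_lintegral {p : ℝ≥0∞} (h0 : p ≠ 0) (ht : p ≠ ∞) (f : α → ℝ≥0∞) :
    eLpNorm f p μ = (∫⁻ x, f x ^ p.toReal ∂μ) ^ (p.toReal)⁻¹ := by
  rw [eLpNorm_eq_lintegral_rpow_enorm_toReal h0 ht, one_div]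
  rfl

theorem lpNorm_mono {p : ℝ≥0∞} {f g : α → ℝ≥0∞} (h : ∀ x, f x ≤ g x) :
    eLpNorm f p μ ≤ eLpNorm g p μ := eLpNorm_mono_enorm h

theorem lpNorm_mono_ae {p : ℝ≥0∞} {f g : α → ℝ≥0∞} (h : ∀ᵐ x ∂μ, f x ≤ g x) :
    eLpNorm f p μ ≤ eLpNorm g p μ := eLpNorm_mono_enorm_ae h

theorem ae_le_lpNorm_top (f : α → ℝ≥0∞) : ∀ᵐ x ∂μ, f x ≤ eLpNorm f ∞ μ := by
  rw [eLpNorm_exponent_top]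
  exact ae_le_eLpNormEssSup (f := f)

theorem lpNorm_top_le {f : α → ℝ≥0∞} {C : ℝ≥0∞} (h : ∀ᵐ x ∂μ, f x ≤ C) : eLpNorm f ∞ μ ≤ C := by
  rw [eLpNorm_exponent_top]
  exact essSup_le_of_ae_le C h

theorem lpNorm_const_mul {p : ℝ≥0∞} {f : α → ℝ≥0∞} (hf : Measurable f) (c : ℝ≥0∞) :
    eLpNorm (fun x => c * f x) p μ ≤ c * eLpNorm f p μ := by
  rcases eq_or_ne p 0 with rfl | h0
  · simp
  rcases eq_or_ne p ∞ with rfl | ht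
  · exact lpNorm_top_le ((ae_le_lpNorm_top f).mono fun x hx => by gcongr)
  · have hp := ENNReal.toReal_pos h0 ht
    rw [lpNorm_eq_lintegral h0 ht, lpNorm_eq_lintegral h0 ht]
    simp_rw [ENNReal.mul_rpow_of_nonneg _ _ hp.le]
    rw [lintegral_const_mul _ (hf.pow_const _),
      ENNReal.mul_rpow_of_nonneg _ _ (inv_nonneg.2 hp.le), ENNReal.rpow_rpow_inv hp.ne']

theorem lpNorm_one (f : α → ℝ≥0∞) : eLpNorm f 1 μ = ∫⁻ x, f x ∂μ := by
  rw [eLpNorm_one_eq_lintegral_enorm]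
  rfl

theorem lpNorm_rpow {p : ℝ≥0∞} {r : ℝ} (hr : 0 < r) (f : α → ℝ≥0∞) :
    eLpNorm (fun x => f x ^ r) p μ = eLpNorm f (p * ENNReal.ofReal r) μ ^ r :=
  eLpNorm_enorm_rpow f hr

/-- Hölder's inequality. -/
theorem lintegral_mul_le_lpNorm {p q : ℝ≥0∞} (hpq : p⁻¹ + q⁻¹ = 1) {f g : α → ℝ≥0∞}
    (hf : Measurable f) (hg : Measurable g) :
    ∫⁻ x, f x * g x ∂μ ≤ eLpNorm f p μ * eLpNorm g q μ := by
  have key : ∀ f g : α → ℝ≥0∞, Measurable f →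
      ∫⁻ x, f x * g x ∂μ ≤ eLpNorm f 1 μ * eLpNorm g ∞ μ := by
    intro f g hf
    rw [lpNorm_one, ← lintegral_mul_const _ hf]
    refine lintegral_mono_ae ((ae_le_lpNorm_top g).mono fun x hx => ?_)
    gcongr
  rcases eq_or_ne p ∞ with rfl | hp
  · have : q = 1 := by simpa using hpq
    subst this
    simp_rw [mul_comm (f _), mul_comm (eLpNorm f _ _)]
    exact key g f hg
  rcases eq_or_ne q ∞ with rfl | hq
  · have : p = 1 := by simpa using hpq
    subst this
    exact key f g hf
  have hp0 : p ≠ 0 := by rintro rfl; simp at hpq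
  have hq0 : q ≠ 0 := by rintro rfl; simp at hpq
  have h : p.toReal.HolderConjugate q.toReal := by
    have hsum : p.toReal⁻¹ + q.toReal⁻¹ = 1 := by
      rw [← ENNReal.toReal_inv, ← ENNReal.toReal_inv, ← ENNReal.toReal_add
        (ENNReal.inv_ne_top.2 hp0) (ENNReal.inv_ne_top.2 hq0), hpq, ENNReal.toReal_one]
    have hq' : 0 < q.toReal⁻¹ := inv_pos.2 (ENNReal.toReal_pos hq0 hq)
    refine Real.holderConjugate_iff.2 ⟨?_, hsum⟩
    rw [← inv_lt_one₀ (ENNReal.toReal_pos hp0 hp)]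
    linarith
  rw [lpNorm_eq_lintegral hp0 hp, lpNorm_eq_lintegral hq0 hq]
  simpa only [one_div, Pi.mul_apply] using
    ENNReal.lintegral_mul_le_Lp_mul_Lq μ h hf.aemeasurable hg.aemeasurable

theorem measurable_lpNorm_left [SFinite μ] {f : α → β → ℝ≥0∞}
    (hf : Measurable (Function.uncurry f)) (p : ℝ≥0∞) :
    Measurable fun y => eLpNorm (fun x => f x y) p μ := by
  rcases eq_or_ne p 0 with rfl | h0
  · simp
  rcases eq_or_ne p ∞ with rfl | ht
  · refine measurable_of_Ioi fun c => ?_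
    -- An essential supremum exceeds c exactly when the corresponding section of a superlevel set
    -- has positive measure, and measures of sections depend measurably on the parameter.
    have e : (fun y => eLpNorm (fun x => f x y) ∞ μ) ⁻¹' Set.Ioi c =
        {y | 0 < μ ((fun x => (x, y)) ⁻¹' {z : α × β | c < f z.1 z.2})} := by
      ext y
      simp only [Set.mem_preimage, Set.mem_Ioi, Set.mem_ofPred_eq, Set.preimage_ofPred_eq,
        pos_iff_ne_zero]
      rw [← not_le, not_iff_not]
      constructor
      · intro h
        have := (ae_le_lpNorm_top (μ := μ) fun x => f x y).mono fun x hx => hx.trans h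
        simpa [ae_iff] using this
      · intro h
        refine lpNorm_top_le ?_
        simpa [ae_iff] using h
    rw [e]
    exact measurableSet_lt measurable_const
      (measurable_measure_prodMk_right (measurableSet_lt measurable_const hf))
  · simp_rw [lpNorm_eq_lintegral h0 ht]
    exact Measurable.pow_const (Measurable.lintegral_prod_left' (hf.pow_const _)) _

theorem measurable_lpNorm_right [SFinite ν] {f : α → β → ℝ≥0∞}
    (hf : Measurable (Function.uncurry f)) (p : ℝ≥0∞) :
    Measurable fun x => eLpNorm (f x) p ν :=
  measurable_lpNorm_left (f := fun y x => f x y) (hf.comp measurable_swap) p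

theorem ae_ae_le_lpNorm_top [SFinite μ] [SFinite ν] {f : α → β → ℝ≥0∞}
    (hf : Measurable (Function.uncurry f)) :
    ∀ᵐ x ∂μ, ∀ᵐ y ∂ν, f x y ≤ eLpNorm (fun x => f x y) ∞ μ := by
  have hm : MeasurableSet {z : α × β | f z.1 z.2 ≤ eLpNorm (fun x => f x z.2) ∞ μ} :=
    measurableSet_le hf ((measurable_lpNorm_left hf ∞).comp measurable_snd)
  rw [Measure.ae_ae_comm hm]
  exact Eventually.of_forall fun y => ae_le_lpNorm_top fun x => f x y

/-- Minkowski's integral inequality. -/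
theorem lpNorm_lintegral_le [SigmaFinite μ] [SFinite ν] {p : ℝ≥0∞} (hp : 1 ≤ p)
    {f : α → β → ℝ≥0∞} (hf : Measurable (Function.uncurry f)) :
    eLpNorm (fun x => ∫⁻ y, f x y ∂ν) p μ ≤ ∫⁻ y, eLpNorm (fun x => f x y) p μ ∂ν := by
  rcases eq_or_ne p ∞ with rfl | ht
  · refine lpNorm_top_le ((ae_ae_le_lpNorm_top (ν := ν) hf).mono fun x hx => ?_)
    exact lintegral_mono_ae hx
  rcases hp.eq_or_lt with rfl | hp1
  · simp_rw [lpNorm_one]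
    exact (lintegral_lintegral_swap hf.aemeasurable).le
  have h0 : p ≠ 0 := (zero_lt_one.trans hp1).ne'
  have hr : 1 < p.toReal := by
    rw [← ENNReal.toReal_one]
    exact (ENNReal.toReal_lt_toReal ENNReal.one_ne_top ht).2 hp1
  set r := p.toReal with hr_def
  have hr0 : 0 < r := zero_lt_one.trans hr
  set M := ∫⁻ y, eLpNorm (fun x => f x y) p μ ∂ν with hM
  rw [lpNorm_eq_lintegral h0 ht, ENNReal.rpow_inv_le_iff hr0]
  -- Let I be the inner integral. It suffices to bound A = ∫ G for simple G ≤ I^r with A finite.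
  -- Writing G = G^{1/s} G^{1/r} ≤ G^{1/s} I, Tonelli and Hölder give A ≤ A^{1/s} M. Since A is
  -- finite, division by A^{1/s} is legitimate; this is why simple minorants are used instead of I^r
  -- itself.
  refine le_of_forall_lt fun L hL => ?_
  rw [lintegral_eq_nnreal] at hL
  simp_rw [lt_iSup_iff] at hL
  obtain ⟨g₀, hg₀, hL₀⟩ := hL
  have hL₀' : L < ∫⁻ x, g₀ x ∂μ := by
    rw [← SimpleFunc.lintegral_eq_lintegral, SimpleFunc.coe_map] at *
    exact hL₀
  obtain ⟨g, hg, hgt, hLg⟩ := SimpleFunc.exists_lt_lintegral_simpleFunc_of_lt_lintegral hL₀'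
  refine hLg.trans_le ?_
  have hgI : ∀ x, (g x : ℝ≥0∞) ≤ (∫⁻ y, f x y ∂ν) ^ r := fun x =>
    (ENNReal.coe_le_coe.2 (hg x)).trans (hg₀ x)
  set G : α → ℝ≥0∞ := fun x => g x with hG
  have hGm : Measurable G := measurable_coe_nnreal_ennreal.comp g.measurable
  set A := ∫⁻ x, G x ∂μ with hA
  have hs : r.HolderConjugate (r.conjExponent) := Real.HolderConjugate.conjExponent hr
  set s := r.conjExponent with hs_def
  have h1 : ∀ x, G x ≤ G x ^ s⁻¹ * ∫⁻ y, f x y ∂ν := by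
    intro x
    have : G x = G x ^ s⁻¹ * G x ^ r⁻¹ := by
      rw [← ENNReal.rpow_add_of_nonneg _ _ (inv_nonneg.2 hs.symm.nonneg) (inv_nonneg.2 hr0.le),
        hs.symm.inv_add_inv_eq_one, ENNReal.rpow_one]
    calc G x = G x ^ s⁻¹ * G x ^ r⁻¹ := this
      _ ≤ G x ^ s⁻¹ * ∫⁻ y, f x y ∂ν := by
        gcongr
        rw [ENNReal.rpow_inv_le_iff hr0]
        exact hgI x
  have h2 : A ≤ A ^ s⁻¹ * M := by
    calc A ≤ ∫⁻ x, G x ^ s⁻¹ * ∫⁻ y, f x y ∂ν ∂μ := lintegral_mono h1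
      _ = ∫⁻ x, ∫⁻ y, G x ^ s⁻¹ * f x y ∂ν ∂μ := by
        refine lintegral_congr fun x => ?_
        exact (lintegral_const_mul _ (hf.comp measurable_prodMk_left)).symm
      _ = ∫⁻ y, ∫⁻ x, G x ^ s⁻¹ * f x y ∂μ ∂ν :=
        lintegral_lintegral_swap
          (((hGm.pow_const _).comp measurable_fst).mul hf).aemeasurable
      _ ≤ ∫⁻ y, A ^ s⁻¹ * eLpNorm (fun x => f x y) p μ ∂ν := by
        refine lintegral_mono fun y => ?_
        have := ENNReal.lintegral_mul_le_Lp_mul_Lq μ hs.symm (hGm.pow_const s⁻¹).aemeasurable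
          (hf.comp (measurable_prodMk_right (y := y))).aemeasurable
        refine this.trans (le_of_eq ?_)
        rw [lpNorm_eq_lintegral h0 ht]
        simp only [one_div, ENNReal.rpow_inv_rpow hs.symm.ne_zero]
        rfl
      _ = A ^ s⁻¹ * M := lintegral_const_mul _ (measurable_lpNorm_left hf p)
  rcases eq_or_ne A 0 with hA0 | hA0
  · rw [hA0]; exact zero_le
  have hAs0 : A ^ s⁻¹ ≠ 0 := by
    simp [ENNReal.rpow_eq_zero_iff, hA0, hgt.ne]
  have hAst : A ^ s⁻¹ ≠ ∞ := ENNReal.rpow_ne_top_of_nonneg (inv_nonneg.2 hs.symm.nonneg) hgt.ne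
  have h3 : A = A ^ s⁻¹ * A ^ r⁻¹ := by
    rw [← ENNReal.rpow_add_of_nonneg _ _ (inv_nonneg.2 hs.symm.nonneg) (inv_nonneg.2 hr0.le),
        hs.symm.inv_add_inv_eq_one, ENNReal.rpow_one]
  rw [← ENNReal.rpow_inv_le_iff hr0]
  rw [h3] at h2
  exact (ENNReal.mul_le_mul_iff_right hAs0 hAst).1 (by rw [← h3]; rw [← h3] at h2; exact h2)

/-- Minkowski's inequality for mixed Lebesgue norms. -/
theorem lpNorm_lpNorm_swap_le [SigmaFinite μ] [SFinite ν] {p q : ℝ≥0∞} (hq : 1 ≤ q) (hqp : q ≤ p)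
    {f : α → β → ℝ≥0∞} (hf : Measurable (Function.uncurry f)) :
    eLpNorm (fun x => eLpNorm (fun y => f x y) q ν) p μ ≤
      eLpNorm (fun y => eLpNorm (fun x => f x y) p μ) q ν := by
  have hq0 : q ≠ 0 := (zero_lt_one.trans_le hq).ne'
  rcases eq_or_ne q ∞ with rfl | hqt
  · obtain rfl : p = ∞ := top_le_iff.1 hqp
    refine lpNorm_top_le ((ae_ae_le_lpNorm_top (ν := ν) hf).mono fun x hx => ?_)
    exact lpNorm_mono_ae hx
  have hr : 0 < q.toReal := ENNReal.toReal_pos hq0 hqt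
  have hqr : ENNReal.ofReal q.toReal = q := ENNReal.ofReal_toReal hqt
  have hpq : p / q * ENNReal.ofReal q.toReal = p := by
    rw [hqr, ENNReal.div_mul_cancel hq0 hqt]
  -- The claim is Minkowski's integral inequality for f^q with exponent p/q, which is at least 1
  -- because q ≤ p.
  have hle : 1 ≤ p / q := (ENNReal.le_div_iff_mul_le (Or.inl hq0) (Or.inl hqt)).2 (by simpa)
  rw [← ENNReal.rpow_le_rpow_iff hr]
  calc eLpNorm (fun x => eLpNorm (fun y => f x y) q ν) p μ ^ q.toReal
      = eLpNorm (fun x => eLpNorm (fun y => f x y) q ν ^ q.toReal) (p / q) μ := by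
        rw [lpNorm_rpow hr, hpq]
    _ = eLpNorm (fun x => ∫⁻ y, f x y ^ q.toReal ∂ν) (p / q) μ := by
        simp_rw [lpNorm_eq_lintegral hq0 hqt, ENNReal.rpow_inv_rpow hr.ne']
    _ ≤ ∫⁻ y, eLpNorm (fun x => f x y ^ q.toReal) (p / q) μ ∂ν :=
        lpNorm_lintegral_le hle (hf.pow_const _)
    _ = ∫⁻ y, eLpNorm (fun x => f x y) p μ ^ q.toReal ∂ν := by
        simp_rw [lpNorm_rpow hr, hpq]
    _ = _ := by
        rw [lpNorm_eq_lintegral hq0 hqt, ENNReal.rpow_inv_rpow hr.ne']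

/-- An iterated Lebesgue norm is at most the Lebesgue norm on the product. -/
theorem lpNorm_lpNorm_le_prod [SFinite μ] [SFinite ν] {p : ℝ≥0∞} {f : α → β → ℝ≥0∞}
    (hf : Measurable (Function.uncurry f)) :
    eLpNorm (fun y => eLpNorm (fun x => f x y) p μ) p ν ≤
      eLpNorm (Function.uncurry f) p (μ.prod ν) := by
  rcases eq_or_ne p 0 with rfl | h0
  · simp
  rcases eq_or_ne p ∞ with rfl | ht
  · have h1 := ae_le_lpNorm_top (μ := μ.prod ν) (Function.uncurry f)
    have hm : MeasurableSet {z : α × β | Function.uncurry f z ≤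
        eLpNorm (Function.uncurry f) ∞ (μ.prod ν)} := measurableSet_le hf measurable_const
    have h2 := (Measure.ae_ae_comm (μ := μ) (ν := ν) hm).1 (Measure.ae_ae_of_ae_prod h1)
    exact lpNorm_top_le (h2.mono fun y hy => lpNorm_top_le hy)
  · have hr := ENNReal.toReal_pos h0 ht
    rw [lpNorm_eq_lintegral h0 ht, lpNorm_eq_lintegral h0 ht]
    simp_rw [lpNorm_eq_lintegral h0 ht, ENNReal.rpow_inv_rpow hr.ne']
    rw [lintegral_prod_symm _ (hf.pow_const _).aemeasurable]
    rfl

theorem lpNorm_comp_measurePreserving {p : ℝ≥0∞} {f : β → ℝ≥0∞} (hf : Measurable f) {T : α → β}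
    (hT : MeasurePreserving T μ ν) : eLpNorm (fun x => f (T x)) p μ = eLpNorm f p ν :=
  eLpNorm_comp_measurePreserving hf.aestronglyMeasurable hT

/-- Hölder's inequality for a geometric mean. -/
theorem lpNorm_geom_mean_le {p q r : ℝ≥0∞} (hp : 1 ≤ p) (hq : 1 ≤ q) (hr : 1 ≤ r) {θ : ℝ}
    (h0 : 0 < θ) (h1 : θ < 1)
    (h : r⁻¹ = ENNReal.ofReal (1 - θ) * p⁻¹ + ENNReal.ofReal θ * q⁻¹) {f g : α → ℝ≥0∞}
    (hf : Measurable f) (hg : Measurable g) :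
    eLpNorm (fun x => f x ^ (1 - θ) * g x ^ θ) r μ ≤
      eLpNorm f p μ ^ (1 - θ) * eLpNorm g q μ ^ θ := by
  have h1' : 0 < 1 - θ := by linarith
  have hpos : ∀ {t : ℝ≥0∞}, 1 ≤ t → t ≠ 0 := fun ht => (zero_lt_one.trans_le ht).ne'
  set A := ENNReal.ofReal (1 - θ) with hA
  set B := ENNReal.ofReal θ with hB
  have hA0 : A ≠ 0 := by simpa [hA] using h1
  have hB0 : B ≠ 0 := by simpa [hB] using h0
  have hAt : A ≠ ∞ := ENNReal.ofReal_ne_top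
  have hBt : B ≠ ∞ := ENNReal.ofReal_ne_top
  have main : ∀ (c : ℝ≥0∞) (θ : ℝ) (p r : ℝ≥0∞) (f : α → ℝ≥0∞), Measurable f → 0 < θ → 1 ≤ p →
      r⁻¹ = ENNReal.ofReal θ * p⁻¹ →
      eLpNorm (fun x => c * f x ^ θ) r μ ≤ c * eLpNorm f p μ ^ θ := by
    intro c θ p r f hf hθ hp hr
    refine (lpNorm_const_mul (hf.pow_const _) c).trans ?_
    rw [lpNorm_rpow hθ]
    have e : r * ENNReal.ofReal θ = p := by
      have hB0 : ENNReal.ofReal θ ≠ 0 := by simpa using hθ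
      rw [← inv_inv r, hr, ENNReal.mul_inv (Or.inl hB0) (Or.inl ENNReal.ofReal_ne_top), inv_inv,
        mul_comm, ← mul_assoc, ENNReal.mul_inv_cancel hB0 ENNReal.ofReal_ne_top, one_mul]
    rw [e]
  rcases eq_or_ne p ∞ with rfl | hpt
  · refine (lpNorm_mono_ae (g := fun x => eLpNorm f ∞ μ ^ (1 - θ) * g x ^ θ)
      ((ae_le_lpNorm_top f).mono fun x hx => ?_)).trans (main _ _ q r g hg h0 hq (by simpa using h))
    gcongr
  rcases eq_or_ne q ∞ with rfl | hqt
  · refine (lpNorm_mono_ae (g := fun x => eLpNorm g ∞ μ ^ θ * f x ^ (1 - θ))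
      ((ae_le_lpNorm_top g).mono fun x hx => ?_)).trans ((main _ _ p r f hf h1' hp
        (by simpa using h)).trans (mul_comm _ _).le)
    rw [mul_comm]
    gcongr
  have hrt : r ≠ ∞ := by
    rintro rfl
    have := hpos hp
    have h2 : A * p⁻¹ = 0 := by
      have := h.symm
      rw [ENNReal.inv_top, add_eq_zero] at this
      exact this.1
    simp [hA0, hpt] at h2
  have hp' := ENNReal.toReal_pos (hpos hp) hpt
  have hq' := ENNReal.toReal_pos (hpos hq) hqt
  have hr' := ENNReal.toReal_pos (hpos hr) hrt
  set P := p.toReal with hP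
  set Q := q.toReal with hQ
  set R := r.toReal with hR
  have hreal : R⁻¹ = (1 - θ) * P⁻¹ + θ * Q⁻¹ := by
    have := congrArg ENNReal.toReal h
    rw [ENNReal.toReal_add (ENNReal.mul_ne_top hAt (ENNReal.inv_ne_top.2 (hpos hp)))
      (ENNReal.mul_ne_top hBt (ENNReal.inv_ne_top.2 (hpos hq))), ENNReal.toReal_mul,
      ENNReal.toReal_mul, ENNReal.toReal_ofReal h1'.le, ENNReal.toReal_ofReal h0.le,
      ENNReal.toReal_inv, ENNReal.toReal_inv, ENNReal.toReal_inv] at this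
    exact this
  -- These are the weights with which Hölder's inequality is applied to f^P and g^Q.
  have hsum : R * (1 - θ) / P + R * θ / Q = 1 := by
    have : R * R⁻¹ = 1 := mul_inv_cancel₀ hr'.ne'
    rw [hreal] at this
    calc _ = R * ((1 - θ) * P⁻¹ + θ * Q⁻¹) := by ring
      _ = 1 := this
  rw [lpNorm_eq_lintegral (hpos hp) hpt, lpNorm_eq_lintegral (hpos hq) hqt,
    lpNorm_eq_lintegral (hpos hr) hrt]
  have key := ENNReal.lintegral_mul_norm_pow_le (μ := μ) (hf.pow_const P).aemeasurable
    (hg.pow_const Q).aemeasurable (by positivity : 0 ≤ R * (1 - θ) / P)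
    (by positivity : 0 ≤ R * θ / Q) hsum
  rw [ENNReal.rpow_inv_le_iff hr']
  have e1 : ∀ x, (f x ^ (1 - θ) * g x ^ θ) ^ R =
      (f x ^ P) ^ (R * (1 - θ) / P) * (g x ^ Q) ^ (R * θ / Q) := by
    intro x
    rw [ENNReal.mul_rpow_of_nonneg _ _ hr'.le, ← ENNReal.rpow_mul, ← ENNReal.rpow_mul,
      ← ENNReal.rpow_mul, ← ENNReal.rpow_mul]
    congr 2 <;> field_simp
  have e2 : (((∫⁻ x, f x ^ P ∂μ) ^ P⁻¹) ^ (1 - θ) * ((∫⁻ x, g x ^ Q ∂μ) ^ Q⁻¹) ^ θ) ^ R =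
      (∫⁻ x, f x ^ P ∂μ) ^ (R * (1 - θ) / P) * (∫⁻ x, g x ^ Q ∂μ) ^ (R * θ / Q) := by
    rw [ENNReal.mul_rpow_of_nonneg _ _ hr'.le, ← ENNReal.rpow_mul, ← ENNReal.rpow_mul,
      ← ENNReal.rpow_mul, ← ENNReal.rpow_mul]
    congr 2 <;> field_simp
  rw [e2]
  refine (le_of_eq (lintegral_congr e1)).trans key

end LebesgueNorms

/-! ### Young-type inequalities for kernels H(u, w - u), in plain and mixed norms. -/

section TwistedKernels

variable {G : Type*} [AddCommGroup G] [MeasureSpace G] [MeasurableAdd₂ G] [MeasurableNeg G]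
  [(volume : Measure G).IsAddLeftInvariant] [(volume : Measure G).IsNegInvariant]
  [SigmaFinite (volume : Measure G)]

/-- The operator with kernel `(w, u) ↦ H(u, w - u)`. -/
def twistedOp (H : G → G → ℝ≥0∞) (F : G → ℝ≥0∞) (w : G) : ℝ≥0∞ := ∫⁻ u, H u (w - u) * F u

variable {H : G → G → ℝ≥0∞} {F : G → ℝ≥0∞}

theorem measurable_twistedKernel (hH : Measurable (Function.uncurry H)) :
    Measurable (fun z : G × G => H z.2 (z.1 - z.2)) :=
  hH.comp (measurable_snd.prodMk (measurable_fst.sub measurable_snd))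

theorem measurable_twistedOp (hH : Measurable (Function.uncurry H)) (hF : Measurable F) :
    Measurable (twistedOp H F) :=
  Measurable.lintegral_prod_right' (f := fun z : G × G => H z.2 (z.1 - z.2) * F z.2)
    ((measurable_twistedKernel hH).mul (hF.comp measurable_snd))

theorem twistedOp_eq (H : G → G → ℝ≥0∞) (F : G → ℝ≥0∞) (w : G) :
    twistedOp H F w = ∫⁻ ζ, H (w - ζ) ζ * F (w - ζ) := by
  rw [twistedOp, ← lintegral_sub_left_eq_self _ w]
  simp only [sub_sub_cancel]

/-- The endpoint a = P'. Minkowski's inequality moves the L^q norm inside the integral over u, where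
translation invariance removes the shift by u; Hölder in u follows, and q ≤ P permits the exchange
of the two norms of H. -/
theorem lpNorm_twistedOp_le_left {P q a : ℝ≥0∞} (hq : 1 ≤ q) (hqP : q ≤ P)
    (ha : P⁻¹ + a⁻¹ = 1) (hH : Measurable (Function.uncurry H)) (hF : Measurable F) :
    eLpNorm (twistedOp H F) q volume ≤
      eLpNorm (fun ζ => eLpNorm (fun u => H u ζ) P volume) q volume * eLpNorm F a volume := by
  have hm := (measurable_twistedKernel hH).mul (hF.comp measurable_snd)
  calc eLpNorm (twistedOp H F) q volume
      ≤ ∫⁻ u, eLpNorm (fun w => H u (w - u) * F u) q volume :=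
        lpNorm_lintegral_le (f := fun w u => H u (w - u) * F u) hq hm
    _ ≤ ∫⁻ u, eLpNorm (H u) q volume * F u := by
        refine lintegral_mono fun u => ?_
        have hu : Measurable (H u) := hH.comp measurable_prodMk_left
        have h1 : Measurable fun w => H u (w - u) := hu.comp (measurable_sub_const' u)
        simp_rw [mul_comm _ (F u)]
        refine (lpNorm_const_mul h1 (F u)).trans (le_of_eq ?_)
        rw [lpNorm_comp_measurePreserving hu (measurePreserving_sub_right volume u)]
    _ ≤ eLpNorm (fun u => eLpNorm (H u) q volume) P volume * eLpNorm F a volume :=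
        lintegral_mul_le_lpNorm ha (measurable_lpNorm_right hH q) hF
    _ ≤ _ := by
        gcongr
        exact lpNorm_lpNorm_swap_le hq hqP hH

/-- The endpoint a = q'. Here Hölder is applied in ζ = w - u for fixed w; the exchange of norms,
again by q ≤ P, leaves an L^P norm in w from which the shift by ζ drops out. -/
theorem lpNorm_twistedOp_le_right {P q a : ℝ≥0∞} (hq : 1 ≤ q) (hqP : q ≤ P)
    (ha : q⁻¹ + a⁻¹ = 1) (hH : Measurable (Function.uncurry H)) (hF : Measurable F) :
    eLpNorm (twistedOp H F) P volume ≤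
      eLpNorm (fun ζ => eLpNorm (fun u => H u ζ) P volume) q volume * eLpNorm F a volume := by
  have hm : Measurable (Function.uncurry fun w ζ => H (w - ζ) ζ) :=
    hH.comp ((measurable_fst.sub measurable_snd).prodMk measurable_snd)
  calc eLpNorm (twistedOp H F) P volume
      ≤ eLpNorm (fun w => eLpNorm F a volume * eLpNorm (fun ζ => H (w - ζ) ζ) q volume) P volume := by
        refine lpNorm_mono fun w => ?_
        rw [twistedOp_eq, mul_comm]
        have hFw : Measurable fun ζ => F (w - ζ) := hF.comp (measurable_const.sub measurable_id)
        refine (lintegral_mul_le_lpNorm ha (hm.comp measurable_prodMk_left) hFw).trans (le_of_eq ?_)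
        rw [lpNorm_comp_measurePreserving hF (Measure.measurePreserving_sub_left volume w)]
        rfl
    _ ≤ eLpNorm F a volume *
        eLpNorm (fun w => eLpNorm (fun ζ => H (w - ζ) ζ) q volume) P volume :=
        lpNorm_const_mul (measurable_lpNorm_right hm q) _
    _ ≤ eLpNorm F a volume *
        eLpNorm (fun ζ => eLpNorm (fun w => H (w - ζ) ζ) P volume) q volume := by
        gcongr
        exact lpNorm_lpNorm_swap_le hq hqP hm
    _ = _ := by
        rw [mul_comm]
        congr 2
        funext ζ
        exact lpNorm_comp_measurePreserving (f := fun u => H u ζ) (hH.comp measurable_prodMk_right)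
          (measurePreserving_sub_right volume ζ)

/-- Moves F from L^{1/x} to L^{1/y} by taking a power, which supplies the endpoint functions of the
interpolation. For y = 0 the power is the constant 1 and the exponent is ∞. -/
theorem lpNorm_rpow_of_inv_eq {α : Type*} [MeasurableSpace α] {μ : Measure α} {p a : ℝ≥0∞} {x y : ℝ}
    (hx : 0 < x) (hy : 0 ≤ y) (ha : a⁻¹ = ENNReal.ofReal x) (hp : p⁻¹ = ENNReal.ofReal y)
    (f : α → ℝ≥0∞) :
    eLpNorm (fun t => f t ^ (y / x)) p μ ≤ eLpNorm f a μ ^ (y / x) := by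
  rcases hy.eq_or_lt with rfl | hy
  · have : p = ∞ := by simpa using hp
    subst this
    simp only [zero_div, ENNReal.rpow_zero]
    exact lpNorm_top_le (Filter.Eventually.of_forall fun _ => le_rfl)
  · rw [lpNorm_rpow (by positivity)]
    have : p * ENNReal.ofReal (y / x) = a := by
      rw [← inv_inv p, hp, ← inv_inv a, ha, ← ENNReal.ofReal_inv_of_pos hy,
        ← ENNReal.ofReal_inv_of_pos hx, ← ENNReal.ofReal_mul (by positivity)]
      congr 1
      field_simp
    rw [this]

/-- A Young-type inequality for operators with kernel `H(u, w - u)`. -/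
theorem lpNorm_twistedOp_le {P q a b : ℝ≥0∞} (hq : 1 ≤ q) (hqP : q ≤ P)
    (hPa : P⁻¹ + a⁻¹ ≤ 1) (hqa : 1 ≤ q⁻¹ + a⁻¹) (hb : b⁻¹ + 1 = P⁻¹ + q⁻¹ + a⁻¹)
    (hH : Measurable (Function.uncurry H)) (hF : Measurable F) :
    eLpNorm (twistedOp H F) b volume ≤
      eLpNorm (fun ζ => eLpNorm (fun u => H u ζ) P volume) q volume * eLpNorm F a volume := by
  rcases hPa.eq_or_lt with hPa | hPa
  · have : b = q := by
      rw [add_right_comm, hPa, add_comm] at hb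
      exact inv_inj.1 ((ENNReal.add_right_inj ENNReal.one_ne_top).1 hb)
    rw [this]
    exact lpNorm_twistedOp_le_left hq hqP hPa hH hF
  rcases hqa.eq_or_lt with hqa | hqa
  · have : b = P := by
      rw [add_assoc, ← hqa] at hb
      exact inv_inj.1 ((ENNReal.add_left_inj ENNReal.one_ne_top).1 hb)
    rw [this]
    exact lpNorm_twistedOp_le_right hq hqP hqa.symm hH hF
  have hP1 : P⁻¹ ≤ 1 := ENNReal.inv_le_one.2 (hq.trans hqP)
  have hq1 : q⁻¹ ≤ 1 := ENNReal.inv_le_one.2 hq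
  have ha1 : a⁻¹ ≤ 1 := (le_add_self).trans hPa.le
  have hPt := ne_top_of_le_ne_top ENNReal.one_ne_top hP1
  have hqt := ne_top_of_le_ne_top ENNReal.one_ne_top hq1
  have hat := ne_top_of_le_ne_top ENNReal.one_ne_top ha1
  -- In reciprocals: x = 1/a, y = 1/P', z = 1/q'. With both endpoint cases removed, z < x < y.
  obtain ⟨x, hx⟩ : ∃ x, x = (a⁻¹).toReal := ⟨_, rfl⟩
  obtain ⟨y, hy⟩ : ∃ y, y = 1 - (P⁻¹).toReal := ⟨_, rfl⟩
  obtain ⟨z, hz⟩ : ∃ z, z = 1 - (q⁻¹).toReal := ⟨_, rfl⟩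
  have hx0 : 0 ≤ x := hx ▸ ENNReal.toReal_nonneg
  have hz0 : 0 ≤ z := by
    have := ENNReal.toReal_mono ENNReal.one_ne_top hq1
    rw [ENNReal.toReal_one] at this
    linarith
  have hxy : x < y := by
    have := (ENNReal.toReal_lt_toReal (ENNReal.add_ne_top.2 ⟨hPt, hat⟩) ENNReal.one_ne_top).2 hPa
    rw [ENNReal.toReal_add hPt hat, ENNReal.toReal_one, ← hx] at this
    linarith
  have hzx : z < x := by
    have := (ENNReal.toReal_lt_toReal ENNReal.one_ne_top (ENNReal.add_ne_top.2 ⟨hqt, hat⟩)).2 hqa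
    rw [ENNReal.toReal_add hqt hat, ENNReal.toReal_one, ← hx] at this
    linarith
  have hx0' : 0 < x := hz0.trans_lt hzx
  have hPy : P⁻¹ = ENNReal.ofReal (1 - y) := by
    rw [hy, sub_sub_cancel, ENNReal.ofReal_toReal hPt]
  have hqz : q⁻¹ = ENNReal.ofReal (1 - z) := by
    rw [hz, sub_sub_cancel, ENNReal.ofReal_toReal hqt]
  have hax : a⁻¹ = ENNReal.ofReal x := by rw [hx, ENNReal.ofReal_toReal hat]
  have hy1 : y ≤ 1 := by rw [hy]; linarith [ENNReal.toReal_nonneg (a := P⁻¹)]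
  have hz1 : z ≤ 1 := by linarith
  -- The solution of (1-θ) y + θ z = x. Hence F = F₀^{1-θ} F₁^θ, where F₀ = F^{y/x} belongs to the
  -- endpoint a = P' and F₁ = F^{z/x} to the endpoint a = q'.
  set θ := (y - x) / (y - z) with hθ
  have hyz : 0 < y - z := by linarith
  have hθ0 : 0 < θ := div_pos (by linarith) hyz
  have hθ1 : θ < 1 := (div_lt_one hyz).2 (by linarith)
  have hxθ : (1 - θ) * y + θ * z = x := by
    rw [hθ]
    field_simp
    ring
  set a₀ : ℝ≥0∞ := (ENNReal.ofReal y)⁻¹ with ha₀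
  set a₁ : ℝ≥0∞ := (ENNReal.ofReal z)⁻¹ with ha₁
  set F₀ : G → ℝ≥0∞ := fun u => F u ^ (y / x) with hF₀
  set F₁ : G → ℝ≥0∞ := fun u => F u ^ (z / x) with hF₁
  have hF₀m : Measurable F₀ := hF.pow_const _
  have hF₁m : Measurable F₁ := hF.pow_const _
  set N := eLpNorm (fun ζ => eLpNorm (fun u => H u ζ) P volume) q volume with hN
  have hk0 : eLpNorm (twistedOp H F₀) q volume ≤ N * eLpNorm F a volume ^ (y / x) := by
    refine (lpNorm_twistedOp_le_left (a := a₀) hq hqP ?_ hH hF₀m).trans ?_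
    · rw [ha₀, inv_inv, hPy, ← ENNReal.ofReal_add (by linarith) (by linarith)]
      simp
    · gcongr
      exact lpNorm_rpow_of_inv_eq hx0' (by linarith) hax (inv_inv _) F
  have hk1 : eLpNorm (twistedOp H F₁) P volume ≤ N * eLpNorm F a volume ^ (z / x) := by
    refine (lpNorm_twistedOp_le_right (a := a₁) hq hqP ?_ hH hF₁m).trans ?_
    · rw [ha₁, inv_inv, hqz, ← ENNReal.ofReal_add (by linarith) hz0]
      simp
    · gcongr
      exact lpNorm_rpow_of_inv_eq hx0' hz0 hax (inv_inv _) F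
  have hsum : y / x * (1 - θ) + z / x * θ = 1 := by
    field_simp
    linarith
  have hsplit : ∀ c d : ℝ≥0∞, (c * d ^ (y / x)) ^ (1 - θ) * (c * d ^ (z / x)) ^ θ = c * d := by
    intro c d
    have h1θ : 0 ≤ 1 - θ := by linarith
    rw [ENNReal.mul_rpow_of_nonneg _ _ h1θ, ENNReal.mul_rpow_of_nonneg _ _ hθ0.le,
      mul_mul_mul_comm, ← ENNReal.rpow_add_of_nonneg _ _ h1θ hθ0.le, ← ENNReal.rpow_mul,
      ← ENNReal.rpow_mul, ← ENNReal.rpow_add_of_nonneg _ _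
        (mul_nonneg (div_nonneg (by linarith) hx0) h1θ)
        (mul_nonneg (div_nonneg hz0 hx0) hθ0.le), hsum, sub_add_cancel, ENNReal.rpow_one,
      ENNReal.rpow_one]
  -- As the kernel is nonnegative, Hölder's inequality under the integral replaces complex
  -- interpolation.
  have hpt : ∀ w, twistedOp H F w ≤ twistedOp H F₀ w ^ (1 - θ) * twistedOp H F₁ w ^ θ := by
    intro w
    have hHw : Measurable fun u => H u (w - u) :=
      (measurable_twistedKernel hH).comp (measurable_prodMk_left (x := w))
    have := lpNorm_geom_mean_le (μ := (volume : Measure G)) (p := 1) (q := 1) (r := 1) le_rfl le_rfl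
      le_rfl hθ0 hθ1 (by
        rw [inv_one, mul_one, mul_one, ← ENNReal.ofReal_add (by linarith) hθ0.le]
        simp) (hHw.mul hF₀m) (hHw.mul hF₁m)
    simp only [lpNorm_one] at this
    refine le_trans (le_of_eq ?_) this
    refine lintegral_congr fun u => ?_
    exact (hsplit _ _).symm
  calc eLpNorm (twistedOp H F) b volume
      ≤ eLpNorm (fun w => twistedOp H F₀ w ^ (1 - θ) * twistedOp H F₁ w ^ θ) b volume :=
        lpNorm_mono hpt
    _ ≤ eLpNorm (twistedOp H F₀) q volume ^ (1 - θ) * eLpNorm (twistedOp H F₁) P volume ^ θ := by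
        have hbr : b⁻¹ = ENNReal.ofReal (x - y - z + 1) := by
          rw [← ENNReal.add_left_inj ENNReal.one_ne_top, hb, hPy, hqz, hax, ← ENNReal.ofReal_one,
            ← ENNReal.ofReal_add (by linarith) (by linarith),
            ← ENNReal.ofReal_add (by linarith) hx0, ← ENNReal.ofReal_add (by linarith) zero_le_one]
          congr 1
          ring
        refine lpNorm_geom_mean_le hq (hq.trans hqP) ?_ hθ0 hθ1 ?_
          (measurable_twistedOp hH hF₀m) (measurable_twistedOp hH hF₁m)
        · rw [← ENNReal.inv_le_one, hbr, ← ENNReal.ofReal_one]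
          exact ENNReal.ofReal_le_ofReal (by linarith)
        · rw [hbr, hqz, hPy, ← ENNReal.ofReal_mul (by linarith), ← ENNReal.ofReal_mul hθ0.le,
            ← ENNReal.ofReal_add (mul_nonneg (by linarith) (by linarith))
              (mul_nonneg hθ0.le (by linarith))]
          congr 1
          linarith
    _ ≤ (N * eLpNorm F a volume ^ (y / x)) ^ (1 - θ) * (N * eLpNorm F a volume ^ (z / x)) ^ θ := by
        gcongr
    _ = _ := hsplit _ _

/-- The mixed Lebesgue norm `L^{p,q}` of a nonnegative function. -/
def mixedLpNorm (p q : ℝ≥0∞) (f : G → G → ℝ≥0∞) : ℝ≥0∞ :=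
  eLpNorm (fun y => eLpNorm (fun x => f x y) p volume) q volume

/-- Minkowski (q ≤ P) brings the norm in u₂ next to the norm in u₁, so that both merge into one L^P
norm over the product. This compares the kernel left after reducing the first coordinate with the
full kernel norm. -/
theorem kernelNorm_swap_le {P q : ℝ≥0∞} (hq : 1 ≤ q) (hqP : q ≤ P)
    {H : G × G → G × G → ℝ≥0∞} (hH : Measurable (Function.uncurry H)) (ζ₂ : G) :
    eLpNorm (fun u₂ => eLpNorm (fun ζ₁ => eLpNorm (fun u₁ => H (u₁, u₂) (ζ₁, ζ₂)) P volume)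
      q volume) P volume ≤
      eLpNorm (fun ζ₁ => eLpNorm (fun u => H u (ζ₁, ζ₂)) P volume) q volume := by
  have hkm : Measurable (Function.uncurry fun u₂ ζ₁ : G =>
      eLpNorm (fun u₁ => H (u₁, u₂) (ζ₁, ζ₂)) P volume) :=
    measurable_lpNorm_left (f := fun u₁ (t : G × G) => H (u₁, t.1) (t.2, ζ₂))
      (hH.comp (by fun_prop : Measurable fun z : G × (G × G) => ((z.1, z.2.1), (z.2.2, ζ₂)))) P
  refine (lpNorm_lpNorm_swap_le hq hqP hkm).trans (lpNorm_mono fun ζ₁ => ?_)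
  have hm : Measurable (fun z : G × G => H z (ζ₁, ζ₂)) :=
    hH.comp (by fun_prop : Measurable fun z : G × G => (z, (ζ₁, ζ₂)))
  have h := lpNorm_lpNorm_le_prod (μ := (volume : Measure G)) (ν := (volume : Measure G)) (p := P)
    (f := fun u₁ u₂ : G => H (u₁, u₂) (ζ₁, ζ₂)) hm
  rw [← Measure.volume_eq_prod] at h
  exact h

theorem kernelNorm_le {P q : ℝ≥0∞}
    {H : G × G → G × G → ℝ≥0∞} (hH : Measurable (Function.uncurry H)) :
    eLpNorm (fun ζ₂ => eLpNorm (fun ζ₁ => eLpNorm (fun u => H u (ζ₁, ζ₂)) P volume) q volume)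
      q volume ≤ eLpNorm (fun ζ => eLpNorm (fun u => H u ζ) P volume) q volume := by
  have hPm : Measurable fun ζ => eLpNorm (fun u => H u ζ) P volume := measurable_lpNorm_left hH P
  have h := lpNorm_lpNorm_le_prod (μ := (volume : Measure G)) (ν := (volume : Measure G)) (p := q)
    (f := fun ζ₁ ζ₂ : G => eLpNorm (fun u => H u (ζ₁, ζ₂)) P volume) hPm
  rw [← Measure.volume_eq_prod] at h
  exact h

/-- A Young-type inequality in mixed Lebesgue norms for operators with kernel `H(u, w - u)`. -/
theorem mixedLpNorm_twistedOp_le {P q a₁ b₁ a₂ b₂ : ℝ≥0∞} (hq : 1 ≤ q) (hqP : q ≤ P)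
    (hPa₁ : P⁻¹ + a₁⁻¹ ≤ 1) (hqa₁ : 1 ≤ q⁻¹ + a₁⁻¹) (hb₁ : b₁⁻¹ + 1 = P⁻¹ + q⁻¹ + a₁⁻¹)
    (hPa₂ : P⁻¹ + a₂⁻¹ ≤ 1) (hqa₂ : 1 ≤ q⁻¹ + a₂⁻¹) (hb₂ : b₂⁻¹ + 1 = P⁻¹ + q⁻¹ + a₂⁻¹)
    (hb₁' : 1 ≤ b₁)
    {H : G × G → G × G → ℝ≥0∞} (hH : Measurable (Function.uncurry H))
    {f : G → G → ℝ≥0∞} (hf : Measurable (Function.uncurry f)) :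
    mixedLpNorm b₁ b₂ (fun w₁ w₂ => twistedOp H (Function.uncurry f) (w₁, w₂)) ≤
      eLpNorm (fun ζ => eLpNorm (fun u => H u ζ) P volume) q volume * mixedLpNorm a₁ a₂ f := by
  set h : G → G → ℝ≥0∞ := fun u₂ ζ₂ =>
    eLpNorm (fun ζ₁ => eLpNorm (fun u₁ => H (u₁, u₂) (ζ₁, ζ₂)) P volume) q volume with hh
  set φ : G → ℝ≥0∞ := fun u₂ => eLpNorm (fun u₁ => f u₁ u₂) a₁ volume with hφ
  have hφm : Measurable φ := measurable_lpNorm_left hf a₁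
  have hinner : Measurable (fun t : G × (G × G) =>
      eLpNorm (fun u₁ => H (u₁, t.2.1) (t.1, t.2.2)) P volume) := by
    refine measurable_lpNorm_left (f := fun u₁ (t : G × (G × G)) => H (u₁, t.2.1) (t.1, t.2.2)) ?_ P
    exact hH.comp (by fun_prop : Measurable fun z : G × (G × (G × G)) =>
      ((z.1, z.2.2.1), (z.2.1, z.2.2.2)))
  have hhm : Measurable (Function.uncurry h) := by
    refine measurable_lpNorm_left (f := fun ζ₁ (t : G × G) =>
      eLpNorm (fun u₁ => H (u₁, t.1) (ζ₁, t.2)) P volume) ?_ q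
    exact hinner
  have hker : Measurable (fun t : (G × G) × (G × G) =>
      H t.2 (t.1 - t.2) * Function.uncurry f t.2) := by
    have : Measurable fun t : (G × G) × (G × G) => (t.2, (t.1.1 - t.2.1, t.1.2 - t.2.2)) := by
      fun_prop
    exact (hH.comp this).mul (hf.comp measurable_snd)
  -- For frozen u₂ and ζ₂ = w₂ - u₂ the scalar inequality acts in the first coordinate. Minkowski in
  -- u₂ leaves an operator of the same twisted type in the second coordinate, with kernel `h`.
  have hstep : ∀ w₂, eLpNorm (fun w₁ => twistedOp H (Function.uncurry f) (w₁, w₂)) b₁ volume ≤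
      twistedOp h φ w₂ := by
    intro w₂
    have e : (fun w₁ => twistedOp H (Function.uncurry f) (w₁, w₂)) = fun w₁ =>
        ∫⁻ u₂, twistedOp (fun u₁ ζ₁ => H (u₁, u₂) (ζ₁, w₂ - u₂)) (fun u₁ => f u₁ u₂) w₁ := by
      funext w₁
      have hmw : Measurable fun u : G × G => H u ((w₁, w₂) - u) * Function.uncurry f u :=
        hker.comp (measurable_prodMk_left (x := (w₁, w₂)))
      simp only [twistedOp]
      rw [Measure.volume_eq_prod, lintegral_prod_symm _ hmw.aemeasurable]
      rfl
    rw [e]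
    have hker2 : Measurable (Function.uncurry fun w₁ u₂ =>
        twistedOp (fun u₁ ζ₁ => H (u₁, u₂) (ζ₁, w₂ - u₂)) (fun u₁ => f u₁ u₂) w₁) := by
      have : Measurable fun z : (G × G) × G =>
          H (z.2, z.1.2) (z.1.1 - z.2, w₂ - z.1.2) * f z.2 z.1.2 :=
        (hH.comp (by fun_prop : Measurable fun z : (G × G) × G =>
          ((z.2, z.1.2), (z.1.1 - z.2, w₂ - z.1.2)))).mul
          (hf.comp (by fun_prop : Measurable fun z : (G × G) × G => (z.2, z.1.2)))
      exact this.lintegral_prod_right'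
    refine (lpNorm_lintegral_le hb₁' hker2).trans (lintegral_mono fun u₂ => ?_)
    refine lpNorm_twistedOp_le hq hqP hPa₁ hqa₁ hb₁ ?_ (hf.comp measurable_prodMk_right)
    exact hH.comp (by fun_prop : Measurable fun z : G × G => ((z.1, u₂), (z.2, w₂ - u₂)))
  refine (lpNorm_mono hstep).trans ((lpNorm_twistedOp_le hq hqP hPa₂ hqa₂ hb₂ hhm hφm).trans ?_)
  refine mul_le_mul_left ?_ _
  exact (lpNorm_mono fun ζ₂ => kernelNorm_swap_le hq hqP hH ζ₂).trans (kernelNorm_le hH)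

end TwistedKernels

/-! ### Convolution with decaying profiles, moderate weights, change of window and embeddings. -/

section Smearing

open Filter Module

variable {V : Type*} [NormedAddCommGroup V] [InnerProductSpace ℝ V]

/-- The function `decay N` with values in `ℝ≥0∞`. -/
def decayE (N : ℕ) (x : V) : ℝ≥0∞ := ENNReal.ofReal (decay N x)

theorem decayE_le_one (N : ℕ) (x : V) : decayE N x ≤ 1 := by
  rw [decayE, ENNReal.ofReal_le_one, decay]
  exact inv_le_one_of_one_le₀ (one_le_pow₀ (by linarith [norm_nonneg x]))

theorem decay_neg (N : ℕ) (x : V) : decay N (-x) = decay N x := by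
  rw [decay, decay, norm_neg]

theorem decayE_sub_comm (N : ℕ) (x y : V) : decayE N (x - y) = decayE N (y - x) := by
  rw [decayE, decayE, ← decay_neg, neg_sub]

variable [FiniteDimensional ℝ V] [MeasurableSpace V] [BorelSpace V]

theorem ofReal_pow_mul_decayE (n N : ℕ) (x : V) :
    ENNReal.ofReal ((1 + ‖x‖) ^ n) * decayE (n + N) x = decayE N x := by
  rw [decayE, decayE, ← ENNReal.ofReal_mul (by positivity), one_add_norm_pow_mul_decay]

theorem measurable_decayE (N : ℕ) : Measurable (decayE N : V → ℝ≥0∞) :=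
  ENNReal.measurable_ofReal.comp (continuous_decay N).measurable

theorem lpNorm_decayE_lt_top {N : ℕ} (hN : finrank ℝ V < N) {p : ℝ≥0∞} (hp : 1 ≤ p) :
    eLpNorm (decayE N : V → ℝ≥0∞) p volume < ∞ := by
  rcases eq_or_ne p ∞ with rfl | ht
  · exact (lpNorm_top_le (Eventually.of_forall fun x => decayE_le_one N x)).trans_lt
      ENNReal.one_lt_top
  have h0 : p ≠ 0 := (zero_lt_one.trans_le hp).ne'
  rw [lpNorm_eq_lintegral h0 ht]
  refine ENNReal.rpow_lt_top_of_nonneg (by positivity) (ne_of_lt ?_)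
  refine lt_of_le_of_lt (lintegral_mono fun x => ?_) (integrable_decay (V := V) hN).lintegral_lt_top
  exact (ENNReal.rpow_le_rpow_of_exponent_ge (decayE_le_one N x)
    (by simpa using ENNReal.toReal_mono ht hp)).trans_eq (ENNReal.rpow_one _)

/-- Convolution with `decayE N`. -/
def decayConv (N : ℕ) (F : V → ℝ≥0∞) (x : V) : ℝ≥0∞ := ∫⁻ y, decayE N (x - y) * F y

theorem exists_lpNorm_decayConv_le {N : ℕ} (hN : finrank ℝ V < N) {p p' : ℝ≥0∞} (hp : 1 ≤ p)
    (hpp : p ≤ p') : ∃ C : ℝ≥0, ∀ F : V → ℝ≥0∞, Measurable F →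
      eLpNorm (decayConv N F) p' volume ≤ C * eLpNorm F p volume := by
  have hinv : p⁻¹ ≤ 1 := ENNReal.inv_le_one.2 hp
  have hinv' : p'⁻¹ ≤ p⁻¹ := ENNReal.inv_le_inv.2 hpp
  have hfin : p⁻¹ ≠ ∞ := ne_top_of_le_ne_top ENNReal.one_ne_top hinv
  -- Young's exponent, 1/c + 1/p = 1 + 1/p'. The profile lies in every L^c with c ≥ 1, and a
  -- convolution is a twisted operator whose kernel does not depend on u, so the exponent P = ∞ is
  -- available.
  set c : ℝ≥0∞ := (1 + p'⁻¹ - p⁻¹)⁻¹ with hc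
  have hle : 1 + p'⁻¹ - p⁻¹ ≤ 1 := tsub_le_iff_right.2 (by gcongr)
  have hle' : p⁻¹ ≤ 1 + p'⁻¹ := hinv.trans le_self_add
  have hc1 : 1 ≤ c := by rwa [hc, ENNReal.one_le_inv]
  have hcN := lpNorm_decayE_lt_top (V := V) hN hc1
  refine ⟨(eLpNorm (decayE N : V → ℝ≥0∞) c volume).toNNReal, fun F hF => ?_⟩
  rw [ENNReal.coe_toNNReal hcN.ne]
  have hsum : c⁻¹ + p⁻¹ = 1 + p'⁻¹ := by rw [hc, inv_inv, tsub_add_cancel_of_le hle']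
  refine (lpNorm_twistedOp_le (P := ∞) (q := c) (a := p) (b := p') hc1 le_top (by simpa using hinv)
    (by rw [hsum]; exact le_self_add) (by rw [ENNReal.inv_top, zero_add, hsum, add_comm])
    (H := fun _ ζ : V => decayE N ζ) ((measurable_decayE N).comp measurable_snd) hF).trans ?_
  gcongr
  exact lpNorm_mono fun ζ => lpNorm_top_le (Eventually.of_forall fun _ => le_rfl)

theorem exists_decayConv_le {N : ℕ} (hN : finrank ℝ V < N) {p : ℝ≥0∞} (hp : 1 ≤ p) :
    ∃ C : ℝ≥0, ∀ F : V → ℝ≥0∞, Measurable F → ∀ x,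
      decayConv N F x ≤ C * eLpNorm F p volume := by
  set c : ℝ≥0∞ := (1 - p⁻¹)⁻¹ with hc
  have hc1 : 1 ≤ c := by rw [hc, ENNReal.one_le_inv]; exact tsub_le_self
  have hcN := lpNorm_decayE_lt_top (V := V) hN hc1
  refine ⟨(eLpNorm (decayE N : V → ℝ≥0∞) c volume).toNNReal, fun F hF x => ?_⟩
  rw [ENNReal.coe_toNNReal hcN.ne]
  refine (lintegral_mul_le_lpNorm (p := c) (q := p) ?_
    ((measurable_decayE N).comp (measurable_const.sub measurable_id)) hF).trans_eq ?_
  · rw [hc, inv_inv, tsub_add_cancel_of_le (ENNReal.inv_le_one.2 hp)]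
  · congr 1
    exact lpNorm_comp_measurePreserving (measurable_decayE N) (Measure.measurePreserving_sub_left _ x)

/-- Convolution with `decayE N ⊗ decayE N`. -/
def smear (N : ℕ) (G : V → V → ℝ≥0∞) (x ξ : V) : ℝ≥0∞ :=
  decayConv N (fun η => decayConv N (fun y => G y η) x) ξ

theorem measurable_uncurry_decayConv (N : ℕ) {G : V → V → ℝ≥0∞}
    (hG : Measurable (Function.uncurry G)) :
    Measurable (Function.uncurry fun x η => decayConv N (fun y => G y η) x) := by
  have : Measurable fun z : (V × V) × V => decayE N (z.1.1 - z.2) * G z.2 z.1.2 :=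
    ((measurable_decayE N).comp (by fun_prop)).mul
      (hG.comp (by fun_prop : Measurable fun z : (V × V) × V => (z.2, z.1.2)))
  exact this.lintegral_prod_right'

theorem smear_eq {N : ℕ} {G : V → V → ℝ≥0∞} (hG : Measurable (Function.uncurry G)) (x ξ : V) :
    smear N G x ξ = ∫⁻ w : V × V, decayE N (x - w.1) * decayE N (ξ - w.2) * G w.1 w.2 := by
  have hm : Measurable fun w : V × V => decayE N (x - w.1) * decayE N (ξ - w.2) * G w.1 w.2 :=
    (((measurable_decayE N).comp (by fun_prop)).mul ((measurable_decayE N).comp (by fun_prop))).mul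
      hG
  rw [Measure.volume_eq_prod, lintegral_prod_symm _ hm.aemeasurable]
  refine lintegral_congr fun η => ?_
  show decayE N (ξ - η) * (∫⁻ y, decayE N (x - y) * G y η) = _
  rw [← lintegral_const_mul' (decayE N (ξ - η)) _ ENNReal.ofReal_ne_top]
  refine lintegral_congr fun y => ?_
  ring

theorem measurable_smear (N : ℕ) {G : V → V → ℝ≥0∞} (hG : Measurable (Function.uncurry G)) :
    Measurable (Function.uncurry (smear N G)) := by
  have h := measurable_uncurry_decayConv N hG
  have : Measurable fun z : (V × V) × V =>
      decayE N (z.1.2 - z.2) * decayConv N (fun y => G y z.2) z.1.1 :=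
    ((measurable_decayE N).comp (by fun_prop)).mul
      (h.comp (by fun_prop : Measurable fun z : (V × V) × V => (z.1.1, z.2)))
  exact this.lintegral_prod_right'

theorem exists_mixedLpNorm_smear_le {N : ℕ} (hN : finrank ℝ V < N) {p q p' q' : ℝ≥0∞}
    (hp : 1 ≤ p) (hpp : p ≤ p') (hq : 1 ≤ q) (hqq : q ≤ q') :
    ∃ C : ℝ≥0, ∀ G : V → V → ℝ≥0∞, Measurable (Function.uncurry G) →
      mixedLpNorm p' q' (smear N G) ≤ C * mixedLpNorm p q G := by
  obtain ⟨C₁, h₁⟩ := exists_lpNorm_decayConv_le (V := V) hN hp hpp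
  obtain ⟨C₂, h₂⟩ := exists_lpNorm_decayConv_le (V := V) hN hq hqq
  refine ⟨C₂ * C₁, fun G hG => ?_⟩
  have hG' := measurable_uncurry_decayConv N hG
  have hm : Measurable fun η => eLpNorm (fun x => decayConv N (fun y => G y η) x) p' volume :=
    measurable_lpNorm_left hG' p'
  have hm' : Measurable fun η => eLpNorm (fun y => G y η) p volume := measurable_lpNorm_left hG p
  have hstep : ∀ ξ, eLpNorm (fun x => smear N G x ξ) p' volume ≤
      decayConv N (fun η => eLpNorm (fun x => decayConv N (fun y => G y η) x) p' volume) ξ := by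
    intro ξ
    refine (lpNorm_lintegral_le (hp.trans hpp) ?_).trans (lintegral_mono fun η => ?_)
    · exact ((measurable_decayE N).comp (by fun_prop)).mul hG'
    · exact lpNorm_const_mul (hG'.comp measurable_prodMk_right) _
  calc mixedLpNorm p' q' (smear N G)
      ≤ eLpNorm (decayConv N fun η => eLpNorm (fun x => decayConv N (fun y => G y η) x) p' volume)
          q' volume := lpNorm_mono hstep
    _ ≤ C₂ * eLpNorm (fun η => eLpNorm (fun x => decayConv N (fun y => G y η) x) p' volume)
          q volume := h₂ _ hm
    _ ≤ C₂ * eLpNorm (fun η => C₁ * eLpNorm (fun y => G y η) p volume) q volume := by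
        gcongr
        exact lpNorm_mono fun η => h₁ _ (hG.comp measurable_prodMk_right)
    _ ≤ C₂ * (C₁ * mixedLpNorm p q G) := by
        gcongr
        exact lpNorm_const_mul hm' _
    _ = _ := by push_cast; ring

theorem exists_smear_le {N : ℕ} (hN : finrank ℝ V < N) {p q : ℝ≥0∞} (hp : 1 ≤ p) (hq : 1 ≤ q) :
    ∃ C : ℝ≥0, ∀ G : V → V → ℝ≥0∞, Measurable (Function.uncurry G) → ∀ x ξ,
      smear N G x ξ ≤ C * mixedLpNorm p q G := by
  obtain ⟨C₁, h₁⟩ := exists_decayConv_le (V := V) hN hp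
  obtain ⟨C₂, h₂⟩ := exists_decayConv_le (V := V) hN hq
  refine ⟨C₂ * C₁, fun G hG x ξ => ?_⟩
  have hG' := measurable_uncurry_decayConv N hG
  have hm' : Measurable fun η => eLpNorm (fun y => G y η) p volume := measurable_lpNorm_left hG p
  calc smear N G x ξ ≤ C₂ * eLpNorm (fun η => decayConv N (fun y => G y η) x) q volume :=
        h₂ _ (hG'.comp measurable_prodMk_left) ξ
    _ ≤ C₂ * eLpNorm (fun η => C₁ * eLpNorm (fun y => G y η) p volume) q volume := by
        gcongr
        exact lpNorm_mono fun η => h₁ _ (hG.comp measurable_prodMk_right) x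
    _ ≤ C₂ * (C₁ * mixedLpNorm p q G) := by
        gcongr
        exact lpNorm_const_mul hm' _
    _ = _ := by push_cast; ring

/-- A continuous positive weight which is moderate with respect to a polynomial. -/
structure IsModerate (m : V → V → ℝ) : Prop where
  continuous : Continuous (Function.uncurry m)
  pos : ∀ x ξ, 0 < m x ξ
  moderate : ∃ (C : ℝ) (k : ℕ), 0 ≤ C ∧ ∀ x ξ y η,
    m x ξ ≤ C * ((1 + ‖x - y‖) ^ k * (1 + ‖ξ - η‖) ^ k) * m y η

/-- The hypothesis on A is symmetric in the two points. For s ≥ 0 it is raised to a power directly;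
for s < 0 the points exchange roles and reciprocals are taken, so |s| governs the polynomial. -/
theorem rpow_moderate {A : V → V → ℝ} (hc : Continuous (Function.uncurry A))
    (hpos : ∀ x ξ, 0 < A x ξ)
    (hA : ∀ x ξ y η, A x ξ ≤ 2 * ((1 + ‖x - y‖) ^ 2 * (1 + ‖ξ - η‖) ^ 2) * A y η) (s : ℝ) :
    IsModerate fun x ξ => A x ξ ^ (s / 2) := by
  refine ⟨?_, fun x ξ => Real.rpow_pos_of_pos (hpos x ξ) _, ?_⟩
  · exact hc.rpow_const fun w => Or.inl (hpos w.1 w.2).ne'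
  obtain ⟨k, hk⟩ := exists_nat_ge |s|
  refine ⟨2 ^ (|s| / 2), k, by positivity, fun x ξ y η => ?_⟩
  set B := (1 + ‖x - y‖) ^ 2 * (1 + ‖ξ - η‖) ^ 2 with hB
  have hBk : B ^ (|s| / 2) ≤ (1 + ‖x - y‖) ^ k * (1 + ‖ξ - η‖) ^ k := by
    have h1 : ∀ t : ℝ, 0 ≤ t → ((1 + t) ^ 2) ^ (|s| / 2) ≤ (1 + t) ^ k := by
      intro t ht
      rw [← Real.rpow_natCast, ← Real.rpow_mul (by positivity), ← Real.rpow_natCast (1 + t) k]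
      refine Real.rpow_le_rpow_of_exponent_le (by linarith) ?_
      push_cast
      linarith
    rw [hB, Real.mul_rpow (by positivity) (by positivity)]
    exact mul_le_mul (h1 _ (norm_nonneg _)) (h1 _ (norm_nonneg _)) (by positivity) (by positivity)
  have hB0 : 0 < B := by positivity
  have key : A x ξ ^ (s / 2) ≤ (2 * B) ^ (|s| / 2) * A y η ^ (s / 2) := by
    rcases le_total 0 s with h | h
    · rw [abs_of_nonneg h, ← Real.mul_rpow (by positivity) (hpos y η).le]
      exact Real.rpow_le_rpow (hpos x ξ).le (hA x ξ y η) (by linarith)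
    · have h2 : A y η ≤ 2 * B * A x ξ := by
        have := hA y η x ξ
        rwa [norm_sub_rev y x, norm_sub_rev η ξ] at this
      have h3 := Real.rpow_le_rpow (hpos y η).le h2 (by linarith : 0 ≤ -s / 2)
      rw [Real.mul_rpow (by positivity) (hpos x ξ).le] at h3
      rw [abs_of_nonpos h]
      have e : s / 2 = -(-s / 2) := by ring
      rw [e, Real.rpow_neg (hpos x ξ).le, Real.rpow_neg (hpos y η).le, ← div_eq_mul_inv,
        inv_eq_one_div, div_le_div_iff₀ (Real.rpow_pos_of_pos (hpos _ _) _)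
          (Real.rpow_pos_of_pos (hpos _ _) _)]
      linarith
  refine key.trans ?_
  rw [Real.mul_rpow (by positivity) hB0.le]
  have := Real.rpow_nonneg (hpos y η).le (s / 2)
  gcongr

theorem sq_add_sq_le_of_le {a b c : ℝ} (ha : 0 ≤ a) (h : a ≤ b + c) :
    a ^ 2 ≤ 2 * b ^ 2 + 2 * c ^ 2 := by
  nlinarith [sq_nonneg (b - c), pow_le_pow_left₀ ha h 2]

theorem one_add_sq_add_sq_le {u v : ℝ} (hu : 0 ≤ u) (hv : 0 ≤ v) :
    1 + u ^ 2 + v ^ 2 ≤ (1 + u) ^ 2 * (1 + v) ^ 2 := by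
  have h1 : 1 + u ^ 2 ≤ (1 + u) ^ 2 := by nlinarith
  have h2 : 1 + v ^ 2 ≤ (1 + v) ^ 2 := by nlinarith
  calc 1 + u ^ 2 + v ^ 2 ≤ (1 + u ^ 2) * (1 + v ^ 2) := by nlinarith [sq_nonneg (u * v)]
    _ ≤ _ := by gcongr

theorem isModerate_vWeight (s : ℝ) : IsModerate (vWeight s : V → V → ℝ) := by
  refine rpow_moderate (A := fun x ξ : V => 1 + ‖x‖ ^ 2 + ‖ξ‖ ^ 2) ?_ (fun x ξ => by positivity)
    (fun x ξ y η => ?_) s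
  · simp only [Function.uncurry_def]
    fun_prop
  have hx : ‖x‖ ≤ ‖y‖ + ‖x - y‖ := by simpa using norm_add_le y (x - y)
  have hξ : ‖ξ‖ ≤ ‖η‖ + ‖ξ - η‖ := by simpa using norm_add_le η (ξ - η)
  have h1 := norm_nonneg x
  have h2 := norm_nonneg ξ
  have h3 := sq_add_sq_le_of_le h1 hx
  have h4 := sq_add_sq_le_of_le h2 hξ
  have h5 := one_add_sq_add_sq_le (norm_nonneg (x - y)) (norm_nonneg (ξ - η))
  have h6 : 0 ≤ ‖y‖ ^ 2 + ‖η‖ ^ 2 := by positivity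
  calc 1 + ‖x‖ ^ 2 + ‖ξ‖ ^ 2
      ≤ 2 * (1 + ‖x - y‖ ^ 2 + ‖ξ - η‖ ^ 2) * (1 + ‖y‖ ^ 2 + ‖η‖ ^ 2) := by
        have : 0 ≤ (‖x - y‖ ^ 2 + ‖ξ - η‖ ^ 2) * (‖y‖ ^ 2 + ‖η‖ ^ 2) := by positivity
        nlinarith
    _ ≤ _ := by gcongr

theorem isModerate_oneTensorWeight (s : ℝ) : IsModerate (oneTensorWeight s : V → V → ℝ) := by
  refine rpow_moderate (A := fun _ ξ : V => 1 + ‖ξ‖ ^ 2) ?_ (fun x ξ => by positivity)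
    (fun x ξ y η => ?_) s
  · simp only [Function.uncurry_def]
    fun_prop
  have hξ : ‖ξ‖ ≤ ‖η‖ + ‖ξ - η‖ := by simpa using norm_add_le η (ξ - η)
  have h4 := sq_add_sq_le_of_le (norm_nonneg ξ) hξ
  have h5 := one_add_sq_add_sq_le (norm_nonneg (x - y)) (norm_nonneg (ξ - η))
  calc 1 + ‖ξ‖ ^ 2
      ≤ 2 * (1 + ‖x - y‖ ^ 2 + ‖ξ - η‖ ^ 2) * (1 + ‖η‖ ^ 2) := by
        have : 0 ≤ (‖x - y‖ ^ 2 + ‖ξ - η‖ ^ 2) * ‖η‖ ^ 2 := by positivity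
        nlinarith [sq_nonneg ‖x - y‖]
    _ ≤ _ := by gcongr

theorem IsModerate.measurable {m : V → V → ℝ} (hm : IsModerate m) :
    Measurable (Function.uncurry fun x ξ => ENNReal.ofReal (m x ξ)) :=
  ENNReal.measurable_ofReal.comp hm.continuous.measurable

/-- The polynomial of degree k in the moderateness of m is paid for by k extra orders of decay,
which lets the weight pass inside the smearing. -/
theorem IsModerate.exists_mul_smear_le {m : V → V → ℝ} (hm : IsModerate m) (N : ℕ) :
    ∃ (C : ℝ≥0) (n : ℕ), ∀ (G : V → V → ℝ≥0∞), Measurable (Function.uncurry G) → ∀ x ξ,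
      ENNReal.ofReal (m x ξ) * smear n G x ξ ≤
        C * smear N (fun x ξ => ENNReal.ofReal (m x ξ) * G x ξ) x ξ := by
  obtain ⟨C, k, hC, h⟩ := hm.moderate
  refine ⟨C.toNNReal, k + N, fun G hG x ξ => ?_⟩
  have hG' : Measurable (Function.uncurry fun x ξ => ENNReal.ofReal (m x ξ) * G x ξ) :=
    hm.measurable.mul hG
  rw [smear_eq hG, smear_eq hG', ← lintegral_const_mul' _ _ ENNReal.ofReal_ne_top,
    ← lintegral_const_mul' _ _ ENNReal.coe_ne_top]
  refine lintegral_mono fun w => ?_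
  have hw : ENNReal.ofReal (m x ξ) ≤ C.toNNReal * (ENNReal.ofReal ((1 + ‖x - w.1‖) ^ k) *
      ENNReal.ofReal ((1 + ‖ξ - w.2‖) ^ k)) * ENNReal.ofReal (m w.1 w.2) := by
    refine (ENNReal.ofReal_le_ofReal (h x ξ w.1 w.2)).trans_eq ?_
    rw [ENNReal.ofReal_mul (by positivity), ENNReal.ofReal_mul hC, ENNReal.ofReal_mul (by positivity)]
    rfl
  refine (mul_le_mul_left hw _).trans_eq ?_
  rw [← ofReal_pow_mul_decayE k N (x - w.1), ← ofReal_pow_mul_decayE k N (ξ - w.2)]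
  ring

/-- Change of windows for the short-time Fourier transform. -/
theorem exists_enorm_stft_le_smear {g : 𝓢(V, ℂ)} (hg : g ≠ 0) (γ : 𝓢(V, ℂ)) (N : ℕ) :
    ∃ C : ℝ≥0, ∀ (F : 𝓢'(V, ℂ)) (x ξ : V),
      ‖stft γ F x ξ‖ₑ ≤ C * smear N (fun x ξ => ‖stft g F x ξ‖ₑ) x ξ := by
  obtain ⟨q, -, hq⟩ := exists_norm_stft_coe_le_decay g N
  have hg0 := integral_norm_sq_pos hg
  set c := ∫ t, ‖g t‖ ^ 2 with hc
  refine ⟨(c⁻¹ * q γ).toNNReal, fun F x ξ => ?_⟩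
  -- Orthogonality with the shifted window as test function reproduces V_γ F(x, ξ) from V_g F;
  -- covariance makes the reproducing kernel decay in the distance to (x, ξ).
  obtain ⟨-, h⟩ := integral_stft_mul_conj_stft F g g (shiftS (x, ξ) γ)
  rw [bracket_coe_self, ← stft_eq] at h
  have hmeas : Measurable (Function.uncurry fun x ξ => ‖stft g F x ξ‖ₑ) :=
    (continuous_stft g F).enorm.measurable
  have e : stft γ F x ξ = (c⁻¹ : ℝ) * ∫ w : V × V, stft g F w.1 w.2 *
      conj (stft g ((shiftS (x, ξ) γ : 𝓢(V, ℂ)) : 𝓢'(V, ℂ)) w.1 w.2) := by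
    rw [h, ← mul_assoc, ← Complex.ofReal_mul, inv_mul_cancel₀ hg0.ne', Complex.ofReal_one, one_mul]
  rw [e, enorm_mul, smear_eq hmeas, ← lintegral_const_mul' _ _ ENNReal.coe_ne_top]
  refine (mul_le_mul_right (enorm_integral_le_lintegral_enorm _) _).trans ?_
  rw [← lintegral_const_mul' _ _ enorm_ne_top]
  refine lintegral_mono fun w => ?_
  have h1 : ‖stft g ((shiftS (x, ξ) γ : 𝓢(V, ℂ)) : 𝓢'(V, ℂ)) w.1 w.2‖ₑ ≤
      ENNReal.ofReal (q γ) * (decayE N (x - w.1) * decayE N (ξ - w.2)) := by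
    rw [← ofReal_norm, norm_stft_shiftS, decayE_sub_comm, decayE_sub_comm N ξ, decayE, decayE,
      ← ENNReal.ofReal_mul (decay_pos _ _).le, ← ENNReal.ofReal_mul (apply_nonneg _ _)]
    exact ENNReal.ofReal_le_ofReal (hq γ _ _)
  have h2 : ‖((c⁻¹ : ℝ) : ℂ)‖ₑ = ENNReal.ofReal c⁻¹ := by
    rw [← ofReal_norm, Complex.norm_real, Real.norm_of_nonneg (by positivity)]
  rw [enorm_mul, RCLike.enorm_conj, h2]
  refine (mul_le_mul_right (mul_le_mul_right h1 _) _).trans_eq ?_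
  have h3 : (((c⁻¹ * q γ).toNNReal : ℝ≥0) : ℝ≥0∞) = ENNReal.ofReal c⁻¹ * ENNReal.ofReal (q γ) := by
    rw [← ENNReal.ofReal_mul (by positivity)]
    rfl
  rw [h3]
  ring

theorem modulationNorm_eq (g : 𝓢(V, ℂ)) (p q : ℝ≥0∞) {m : V → V → ℝ} (hm : IsModerate m)
    (f : 𝓢'(V, ℂ)) : modulationNorm g p q m f =
      mixedLpNorm p q (fun x ξ => ENNReal.ofReal (m x ξ) * ‖stft g f x ξ‖ₑ) := by
  have : ∀ x ξ, ENNReal.ofReal (m x ξ) * ‖stft g f x ξ‖ₑ = ‖(m x ξ : ℂ) * stft g f x ξ‖ₑ := by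
    intro x ξ
    rw [enorm_mul, ← ofReal_norm (m x ξ : ℂ), Complex.norm_real,
      Real.norm_of_nonneg (hm.pos x ξ).le]
  simp only [this, mixedLpNorm, eLpNorm_enorm]
  rfl

theorem measurable_weight_mul_stft (γ : 𝓢(V, ℂ)) {m : V → V → ℝ} (hm : IsModerate m) (f : 𝓢'(V, ℂ)) :
    Measurable (Function.uncurry fun x ξ => ENNReal.ofReal (m x ξ) * ‖stft γ f x ξ‖ₑ) :=
  hm.measurable.mul (continuous_stft γ f).enorm.measurable

theorem mixedLpNorm_mono {p q : ℝ≥0∞} {F G : V → V → ℝ≥0∞} (h : ∀ x ξ, F x ξ ≤ G x ξ) :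
    mixedLpNorm p q F ≤ mixedLpNorm p q G :=
  lpNorm_mono fun ξ => lpNorm_mono fun x => h x ξ

theorem mixedLpNorm_const_mul {p q : ℝ≥0∞} {F : V → V → ℝ≥0∞} (hF : Measurable (Function.uncurry F))
    (c : ℝ≥0∞) : mixedLpNorm p q (fun x ξ => c * F x ξ) ≤ c * mixedLpNorm p q F :=
  (lpNorm_mono fun _ => lpNorm_const_mul (hF.comp measurable_prodMk_right) c).trans
    (lpNorm_const_mul (measurable_lpNorm_left hF p) c)

/-- A weighted mixed norm of a function controlled by smearing. -/
theorem IsModerate.exists_mixedLpNorm_le {m : V → V → ℝ} (hm : IsModerate m) {p q p' q' : ℝ≥0∞}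
    (hp : 1 ≤ p) (hpp : p ≤ p') (hq : 1 ≤ q) (hqq : q ≤ q') :
    ∃ (C : ℝ≥0) (n : ℕ), ∀ G : V → V → ℝ≥0∞, Measurable (Function.uncurry G) →
      mixedLpNorm p' q' (fun x ξ => ENNReal.ofReal (m x ξ) * smear n G x ξ) ≤
        C * mixedLpNorm p q (fun x ξ => ENNReal.ofReal (m x ξ) * G x ξ) := by
  obtain ⟨C₁, n, h₁⟩ := hm.exists_mul_smear_le (finrank ℝ V + 1)
  obtain ⟨C₂, h₂⟩ := exists_mixedLpNorm_smear_le (V := V) (Nat.lt_succ_self _) hp hpp hq hqq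
  refine ⟨C₁ * C₂, n, fun G hG => ?_⟩
  have hG' : Measurable (Function.uncurry fun x ξ => ENNReal.ofReal (m x ξ) * G x ξ) :=
    hm.measurable.mul hG
  refine (mixedLpNorm_mono (h₁ G hG)).trans ((mixedLpNorm_const_mul (measurable_smear _ hG') _).trans
    ?_)
  rw [ENNReal.coe_mul, mul_assoc]
  exact mul_le_mul_right (h₂ _ hG') _

/-- Window independence and embeddings of modulation spaces. -/
theorem exists_mixedLpNorm_stft_le {g : 𝓢(V, ℂ)} (hg : g ≠ 0) (γ : 𝓢(V, ℂ)) {m : V → V → ℝ}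
    (hm : IsModerate m) {p q p' q' : ℝ≥0∞}
    (hp : 1 ≤ p) (hpp : p ≤ p') (hq : 1 ≤ q) (hqq : q ≤ q') :
    ∃ C : ℝ≥0, ∀ f : 𝓢'(V, ℂ),
      mixedLpNorm p' q' (fun x ξ => ENNReal.ofReal (m x ξ) * ‖stft γ f x ξ‖ₑ) ≤
        C * modulationNorm g p q m f := by
  obtain ⟨C₁, n, h₁⟩ := hm.exists_mixedLpNorm_le hp hpp hq hqq
  obtain ⟨C₂, h₂⟩ := exists_enorm_stft_le_smear hg γ n
  refine ⟨C₂ * C₁, fun f => ?_⟩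
  have hmeas : Measurable (Function.uncurry fun x ξ => ‖stft g f x ξ‖ₑ) :=
    (continuous_stft g f).enorm.measurable
  have := h₁ (fun x ξ => ‖stft g f x ξ‖ₑ) hmeas
  rw [← modulationNorm_eq g p q hm] at this
  refine (mixedLpNorm_mono fun x ξ => mul_le_mul_right (h₂ f x ξ) _).trans ?_
  simp only [mul_left_comm _ (C₂ : ℝ≥0∞)]
  refine (mixedLpNorm_const_mul (hm.measurable.mul (measurable_smear n hmeas)) _).trans ?_
  rw [ENNReal.coe_mul, mul_assoc]
  exact mul_le_mul_right this _

end Smearing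

/-! ### The Gaussian window and its ambiguity function. -/

section Gaussian

open Filter Module

variable {V : Type*} [NormedAddCommGroup V] [InnerProductSpace ℝ V]

theorem exists_mul_exp_neg_le (k : ℕ) : ∃ C : ℝ, ∀ t : ℝ, 0 ≤ t →
    (1 + t) ^ k * Real.exp (-π * t ^ 2) ≤ C := by
  obtain ⟨C, hC⟩ : ∃ C, ∀ t ∈ Set.Ici (0 : ℝ), t ^ k * Real.exp (-t) ≤ C := by
    have hbd : ∀ t : ℝ, 0 ≤ t → t ^ k * Real.exp (-t) ≤ k.factorial := by
      intro t ht
      have := Real.pow_div_factorial_le_exp t ht k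
      rw [div_le_iff₀ (by positivity)] at this
      calc t ^ k * Real.exp (-t) ≤ Real.exp t * k.factorial * Real.exp (-t) := by gcongr
        _ = k.factorial := by rw [mul_right_comm, ← Real.exp_add]; simp
    exact ⟨_, hbd⟩
  refine ⟨C * Real.exp 2, fun t ht => ?_⟩
  have h2 := hC (1 + t) (by simp; linarith)
  have h3 : -π * t ^ 2 ≤ -(1 + t) + 2 := by nlinarith [Real.pi_gt_three, sq_nonneg (t - 1)]
  calc (1 + t) ^ k * Real.exp (-π * t ^ 2)
      ≤ (1 + t) ^ k * (Real.exp (-(1 + t)) * Real.exp 2) := by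
        rw [← Real.exp_add]
        gcongr
    _ = (1 + t) ^ k * Real.exp (-(1 + t)) * Real.exp 2 := by ring
    _ ≤ C * Real.exp 2 := by gcongr

theorem norm_iteratedFDeriv_exp_neg_pi (n : ℕ) (u : ℝ) :
    ‖iteratedFDeriv ℝ n (fun u : ℝ => Real.exp (-π * u)) u‖ = π ^ n * Real.exp (-π * u) := by
  rw [norm_iteratedFDeriv_eq_norm_iteratedDeriv, iteratedDeriv_exp_const_mul]
  simp [abs_of_pos Real.pi_pos]

/-- The Gaussian `e^{-π|t|²}`. -/
def gaussian (V : Type*) [NormedAddCommGroup V] [InnerProductSpace ℝ V] : 𝓢(V, ℂ) where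
  toFun t := (Real.exp (-π * ‖t‖ ^ 2) : ℝ)
  smooth' := by
    have : ContDiff ℝ ((⊤ : ℕ∞) : WithTop ℕ∞) fun t : V => Real.exp (-π * ‖t‖ ^ 2) :=
      Real.contDiff_exp.comp (contDiff_const.mul (contDiff_norm_sq ℝ))
    exact Complex.ofRealCLM.contDiff.comp this
  decay' k n := by
    obtain ⟨l, C, hC, h⟩ :=
      (Function.hasTemperateGrowth_norm_sq V).norm_iteratedFDeriv_le_uniform n
    obtain ⟨B, hB⟩ := exists_mul_exp_neg_le (k + l * n)
    refine ⟨n.factorial * π ^ n * (max 1 C) ^ n * B, fun x => ?_⟩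
    have e : (fun t : V => ((Real.exp (-π * ‖t‖ ^ 2) : ℝ) : ℂ)) =
        Complex.ofRealLI ∘ ((fun u : ℝ => Real.exp (-π * u)) ∘ fun t : V => ‖t‖ ^ 2) := rfl
    have hs : ContDiff ℝ ((⊤ : ℕ∞) : WithTop ℕ∞) ((fun u : ℝ => Real.exp (-π * u)) ∘ fun t : V => ‖t‖ ^ 2) :=
      Real.contDiff_exp.comp (contDiff_const.mul (contDiff_norm_sq ℝ))
    rw [e, Complex.ofRealLI.norm_iteratedFDeriv_comp_left (hs.contDiffAt) (by exact_mod_cast le_top)]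
    have h1 : 1 ≤ max 1 C * (1 + ‖x‖) ^ l :=
      one_le_mul_of_one_le_of_one_le (le_max_left _ _)
        (one_le_pow₀ (by linarith [norm_nonneg x]))
    have h2 := norm_iteratedFDeriv_comp_le (𝕜 := ℝ) (n := n) (N := ((⊤ : ℕ∞) : WithTop ℕ∞))
      (g := fun u : ℝ => Real.exp (-π * u)) (f := fun t : V => ‖t‖ ^ 2)
      (Real.contDiff_exp.comp (contDiff_const.mul contDiff_id)) (contDiff_norm_sq ℝ)
      (by exact_mod_cast le_top) x (C := π ^ n * Real.exp (-π * ‖x‖ ^ 2))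
      (D := max 1 C * (1 + ‖x‖) ^ l) (fun i hi => by
        rw [norm_iteratedFDeriv_exp_neg_pi]
        gcongr
        linarith [Real.pi_gt_three]) (fun i hi hin => by
        refine (h i hin x).trans ?_
        refine le_trans ?_ (le_self_pow₀ h1 (by omega))
        gcongr
        exact le_max_right _ _)
    calc ‖x‖ ^ k * _ ≤ (1 + ‖x‖) ^ k * (n.factorial * (π ^ n * Real.exp (-π * ‖x‖ ^ 2)) *
          (max 1 C * (1 + ‖x‖) ^ l) ^ n) := by
          gcongr
          linarith
      _ = n.factorial * π ^ n * (max 1 C) ^ n *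
          ((1 + ‖x‖) ^ (k + l * n) * Real.exp (-π * ‖x‖ ^ 2)) := by
          rw [mul_pow, pow_add, pow_mul]
          ring
      _ ≤ _ := by
          gcongr
          exact hB _ (norm_nonneg x)

theorem gaussian_apply (t : V) : gaussian V t = (Real.exp (-π * ‖t‖ ^ 2) : ℝ) := rfl

theorem gaussian_ne_zero : gaussian V ≠ 0 := by
  intro h
  have := DFunLike.congr_fun h 0
  simp [gaussian_apply] at this

variable [FiniteDimensional ℝ V] [MeasurableSpace V] [BorelSpace V]

/-- Centring at x/2 and the parallelogram law separate the product of the two Gaussians into a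
factor in x and e^{-2π|t|²}, whose Fourier transform is Gaussian. The identity lets a Gaussian on
phase space be shared out as two ambiguity functions. -/
theorem exists_norm_sq_stft_gaussian : ∃ c : ℝ, 0 < c ∧ ∀ x ξ : V,
    ‖stft (gaussian V) (gaussian V : 𝓢'(V, ℂ)) x ξ‖ ^ 2 =
      c * Real.exp (-π * (‖x‖ ^ 2 + ‖ξ‖ ^ 2)) := by
  set K : ℂ := (π / (2 * π : ℝ)) ^ (finrank ℝ V / 2 : ℂ) with hK
  have hK0 : K ≠ 0 := by
    rw [hK, Complex.cpow_def_of_ne_zero]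
    · exact Complex.exp_ne_zero _
    · have := Real.pi_pos.ne'
      have : (π : ℂ) ≠ 0 := by exact_mod_cast this
      simp [this]
  refine ⟨‖K‖ ^ 2, by positivity, fun x ξ => ?_⟩
  have key : stft (gaussian V) (gaussian V : 𝓢'(V, ℂ)) x ξ =
      character (-ξ) ((1 / 2 : ℝ) • x) * (Real.exp (-π / 2 * ‖x‖ ^ 2) : ℝ) *
        (K * (Real.exp (-π / 2 * ‖ξ‖ ^ 2) : ℝ)) := by
    have hg := GaussianFourier.integral_cexp_neg_mul_sq_norm_add (V := V) (b := ((2 * π : ℝ) : ℂ))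
      (by rw [Complex.ofReal_re]; positivity) (-2 * π * Complex.I) ξ
    have e2 : Complex.exp ((-2 * π * Complex.I) ^ 2 * ‖ξ‖ ^ 2 / (4 * ((2 * π : ℝ) : ℂ))) =
        ((Real.exp (-π / 2 * ‖ξ‖ ^ 2) : ℝ) : ℂ) := by
      rw [Complex.ofReal_exp]
      congr 1
      have : (π : ℂ) ≠ 0 := by exact_mod_cast Real.pi_pos.ne'
      push_cast
      rw [mul_pow, Complex.I_sq]
      field_simp
      ring
    rw [e2, ← hK] at hg
    rw [stft_coe, ← hg, ← integral_const_mul,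
      ← integral_add_right_eq_self (fun t => conj (shiftS (x, ξ) (gaussian V) t) * gaussian V t)
        ((1 / 2 : ℝ) • x)]
    refine integral_congr_ae (Eventually.of_forall fun t => ?_)
    have e1 : t + (1 / 2 : ℝ) • x - x = t - (1 / 2 : ℝ) • x := by
      rw [show t + (1 / 2 : ℝ) • x - x = t + ((1 / 2 : ℝ) • x - (1 : ℝ) • x) by rw [one_smul]; abel,
        ← sub_smul]
      rw [sub_eq_add_neg t, ← neg_smul]
      norm_num
    simp only [shiftS_apply, gaussian_apply, e1, map_mul, Complex.conj_ofReal, ← character_neg_left]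
    rw [character_add_right]
    have e3 : Real.exp (-π * ‖t - (1 / 2 : ℝ) • x‖ ^ 2) * Real.exp (-π * ‖t + (1 / 2 : ℝ) • x‖ ^ 2)
        = Real.exp (-π / 2 * ‖x‖ ^ 2) * Real.exp (-(2 * π) * ‖t‖ ^ 2) := by
      rw [← Real.exp_add, ← Real.exp_add]
      congr 1
      have h := parallelogram_law_with_norm ℝ t ((1 / 2 : ℝ) • x)
      have h' : ‖(1 / 2 : ℝ) • x‖ = 1 / 2 * ‖x‖ := by
        rw [norm_smul, Real.norm_of_nonneg (by norm_num)]
      rw [h'] at h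
      linear_combination -π * h
    have e4 : Complex.exp (-((2 * π : ℝ) : ℂ) * ‖t‖ ^ 2 + -2 * π * Complex.I * (⟪ξ, t⟫_ℝ : ℂ)) =
        character (-ξ) t * ((Real.exp (-(2 * π) * ‖t‖ ^ 2) : ℝ) : ℂ) := by
      rw [character, Complex.ofReal_exp, ← Complex.exp_add, inner_neg_left]
      congr 1
      push_cast
      ring
    have e5 := congrArg (fun r : ℝ => (r : ℂ)) e3
    push_cast [-Complex.ofReal_exp] at e5
    simp only [e4]
    linear_combination (character (-ξ) t * character (-ξ) ((1 / 2 : ℝ) • x)) * e5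
  rw [key, norm_mul, norm_mul, norm_mul, norm_character, Complex.norm_real, Complex.norm_real,
    Real.norm_of_nonneg (Real.exp_pos _).le, Real.norm_of_nonneg (Real.exp_pos _).le]
  have : Real.exp (-π * (‖x‖ ^ 2 + ‖ξ‖ ^ 2)) =
      (Real.exp (-π / 2 * ‖x‖ ^ 2) * Real.exp (-π / 2 * ‖ξ‖ ^ 2)) ^ 2 := by
    rw [← Real.exp_add, ← Real.exp_nat_mul]
    congr 1
    push_cast
    ring
  rw [this]
  ring

end Gaussian

/-! ### The transform of a product of two short-time Fourier transforms. -/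

section MagicFormula

open Filter Module FourierTransform

variable {V : Type*} [NormedAddCommGroup V] [InnerProductSpace ℝ V] [FiniteDimensional ℝ V]
  [MeasurableSpace V] [BorelSpace V]

/-- Exchanging function and window reflects the point and conjugates, up to a phase; a
distributional window is thus reduced to a Schwartz window. -/
theorem stftDistWindow_eq (φ : 𝓢'(V, ℂ)) (f : 𝓢(V, ℂ)) (x ξ : V) :
    stftDistWindow φ f x ξ = conj (character ξ x) * conj (stft f φ (-x) (-ξ)) := by
  rw [stftDistWindow, translateS_modulateS, bracket_smul_right, character_neg_left,
    character_neg_right, Complex.conj_conj, Complex.conj_conj, map_mul]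
  rfl

theorem continuous_stftDistWindow (φ : 𝓢'(V, ℂ)) (f : 𝓢(V, ℂ)) :
    Continuous fun w : V × V => stftDistWindow φ f w.1 w.2 := by
  simp only [stftDistWindow_eq]
  have h1 := (continuous_stft f φ).comp (continuous_neg (G := V × V))
  have h2 := (continuous_character (V := V)).comp continuous_swap
  exact (Complex.continuous_conj.comp h2).mul (Complex.continuous_conj.comp h1)

theorem shiftS_shiftS (y v : V × V) (γ : 𝓢(V, ℂ)) :
    shiftS y (shiftS v γ) = conj (character v.2 y.1) • shiftS (y + v) γ := by
  ext t
  simp only [smul_apply, smul_eq_mul, shiftS_apply, Prod.fst_add, Prod.snd_add]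
  rw [sub_eq_add_neg t, character_add_right, character_neg_right, character_add_left]
  rw [show t + -y.1 - v.1 = t - (y.1 + v.1) by abel]
  ring

theorem stft_shiftS_window (z v : V × V) (γ : 𝓢(V, ℂ)) (F : 𝓢'(V, ℂ)) :
    stft (shiftS z γ) F v.1 v.2 = character z.2 v.1 * stft γ F (v.1 + z.1) (v.2 + z.2) := by
  rw [stft_eq, stft_eq, shiftS_shiftS, bracket_smul_right, Complex.conj_conj]
  rfl

theorem shiftS_zero (γ : 𝓢(V, ℂ)) : shiftS 0 γ = γ := by
  ext t
  simp [shiftS_apply, character]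

theorem conj_stft_self (γ : 𝓢(V, ℂ)) (u : V × V) :
    conj (stft γ (γ : 𝓢'(V, ℂ)) u.1 u.2) =
      character u.2 u.1 * stft γ (γ : 𝓢'(V, ℂ)) (-u.1) (-u.2) := by
  have h := bracket_shiftS_shiftS u 0 γ γ
  rw [shiftS_zero] at h
  rw [stft_eq, bracket_coe_conj, h]
  simp

/-- Collects every phase produced by composing shifts in `conj_mul_ambiguityProduct`; both sides are
exponentials of the same bilinear expression. -/
theorem phase_identity (y z η : V × V) :
    conj (character η.1 y.1 * character η.2 y.2) * conj (character y.2 y.1) *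
      character (y.2 - z.2) (y.1 - z.1) =
    character (η.1 + z.2) (-y.1) * conj (character (-z.2) (-η.2)) *
      character (-z.2 + y.2) (-η.2 - z.1) := by
  simp only [character, map_mul, ← Complex.exp_conj, Complex.conj_ofReal, Complex.conj_I]
  simp only [← Complex.exp_add]
  congr 1
  simp only [inner_add_left, inner_sub_left, inner_sub_right, inner_neg_left, inner_neg_right,
    real_inner_comm η.2 y.2]
  push_cast
  ring

/-- The product of a short-time Fourier transform with a distributional window and a translate of
the ambiguity function of `γ`. -/
def ambiguityProduct (γ : 𝓢(V, ℂ)) (φ : 𝓢'(V, ℂ)) (f : 𝓢(V, ℂ)) (z y : V × V) : ℂ :=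
  stftDistWindow φ f y.1 y.2 * conj (stft γ (γ : 𝓢'(V, ℂ)) (y.1 - z.1) (y.2 - z.2))

theorem continuous_ambiguityProduct (γ : 𝓢(V, ℂ)) (φ : 𝓢'(V, ℂ)) (f : 𝓢(V, ℂ)) (z : V × V) :
    Continuous (ambiguityProduct γ φ f z) := by
  have h1 := (continuous_stft γ (γ : 𝓢'(V, ℂ))).comp (continuous_sub_right z)
  exact (continuous_stftDistWindow φ f).mul (Complex.continuous_conj.comp h1)

/-- A character times the translated ambiguity function of γ is again a transform of one shift of γ
with another shift of γ as window. The integrand of the Fourier transform at η thereby becomes that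
of an orthogonality relation. -/
theorem conj_mul_ambiguityProduct (γ : 𝓢(V, ℂ)) (φ : 𝓢'(V, ℂ)) (f : 𝓢(V, ℂ)) (z η y : V × V) :
    conj (character η.1 y.1 * character η.2 y.2) * ambiguityProduct γ φ f z y =
      conj (stft f φ (-y.1) (-y.2) * conj (stft (shiftS (-η.2, η.1 + z.2) γ)
        ((shiftS (-η.2, η.1 + z.2) (shiftS (-z) γ) : 𝓢(V, ℂ)) : 𝓢'(V, ℂ)) (-y.1) (-y.2))) := by
  have h1 : stft (shiftS (-η.2, η.1 + z.2) γ)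
        ((shiftS (-η.2, η.1 + z.2) (shiftS (-z) γ) : 𝓢(V, ℂ)) : 𝓢'(V, ℂ)) (-y.1) (-y.2) =
      character (η.1 + z.2) (-y.1) * conj (character (-z.2) (-η.2)) *
      character (-z.2 + y.2) (-η.2 - z.1) *
        stft γ (γ : 𝓢'(V, ℂ)) (-(y.1 - z.1)) (-(y.2 - z.2)) := by
    rw [stft_eq, shiftS_shiftS (-η.2, η.1 + z.2) (-z)]
    rw [show ((-y.1, -y.2) : V × V) = -y from rfl, shiftS_shiftS (-y) (-η.2, η.1 + z.2),
      bracket_smul_right, Complex.conj_conj]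
    have h2 : ∀ (c : ℂ) (F G : 𝓢(V, ℂ)),
        bracket ((c • F : 𝓢(V, ℂ)) : 𝓢'(V, ℂ)) G = c * bracket (F : 𝓢'(V, ℂ)) G := by
      intro c F G
      rw [bracket_coe, bracket_coe, ← integral_const_mul]
      refine integral_congr_ae (Eventually.of_forall fun t => ?_)
      simp only [smul_apply, smul_eq_mul]
      ring
    rw [h2, bracket_shiftS_shiftS]
    have e1 : (-y + (-η.2, η.1 + z.2)).1 - ((-η.2, η.1 + z.2) + -z).1 = -(y.1 - z.1) := by
      simp
      abel
    have e2 : (-y + (-η.2, η.1 + z.2)).2 - ((-η.2, η.1 + z.2) + -z).2 = -(y.2 - z.2) := by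
      simp
      abel
    have e3 : ((-η.2, η.1 + z.2) + -z).2 - (-y + (-η.2, η.1 + z.2)).2 = -z.2 + y.2 := by
      simp
      abel
    have e4 : ((-η.2, η.1 + z.2) + -z).1 = -η.2 - z.1 := by
      simp [sub_eq_add_neg]
    rw [e1, e2, e3, e4]
    simp only [Prod.fst_neg, Prod.snd_neg]
    ring
  have h3 := conj_stft_self γ (y - z)
  simp only [Prod.fst_sub, Prod.snd_sub] at h3
  rw [h1, ← phase_identity, ambiguityProduct, stftDistWindow_eq]
  simp only [map_mul, Complex.conj_conj, h3]
  ring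

instance isNegInvariant_volume_prod : (volume : Measure (V × V)).IsNegInvariant :=
  ⟨((Measure.measurePreserving_neg (volume : Measure V)).prod
    (Measure.measurePreserving_neg (volume : Measure V))).map_eq⟩

theorem integrable_ambiguityProduct (γ : 𝓢(V, ℂ)) (φ : 𝓢'(V, ℂ)) (f : 𝓢(V, ℂ)) (z : V × V) :
    Integrable (ambiguityProduct γ φ f z) := by
  have h := (integral_stft_mul_conj_stft φ f (shiftS (-0, 0 + z.2) γ)
    (shiftS (-0, 0 + z.2) (shiftS (-z) γ))).1
  have h2 := Complex.conjCLE.toContinuousLinearMap.integrable_comp h.comp_neg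
  refine h2.congr (Eventually.of_forall fun y => ?_)
  have := conj_mul_ambiguityProduct γ φ f z 0 y
  simp only [character, Prod.fst_zero, Prod.snd_zero, inner_zero_left, mul_zero,
    Complex.ofReal_zero, zero_mul, Complex.exp_zero, map_one, one_mul] at this
  rw [this]
  rfl

theorem integral_ambiguityProduct (γ : 𝓢(V, ℂ)) (φ : 𝓢'(V, ℂ)) (f : 𝓢(V, ℂ)) (z η : V × V) :
    ∫ y : V × V, conj (character η.1 y.1 * character η.2 y.2) * ambiguityProduct γ φ f z y =
      conj (stft (shiftS (-z) γ) φ (-η.2) (η.1 + z.2)) *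
        stft γ (f : 𝓢'(V, ℂ)) (-η.2) (η.1 + z.2) := by
  simp only [conj_mul_ambiguityProduct]
  rw [integral_conj]
  have h := (integral_stft_mul_conj_stft φ f (shiftS (-η.2, η.1 + z.2) γ)
    (shiftS (-η.2, η.1 + z.2) (shiftS (-z) γ))).2
  rw [← integral_neg_eq_self] at h
  simp only [Prod.fst_neg, Prod.snd_neg] at h
  rw [h, map_mul, bracket_coe_conj, ← stft_eq, ← stft_eq, mul_comm]

/-- Parseval's identity for functions with integrable Fourier transform. -/
theorem integral_conj_mul_mul_conj_character {E : Type*} [NormedAddCommGroup E]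
    [InnerProductSpace ℝ E] [FiniteDimensional ℝ E] [MeasurableSpace E] [BorelSpace E]
    {P Q : E → ℂ} (hP : Integrable P) (hQ : Integrable Q) (hPc : Continuous P)
    (hFP : Integrable (𝓕 P)) (ζ : E) :
    ∫ y, conj (P y) * Q y * conj (character ζ y) = ∫ η, conj (𝓕 P η) * 𝓕 Q (η + ζ) := by
  set R : E → ℂ := fun y => Q y * conj (character ζ y) with hR
  have hRi : Integrable R := by
    have hc : Continuous fun y => conj (character ζ y) := by
      unfold character
      fun_prop
    refine hQ.mul_bdd (c := 1) hc.aestronglyMeasurable (Eventually.of_forall fun y => ?_)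
    rw [RCLike.norm_conj, norm_character]
  have hFR : ∀ η, 𝓕 R η = 𝓕 Q (η + ζ) := by
    intro η
    rw [Real.fourier_eq', Real.fourier_eq']
    refine integral_congr_ae (Eventually.of_forall fun y => ?_)
    simp only [hR, smul_eq_mul]
    rw [← character_neg_left, character, mul_left_comm, mul_comm (Q y),
      ← Complex.exp_add, inner_add_right, inner_neg_left, real_inner_comm ζ y]
    congr 2
    push_cast
    ring
  have hcFP : Integrable fun η => conj (𝓕 P η) :=
    Complex.conjCLE.toContinuousLinearMap.integrable_comp hFP
  -- Conjugated Fourier inversion. It reduces the claim to the multiplication formula, which moves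
  -- the Fourier transform from one factor to the other and needs integrability only.
  have hinv : ∀ y, 𝓕 (fun η => conj (𝓕 P η)) y = conj (P y) := by
    intro y
    rw [← hP.fourierInv_fourier_eq hFP hPc.continuousAt, Real.fourierInv_eq', Real.fourier_eq',
      ← integral_conj]
    refine integral_congr_ae (Eventually.of_forall fun η => ?_)
    simp only [smul_eq_mul, map_mul, ← Complex.exp_conj, Complex.conj_ofReal, Complex.conj_I]
    congr 2
    push_cast
    ring
  have h := VectorFourier.integral_fourierIntegral_smul_eq_flip (e := Real.fourierChar)
    (L := innerₗ E) (μ := volume) (ν := volume) (f := fun η => conj (𝓕 P η)) (g := R)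
    Real.continuous_fourierChar continuous_inner hcFP hRi
  rw [flip_innerₗ] at h
  calc ∫ y, conj (P y) * Q y * conj (character ζ y)
      = ∫ y, 𝓕 (fun η => conj (𝓕 P η)) y • R y := by
        refine integral_congr_ae (Eventually.of_forall fun y => ?_)
        simp only [hinv, hR, smul_eq_mul]
        ring
    _ = ∫ η, conj (𝓕 P η) • 𝓕 R η := h
    _ = _ := by simp only [hFR, smul_eq_mul]

theorem integrable_stft_mul_stft (φ : 𝓢'(V, ℂ)) (γ₁ γ₂ f : 𝓢(V, ℂ)) :
    Integrable fun v : V × V => conj (stft γ₁ φ v.1 v.2) * stft γ₂ (f : 𝓢'(V, ℂ)) v.1 v.2 := by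
  have := Complex.conjCLE.toContinuousLinearMap.integrable_comp
    (integral_stft_mul_conj_stft φ γ₁ γ₂ f).1
  refine this.congr (Eventually.of_forall fun v => ?_)
  simp

/-- The measurable equivalence `(x, ξ) ↦ (-ξ, x + b)`. -/
def rotateShift (b : V) : V × V ≃ᵐ V × V :=
  MeasurableEquiv.prodComm.trans ((MeasurableEquiv.neg V).prodCongr (MeasurableEquiv.addRight b))

theorem measurePreserving_rotateShift (b : V) : MeasurePreserving (rotateShift b) := by
  have h1 : MeasurePreserving (MeasurableEquiv.prodComm : V × V ≃ᵐ V × V) volume volume :=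
    Measure.measurePreserving_swap
  have h2 : MeasurePreserving ((MeasurableEquiv.neg V).prodCongr (MeasurableEquiv.addRight b))
      volume volume :=
    (Measure.measurePreserving_neg (volume : Measure V)).prod
      (measurePreserving_add_right (volume : Measure V) b)
  exact h2.comp h1

/-- The measurable equivalence between the Euclidean and the set-theoretic product. -/
def phaseEquiv (V : Type*) [NormedAddCommGroup V] [InnerProductSpace ℝ V] [FiniteDimensional ℝ V]
    [MeasurableSpace V] [BorelSpace V] : WithLp 2 (V × V) ≃ᵐ V × V :=
  (WithLp.prodContinuousLinearEquiv 2 ℝ V V).toHomeomorph.toMeasurableEquiv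

theorem phaseEquiv_apply (w : WithLp 2 (V × V)) : phaseEquiv V w = (w.fst, w.snd) := rfl

theorem measurePreserving_phaseEquiv : MeasurePreserving (phaseEquiv V) :=
  WithLp.volume_preserving_ofLp V V

theorem character_phase (ζ y : WithLp 2 (V × V)) :
    character ζ y = character ζ.fst y.fst * character ζ.snd y.snd := by
  rw [character, character, character, ← Complex.exp_add,
    show ⟪ζ, y⟫_ℝ = ⟪ζ.fst, y.fst⟫_ℝ + ⟪ζ.snd, y.snd⟫_ℝ from WithLp.prod_inner_apply ζ y]
  congr 1
  push_cast
  ring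

theorem fourier_ambiguityProduct (γ : 𝓢(V, ℂ)) (φ : 𝓢'(V, ℂ)) (f : 𝓢(V, ℂ)) (z : V × V)
    (η : WithLp 2 (V × V)) :
    𝓕 (fun y => ambiguityProduct γ φ f z (phaseEquiv V y)) η =
      conj (stft (shiftS (-z) γ) φ (-η.snd) (η.fst + z.2)) *
        stft γ (f : 𝓢'(V, ℂ)) (-η.snd) (η.fst + z.2) := by
  have h := integral_ambiguityProduct γ φ f z (η.fst, η.snd)
  rw [← measurePreserving_phaseEquiv.integral_comp'] at h
  rw [← h, Real.fourier_eq']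
  refine integral_congr_ae (Eventually.of_forall fun y => ?_)
  simp only [smul_eq_mul, phaseEquiv_apply]
  rw [← character_phase, ← character_neg_left, character, inner_neg_left, real_inner_comm]
  congr 3
  push_cast
  ring

/-- A short-time Fourier transform, with Gaussian window, of the product of two short-time Fourier
transforms. -/
theorem exists_stftFun_gaussian_eq : ∃ c : ℝ, 0 < c ∧ ∀ (φ₁ φ₂ : 𝓢'(V, ℂ)) (f g : 𝓢(V, ℂ))
    (z ζ : WithLp 2 (V × V)),
    c * stftFun (gaussian (WithLp 2 (V × V))) (fun w =>
      conj (stftDistWindow φ₁ f w.fst w.snd) * stftDistWindow φ₂ g w.fst w.snd) z ζ =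
    ∫ v : V × V, stft (shiftS (-(z.fst, z.snd)) (gaussian V)) φ₁ v.1 v.2 *
      conj (stft (gaussian V) (f : 𝓢'(V, ℂ)) v.1 v.2) *
      (conj (stft (shiftS (-(z.fst, z.snd)) (gaussian V)) φ₂ (v.1 - ζ.snd) (v.2 + ζ.fst)) *
        stft (gaussian V) (g : 𝓢'(V, ℂ)) (v.1 - ζ.snd) (v.2 + ζ.fst)) := by
  obtain ⟨c, hc, h⟩ := exists_norm_sq_stft_gaussian (V := V)
  refine ⟨c, hc, fun φ₁ φ₂ f g z ζ => ?_⟩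
  set z' : V × V := (z.fst, z.snd) with hz'
  set P : WithLp 2 (V × V) → ℂ :=
    fun y => ambiguityProduct (gaussian V) φ₁ f z' (phaseEquiv V y) with hP
  set Q : WithLp 2 (V × V) → ℂ :=
    fun y => ambiguityProduct (gaussian V) φ₂ g z' (phaseEquiv V y) with hQ
  have hint : ∀ (φ : 𝓢'(V, ℂ)) (f : 𝓢(V, ℂ)), Integrable (fun y : WithLp 2 (V × V) =>
      ambiguityProduct (gaussian V) φ f z' (phaseEquiv V y)) := fun φ f =>
    measurePreserving_phaseEquiv.integrable_comp_of_integrable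
      (integrable_ambiguityProduct (gaussian V) φ f z')
  have hPc : Continuous P := (continuous_ambiguityProduct _ _ _ _).comp
    (WithLp.prodContinuousLinearEquiv 2 ℝ V V).continuous
  have hFP : Integrable (𝓕 P) := by
    have h1 := (measurePreserving_rotateShift z'.2).integrable_comp_of_integrable
      (integrable_stft_mul_stft φ₁ (shiftS (-z') (gaussian V)) (gaussian V) f)
    refine (measurePreserving_phaseEquiv.integrable_comp_of_integrable h1).congr
      (Eventually.of_forall fun η => ?_)
    exact (fourier_ambiguityProduct (gaussian V) φ₁ f z' η).symm
  have hpars := integral_conj_mul_mul_conj_character (hint φ₁ f) (hint φ₂ g) hPc hFP ζ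
  have hleft : (c : ℂ) * stftFun (gaussian (WithLp 2 (V × V))) (fun w =>
      conj (stftDistWindow φ₁ f w.fst w.snd) * stftDistWindow φ₂ g w.fst w.snd) z ζ =
      ∫ y, conj (P y) * Q y * conj (character ζ y) := by
    rw [stftFun, ← integral_const_mul]
    refine integral_congr_ae (Eventually.of_forall fun y => ?_)
    have e1 := h (y.fst - z.fst) (y.snd - z.snd)
    have e2 : ‖y - z‖ ^ 2 = ‖y.fst - z.fst‖ ^ 2 + ‖y.snd - z.snd‖ ^ 2 :=
      WithLp.prod_norm_sq_eq_of_L2 (y - z)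
    -- The window splits as an ambiguity function times its conjugate; P and Q receive one factor
    -- each.
    have e3 : (c : ℂ) * gaussian (WithLp 2 (V × V)) (y - z) =
        stft (gaussian V) (gaussian V : 𝓢'(V, ℂ)) (y.fst - z.fst) (y.snd - z.snd) *
          conj (stft (gaussian V) (gaussian V : 𝓢'(V, ℂ)) (y.fst - z.fst) (y.snd - z.snd)) := by
      rw [Complex.mul_conj, Complex.normSq_eq_norm_sq, e1, gaussian_apply, e2]
      push_cast
      rfl
    have e4 : conj (gaussian (WithLp 2 (V × V)) (y - z)) = gaussian (WithLp 2 (V × V)) (y - z) := by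
      rw [gaussian_apply, Complex.conj_ofReal]
    simp only [hP, hQ, ambiguityProduct, phaseEquiv_apply, modulateS_apply, translateS_apply,
      map_mul, Complex.conj_conj, e4, hz']
    linear_combination (conj (stftDistWindow φ₁ f y.fst y.snd) * stftDistWindow φ₂ g y.fst y.snd *
      conj (character ζ y)) * e3
  rw [hleft, hpars]
  -- The change of variables v = (-η₂, η₁ + z₂) turns the arguments found for the Fourier transforms
  -- of P and Q into v and a translate of v.
  rw [← (measurePreserving_rotateShift z'.2).integral_comp',
    ← measurePreserving_phaseEquiv.integral_comp']
  refine integral_congr_ae (Eventually.of_forall fun η => ?_)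
  simp only [fourier_ambiguityProduct, map_mul, Complex.conj_conj]
  have e5 : rotateShift z'.2 (phaseEquiv V η) = (-η.snd, η.fst + z'.2) := rfl
  have e6 : (η + ζ).snd = η.snd + ζ.snd := rfl
  have e7 : (η + ζ).fst = η.fst + ζ.fst := rfl
  rw [e5, e6, e7]
  rw [show -(η.snd + ζ.snd) = -η.snd - ζ.snd by abel,
    show η.fst + ζ.fst + z'.2 = η.fst + z'.2 + ζ.fst by abel]

end MagicFormula

/-! ### Functionals as tempered distributions; modulation spaces as submodules. -/

section Distributions

open Filter Module

variable {V : Type*} [NormedAddCommGroup V] [InnerProductSpace ℝ V]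

theorem conjS_conjS (g : 𝓢(V, ℂ)) : conjS (conjS g) = g := by
  ext t
  simp [conjS_apply]

theorem bracket_injective {F G : 𝓢'(V, ℂ)} (h : ∀ g, bracket F g = bracket G g) : F = G := by
  refine DFunLike.ext _ _ fun g => ?_
  have := h (conjS g)
  rwa [bracket, bracket, conjS_conjS] at this

/-- A bounded conjugate-linear functional on Schwartz functions is a tempered distribution. -/
theorem exists_bracket_eq [FiniteDimensional ℝ V] [MeasurableSpace V] [BorelSpace V]
    {L : 𝓢(V, ℂ) → ℂ} (hadd : ∀ g g', L (g + g') = L g + L g')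
    (hsmul : ∀ (c : ℂ) g, L (c • g) = conj c * L g) {q : Seminorm ℂ 𝓢(V, ℂ)} (hq : Continuous q)
    {C : ℝ} (hL : ∀ g, ‖L g‖ ≤ C * q g) : ∃ F : 𝓢'(V, ℂ), ∀ g, bracket F g = L g := by
  let A : 𝓢(V, ℂ) →ₗ[ℂ] ℂ :=
    { toFun := fun h => L (conjS h)
      map_add' := fun h h' => by
        rw [← hadd]
        congr 1
        ext t
        simp [conjS_apply]
      map_smul' := fun c h => by
        have : conjS (c • h) = conj c • conjS h := by
          ext t
          simp [conjS_apply]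
        rw [this, hsmul, Complex.conj_conj]
        rfl }
  have hA : Continuous A := by
    refine continuous_of_continuousAt_zero A ?_
    rw [ContinuousAt, map_zero, tendsto_zero_iff_norm_tendsto_zero]
    have hlim : Tendsto (fun h : 𝓢(V, ℂ) => C * q (conjS h)) (nhds 0) (nhds 0) := by
      have hc : Continuous fun h : 𝓢(V, ℂ) => C * q (conjS h) :=
        continuous_const.mul (hq.comp continuous_conjS)
      have h0 : C * q (conjS (0 : 𝓢(V, ℂ))) = 0 := by
        have : conjS (0 : 𝓢(V, ℂ)) = 0 := by
          ext t
          simp [conjS_apply]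
        rw [this, map_zero, mul_zero]
      simpa [h0] using hc.tendsto 0
    exact squeeze_zero (fun h => norm_nonneg _) (fun h => hL (conjS h)) hlim
  refine ⟨ContinuousLinearMap.toPointwiseConvergenceCLM _ _ _ _ (⟨A, hA⟩ : 𝓢(V, ℂ) →L[ℂ] ℂ), fun g => ?_⟩
  change L (conjS (conjS g)) = L g
  rw [conjS_conjS]

theorem bracket_add_left (F G : 𝓢'(V, ℂ)) (g : 𝓢(V, ℂ)) :
    bracket (F + G) g = bracket F g + bracket G g := rfl

theorem bracket_smul_left (c : ℂ) (F : 𝓢'(V, ℂ)) (g : 𝓢(V, ℂ)) :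
    bracket (c • F) g = c * bracket F g := rfl

variable [FiniteDimensional ℝ V] [MeasurableSpace V] [BorelSpace V]

theorem stft_coe_add (γ g g' : 𝓢(V, ℂ)) (x ξ : V) :
    stft γ ((g + g' : 𝓢(V, ℂ)) : 𝓢'(V, ℂ)) x ξ =
      stft γ (g : 𝓢'(V, ℂ)) x ξ + stft γ (g' : 𝓢'(V, ℂ)) x ξ := by
  rw [map_add]
  rfl

theorem stft_coe_smul (c : ℂ) (γ g : 𝓢(V, ℂ)) (x ξ : V) :
    stft γ ((c • g : 𝓢(V, ℂ)) : 𝓢'(V, ℂ)) x ξ = c * stft γ (g : 𝓢'(V, ℂ)) x ξ := by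
  rw [map_smul]
  rfl

theorem modulationNorm_add_lt_top (g : 𝓢(V, ℂ)) {p q : ℝ≥0∞} (hp : 1 ≤ p) (hq : 1 ≤ q)
    {m : V → V → ℝ} (hm : IsModerate m) {F G : 𝓢'(V, ℂ)} (hF : modulationNorm g p q m F < ∞)
    (hG : modulationNorm g p q m G < ∞) : modulationNorm g p q m (F + G) < ∞ := by
  have hmeas : ∀ F : 𝓢'(V, ℂ), Measurable fun ξ =>
      eLpNorm (fun x => ENNReal.ofReal (m x ξ) * ‖stft g F x ξ‖ₑ) p volume := fun F =>
    measurable_lpNorm_left (measurable_weight_mul_stft g hm F) p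
  rw [modulationNorm_eq g p q hm] at hF hG ⊢
  refine lt_of_le_of_lt ?_ (ENNReal.add_lt_top.2 ⟨hF, hG⟩)
  refine le_trans (lpNorm_mono fun ξ => ?_)
    (eLpNorm_add_le (hmeas F).aestronglyMeasurable (hmeas G).aestronglyMeasurable hq)
  refine le_trans (lpNorm_mono fun x => ?_) (eLpNorm_add_le
    ((measurable_weight_mul_stft g hm F).comp measurable_prodMk_right).aestronglyMeasurable
    ((measurable_weight_mul_stft g hm G).comp measurable_prodMk_right).aestronglyMeasurable hp)
  simp only [Pi.add_apply]
  rw [← mul_add]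
  gcongr
  exact enorm_add_le _ _

theorem modulationNorm_smul_le (g : 𝓢(V, ℂ)) {p q : ℝ≥0∞}
    {m : V → V → ℝ} (hm : IsModerate m) (c : ℂ) (F : 𝓢'(V, ℂ)) :
    modulationNorm g p q m (c • F) ≤ ‖c‖ₑ * modulationNorm g p q m F := by
  rw [modulationNorm_eq g p q hm, modulationNorm_eq g p q hm]
  refine le_trans (mixedLpNorm_mono fun x ξ => le_of_eq ?_)
    (mixedLpNorm_const_mul (measurable_weight_mul_stft g hm F) _)
  have : stft g (c • F) x ξ = c * stft g F x ξ := rfl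
  rw [this, enorm_mul]
  ring

/-- The modulation space as a submodule of the tempered distributions. -/
def modulationSubmodule (g : 𝓢(V, ℂ)) {p q : ℝ≥0∞} (hp : 1 ≤ p) (hq : 1 ≤ q)
    {m : V → V → ℝ} (hm : IsModerate m) : Submodule ℂ 𝓢'(V, ℂ) where
  carrier := modulationSpace g p q m
  add_mem' := fun hF hG => modulationNorm_add_lt_top g hp hq hm hF hG
  zero_mem' := by
    have := modulationNorm_smul_le g (p := p) (q := q) hm (0 : ℂ) (0 : 𝓢'(V, ℂ))
    have e : (0 : ℂ) • (0 : 𝓢'(V, ℂ)) = 0 :=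
      bracket_injective fun g => by rw [bracket_smul_left, zero_mul]; rfl
    rw [e, enorm_zero, zero_mul] at this
    exact this.trans_lt ENNReal.zero_lt_top
  smul_mem' := fun c F hF =>
    (modulationNorm_smul_le g hm c F).trans_lt (ENNReal.mul_lt_top enorm_lt_top hF)

theorem coe_mem_modulationSpace (γ g : 𝓢(V, ℂ)) {p q : ℝ≥0∞} (hp : 1 ≤ p) (hq : 1 ≤ q)
    {m : V → V → ℝ} (hm : IsModerate m) : (g : 𝓢'(V, ℂ)) ∈ modulationSpace γ p q m := by
  obtain ⟨C, k, hC, hmod⟩ := hm.moderate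
  set N := finrank ℝ V + 1 with hN
  obtain ⟨Q, -, hQ⟩ := exists_norm_stft_coe_le_decay γ (k + N)
  have hpt : ∀ x ξ : V, ENNReal.ofReal (m x ξ) * ‖stft γ (g : 𝓢'(V, ℂ)) x ξ‖ₑ ≤
      ENNReal.ofReal (C * m 0 0 * Q g) * (decayE N x * decayE N ξ) := by
    intro x ξ
    have hd := decay_pos N x
    have hm0 := hm.pos 0 0
    rw [← ofReal_norm, ← ENNReal.ofReal_mul (hm.pos x ξ).le, decayE, decayE,
      ← ENNReal.ofReal_mul hd.le, ← ENNReal.ofReal_mul (by positivity)]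
    refine ENNReal.ofReal_le_ofReal ?_
    have h1 := hmod x ξ 0 0
    simp only [sub_zero] at h1
    have hmx := hm.pos x ξ
    calc m x ξ * ‖stft γ (g : 𝓢'(V, ℂ)) x ξ‖
        ≤ C * ((1 + ‖x‖) ^ k * (1 + ‖ξ‖) ^ k) * m 0 0 *
          (Q g * (decay (k + N) x * decay (k + N) ξ)) :=
        mul_le_mul h1 (hQ g x ξ) (norm_nonneg _) (by positivity)
      _ = C * m 0 0 * Q g * (decay N x * decay N ξ) := by
        rw [← one_add_norm_pow_mul_decay k N x, ← one_add_norm_pow_mul_decay k N ξ]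
        ring
  have hfin := lpNorm_decayE_lt_top (V := V) (Nat.lt_succ_self (finrank ℝ V)) hp
  have hfin' := lpNorm_decayE_lt_top (V := V) (Nat.lt_succ_self (finrank ℝ V)) hq
  rw [modulationSpace, Set.mem_ofPred_eq, modulationNorm_eq γ p q hm]
  have hmd : Measurable (Function.uncurry fun x ξ : V => decayE N x * decayE N ξ) :=
    ((measurable_decayE N).comp measurable_fst).mul ((measurable_decayE N).comp measurable_snd)
  refine (mixedLpNorm_mono hpt).trans_lt ((mixedLpNorm_const_mul hmd _).trans_lt
    (ENNReal.mul_lt_top ENNReal.ofReal_lt_top ?_))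
  refine lt_of_le_of_lt ?_ (ENNReal.mul_lt_top hfin hfin')
  refine le_trans (lpNorm_mono (g := fun ξ => eLpNorm (decayE N : V → ℝ≥0∞) p volume * decayE N ξ)
    fun ξ => ?_) (lpNorm_const_mul (measurable_decayE N) _)
  rw [mul_comm]
  simp only [mul_comm _ (decayE N ξ)]
  exact lpNorm_const_mul (measurable_decayE N) _

end Distributions

/-! ### Operators given by a bounded kernel on the time-frequency plane. -/

section KernelOperators

open Filter Module

variable {V : Type*} [NormedAddCommGroup V] [InnerProductSpace ℝ V] [FiniteDimensional ℝ V]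
  [MeasurableSpace V] [BorelSpace V]

/-- The image of a nonnegative function under a nonnegative integral kernel. -/
def kernelMajorant (K : V × V → V × V → ℝ≥0∞) (F : V → V → ℝ≥0∞) (x ξ : V) : ℝ≥0∞ :=
  ∫⁻ u : V × V, K u (x, ξ) * F u.1 u.2

/-- The nonnegative kernel `K` is bounded from `L^{a₁,a₂}_m` to `L^{b₁,b₂}_m`. -/
structure IsBoundedKernel (K : V × V → V × V → ℝ≥0∞) (m : V → V → ℝ) (a₁ a₂ b₁ b₂ C : ℝ≥0∞) :
    Prop where
  measurable : Measurable (Function.uncurry K)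
  ne_top : C ≠ ∞
  bound : ∀ F : V → V → ℝ≥0∞, Measurable (Function.uncurry F) →
    mixedLpNorm b₁ b₂ (fun x ξ => ENNReal.ofReal (m x ξ) * kernelMajorant K F x ξ) ≤
      C * mixedLpNorm a₁ a₂ (fun x ξ => ENNReal.ofReal (m x ξ) * F x ξ)

variable {k : V × V → V × V → ℂ} {K : V × V → V × V → ℝ≥0∞}

theorem measurable_kernelMajorant (hK : Measurable (Function.uncurry K)) {F : V → V → ℝ≥0∞}
    (hF : Measurable (Function.uncurry F)) : Measurable (Function.uncurry (kernelMajorant K F)) := by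
  have : Measurable fun t : (V × V) × (V × V) => K t.2 t.1 * F t.2.1 t.2.2 :=
    (hK.comp measurable_swap).mul (hF.comp measurable_snd)
  exact this.lintegral_prod_right'

/-- The transform of the shifted test function decays away from x, so integrating the kernel first
gives a smearing at x. At x = 0 the estimate yields temperedness of the form; for general x it
bounds the short-time Fourier transform of the image. -/
theorem exists_lintegral_kernel_le (γ : 𝓢(V, ℂ)) (N : ℕ) : ∃ q : Seminorm ℂ 𝓢(V, ℂ),
    Continuous q ∧ ∀ (K : V × V → V × V → ℝ≥0∞), Measurable (Function.uncurry K) →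
      ∀ F : V → V → ℝ≥0∞, Measurable (Function.uncurry F) → ∀ (g : 𝓢(V, ℂ)) (x : V × V),
      ∫⁻ t : (V × V) × (V × V), K t.1 t.2 * F t.1.1 t.1.2 *
        ‖stft γ ((shiftS x g : 𝓢(V, ℂ)) : 𝓢'(V, ℂ)) t.2.1 t.2.2‖ₑ ≤
      ENNReal.ofReal (q g) * smear N (kernelMajorant K F) x.1 x.2 := by
  obtain ⟨q, hq, h⟩ := exists_norm_stft_coe_le_decay γ N
  refine ⟨q, hq, fun K hK F hF g x => ?_⟩
  have hm : Measurable fun t : (V × V) × (V × V) => K t.1 t.2 * F t.1.1 t.1.2 *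
        ‖stft γ ((shiftS x g : 𝓢(V, ℂ)) : 𝓢'(V, ℂ)) t.2.1 t.2.2‖ₑ :=
    (hK.mul (hF.comp measurable_fst)).mul
      ((continuous_stft γ _).enorm.measurable.comp measurable_snd)
  have e : (volume : Measure ((V × V) × (V × V))) =
      (volume : Measure (V × V)).prod (volume : Measure (V × V)) := rfl
  rw [e, lintegral_prod_symm _ hm.aemeasurable, smear_eq (measurable_kernelMajorant hK hF),
    ← lintegral_const_mul' _ _ ENNReal.ofReal_ne_top]
  refine lintegral_mono fun w => ?_
  have hm1 : Measurable fun u : V × V => K u w * F u.1 u.2 :=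
    (hK.comp measurable_prodMk_right).mul hF
  have h1 : ‖stft γ ((shiftS x g : 𝓢(V, ℂ)) : 𝓢'(V, ℂ)) w.1 w.2‖ₑ ≤
      ENNReal.ofReal (q g) * (decayE N (x.1 - w.1) * decayE N (x.2 - w.2)) := by
    rw [← ofReal_norm, norm_stft_shiftS, decayE_sub_comm, decayE_sub_comm N x.2, decayE, decayE,
      ← ENNReal.ofReal_mul (decay_pos _ _).le, ← ENNReal.ofReal_mul (apply_nonneg _ _)]
    exact ENNReal.ofReal_le_ofReal (h g _ _)
  simp only
  rw [lintegral_mul_const _ hm1]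
  refine (mul_le_mul_right h1 _).trans_eq ?_
  rw [show (∫⁻ u : V × V, K u w * F u.1 u.2) = kernelMajorant K F w.1 w.2 from rfl]
  ring

variable {m : V → V → ℝ} {a₁ a₂ b₁ b₂ C : ℝ≥0∞}

theorem IsBoundedKernel.exists_smear_lt_top (hK : IsBoundedKernel K m a₁ a₂ b₁ b₂ C)
    (hm : IsModerate m) (hb₁ : 1 ≤ b₁) (hb₂ : 1 ≤ b₂) :
    ∃ n : ℕ, ∀ F : V → V → ℝ≥0∞, Measurable (Function.uncurry F) →
      mixedLpNorm a₁ a₂ (fun x ξ => ENNReal.ofReal (m x ξ) * F x ξ) < ∞ →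
      ∀ x ξ, smear n (kernelMajorant K F) x ξ < ∞ := by
  obtain ⟨C₁, n, h₁⟩ := hm.exists_mul_smear_le (finrank ℝ V + 1)
  obtain ⟨C₂, h₂⟩ := exists_smear_le (V := V) (Nat.lt_succ_self _) hb₁ hb₂
  refine ⟨n, fun F hF hfin x ξ => ?_⟩
  have hKF := measurable_kernelMajorant hK.measurable hF
  have hmK : Measurable (Function.uncurry fun x ξ =>
      ENNReal.ofReal (m x ξ) * kernelMajorant K F x ξ) := hm.measurable.mul hKF
  have h3 := (h₁ _ hKF x ξ).trans (mul_le_mul_right ((h₂ _ hmK x ξ).trans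
    (mul_le_mul_right (hK.bound F hF) _)) _)
  have h4 : ENNReal.ofReal (m x ξ) * smear n (kernelMajorant K F) x ξ < ∞ :=
    h3.trans_lt (ENNReal.mul_lt_top ENNReal.coe_lt_top (ENNReal.mul_lt_top ENNReal.coe_lt_top
      (ENNReal.mul_lt_top hK.ne_top.lt_top hfin)))
  by_contra h
  rw [not_lt, top_le_iff] at h
  rw [h, ENNReal.mul_top (ENNReal.ofReal_pos.2 (hm.pos x ξ)).ne'] at h4
  exact lt_irrefl _ h4

theorem IsBoundedKernel.lintegral_lt_top (hK : IsBoundedKernel K m a₁ a₂ b₁ b₂ C)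
    (hm : IsModerate m) (hb₁ : 1 ≤ b₁) (hb₂ : 1 ≤ b₂) (γ g : 𝓢(V, ℂ)) {F : V → V → ℝ≥0∞}
    (hF : Measurable (Function.uncurry F))
    (hfin : mixedLpNorm a₁ a₂ (fun x ξ => ENNReal.ofReal (m x ξ) * F x ξ) < ∞) :
    ∫⁻ t : (V × V) × (V × V), K t.1 t.2 * F t.1.1 t.1.2 *
        ‖stft γ (g : 𝓢'(V, ℂ)) t.2.1 t.2.2‖ₑ < ∞ := by
  obtain ⟨n, hn⟩ := hK.exists_smear_lt_top hm hb₁ hb₂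
  obtain ⟨q, -, hq⟩ := exists_lintegral_kernel_le γ n
  have := hq K hK.measurable F hF g 0
  rw [shiftS_zero] at this
  exact this.trans_lt (ENNReal.mul_lt_top ENNReal.ofReal_lt_top (hn F hF hfin _ _))

/-- The sesquilinear form defined by an integral kernel acting on short-time Fourier transforms. -/
def kernelForm (k : V × V → V × V → ℂ) (γ : 𝓢(V, ℂ)) (f : 𝓢'(V, ℂ)) (g : 𝓢(V, ℂ)) : ℂ :=
  ∫ t : (V × V) × (V × V), k t.1 t.2 * stft γ f t.1.1 t.1.2 *
    conj (stft γ (g : 𝓢'(V, ℂ)) t.2.1 t.2.2)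

theorem aestronglyMeasurable_kernelForm (hk : Measurable (Function.uncurry k)) (γ : 𝓢(V, ℂ))
    (f : 𝓢'(V, ℂ)) (g : 𝓢(V, ℂ)) :
    AEStronglyMeasurable (fun t : (V × V) × (V × V) => k t.1 t.2 * stft γ f t.1.1 t.1.2 *
    conj (stft γ (g : 𝓢'(V, ℂ)) t.2.1 t.2.2)) volume := by
  have h1 : Measurable fun t : (V × V) × (V × V) => stft γ f t.1.1 t.1.2 :=
    (continuous_stft γ f).measurable.comp measurable_fst
  have h2 : Measurable fun t : (V × V) × (V × V) => conj (stft γ (g : 𝓢'(V, ℂ)) t.2.1 t.2.2) :=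
    (Complex.continuous_conj.comp (continuous_stft γ _)).measurable.comp measurable_snd
  exact ((hk.mul h1).mul h2).aestronglyMeasurable

theorem IsBoundedKernel.integrable (hK : IsBoundedKernel K m a₁ a₂ b₁ b₂ C)
    (hk : Measurable (Function.uncurry k))
    (hkK : ∀ u w, ‖k u w‖ₑ ≤ K u w) (hm : IsModerate m) (hb₁ : 1 ≤ b₁) (hb₂ : 1 ≤ b₂)
    (γ g : 𝓢(V, ℂ)) {f : 𝓢'(V, ℂ)}
    (hfin : modulationNorm γ a₁ a₂ m f < ∞) :
    Integrable (fun t : (V × V) × (V × V) => k t.1 t.2 * stft γ f t.1.1 t.1.2 *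
      conj (stft γ (g : 𝓢'(V, ℂ)) t.2.1 t.2.2)) := by
  rw [modulationNorm_eq γ a₁ a₂ hm] at hfin
  refine ⟨aestronglyMeasurable_kernelForm hk γ f g, ?_⟩
  have hF : Measurable (Function.uncurry fun x ξ => ‖stft γ f x ξ‖ₑ) :=
    (continuous_stft γ f).enorm.measurable
  have := hK.lintegral_lt_top hm hb₁ hb₂ γ g hF hfin
  rw [hasFiniteIntegral_iff_enorm]
  refine lt_of_le_of_lt (lintegral_mono fun t => ?_) this
  rw [enorm_mul, enorm_mul, RCLike.enorm_conj]
  gcongr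
  exact hkK _ _

theorem enorm_kernelForm_le (hkK : ∀ u w, ‖k u w‖ₑ ≤ K u w) (γ g : 𝓢(V, ℂ)) (f : 𝓢'(V, ℂ)) :
    ‖kernelForm k γ f g‖ₑ ≤ ∫⁻ t : (V × V) × (V × V), K t.1 t.2 * ‖stft γ f t.1.1 t.1.2‖ₑ *
        ‖stft γ (g : 𝓢'(V, ℂ)) t.2.1 t.2.2‖ₑ := by
  refine (enorm_integral_le_lintegral_enorm _).trans (lintegral_mono fun t => ?_)
  rw [enorm_mul, enorm_mul, RCLike.enorm_conj]
  gcongr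
  exact hkK _ _

theorem IsBoundedKernel.exists_distribution (hK : IsBoundedKernel K m a₁ a₂ b₁ b₂ C)
    (hk : Measurable (Function.uncurry k))
    (hkK : ∀ u w, ‖k u w‖ₑ ≤ K u w) (hm : IsModerate m) (hb₁ : 1 ≤ b₁) (hb₂ : 1 ≤ b₂)
    (γ : 𝓢(V, ℂ)) {f : 𝓢'(V, ℂ)}
    (hfin : modulationNorm γ a₁ a₂ m f < ∞) :
    ∃ F : 𝓢'(V, ℂ), ∀ g, bracket F g = kernelForm k γ f g := by
  obtain ⟨n, hn⟩ := hK.exists_smear_lt_top hm hb₁ hb₂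
  obtain ⟨q, hqc, hq⟩ := exists_lintegral_kernel_le γ n
  have hF : Measurable (Function.uncurry fun x ξ => ‖stft γ f x ξ‖ₑ) :=
    (continuous_stft γ f).enorm.measurable
  have hS := hn _ hF (by rwa [← modulationNorm_eq γ a₁ a₂ hm]) 0 0
  set S := smear n (kernelMajorant K fun x ξ => ‖stft γ f x ξ‖ₑ) 0 0 with hSdef
  refine exists_bracket_eq (L := kernelForm k γ f) (C := S.toReal) (fun g g' => ?_)
    (fun c g => ?_) hqc (fun g => ?_)
  · rw [kernelForm, kernelForm, kernelForm, ← integral_add (hK.integrable hk hkK hm hb₁ hb₂ γ g hfin)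
      (hK.integrable hk hkK hm hb₁ hb₂ γ g' hfin)]
    refine integral_congr_ae (Eventually.of_forall fun t => ?_)
    simp only [stft_coe_add]
    rw [map_add]
    ring
  · rw [kernelForm, kernelForm, ← integral_const_mul]
    refine integral_congr_ae (Eventually.of_forall fun t => ?_)
    simp only [stft_coe_smul]
    rw [map_mul]
    ring
  · have h1 := hq K hK.measurable _ hF g 0
    rw [shiftS_zero] at h1
    have h2 := (enorm_kernelForm_le hkK γ g f).trans h1
    have h3 := ENNReal.toReal_mono (ENNReal.mul_ne_top ENNReal.ofReal_ne_top hS.ne) h2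
    rw [toReal_enorm, ENNReal.toReal_mul, ENNReal.toReal_ofReal (apply_nonneg _ _)] at h3
    rw [mul_comm]
    exact h3

theorem IsBoundedKernel.kernelForm_add (hK : IsBoundedKernel K m a₁ a₂ b₁ b₂ C)
    (hk : Measurable (Function.uncurry k))
    (hkK : ∀ u w, ‖k u w‖ₑ ≤ K u w) (hm : IsModerate m) (hb₁ : 1 ≤ b₁) (hb₂ : 1 ≤ b₂)
    (γ g : 𝓢(V, ℂ)) {f f' : 𝓢'(V, ℂ)}
    (hfin : modulationNorm γ a₁ a₂ m f < ∞) (hfin' : modulationNorm γ a₁ a₂ m f' < ∞) :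
    kernelForm k γ (f + f') g = kernelForm k γ f g + kernelForm k γ f' g := by
  rw [kernelForm, kernelForm, kernelForm, ← integral_add (hK.integrable hk hkK hm hb₁ hb₂ γ g hfin)
      (hK.integrable hk hkK hm hb₁ hb₂ γ g hfin')]
  refine integral_congr_ae (Eventually.of_forall fun t => ?_)
  have : stft γ (f + f') t.1.1 t.1.2 = stft γ f t.1.1 t.1.2 + stft γ f' t.1.1 t.1.2 := rfl
  simp only [this]
  ring

theorem kernelForm_smul (c : ℂ) (γ g : 𝓢(V, ℂ)) (f : 𝓢'(V, ℂ)) :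
    kernelForm k γ (c • f) g = c * kernelForm k γ f g := by
  rw [kernelForm, kernelForm, ← integral_const_mul]
  refine integral_congr_ae (Eventually.of_forall fun t => ?_)
  have : stft γ (c • f) t.1.1 t.1.2 = c * stft γ f t.1.1 t.1.2 := rfl
  simp only [this]
  ring

/-- Fubini when S reproduces U from φ; D dominates the absolute integral over the first variable. It
serves both the expansion into shifts and the change of window in the extended pairing. -/
theorem integral_mul_integral_eq {α β : Type*} [MeasurableSpace α] [MeasurableSpace β]
    {μ : Measure α} {ν : Measure β} [SFinite μ] [SFinite ν] {φ : α → ℂ} {S : α → β → ℂ}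
    {ψ U : β → ℂ} {c : ℂ} {D : β → ℝ≥0∞} (hφ : Measurable φ) (hS : Measurable (Function.uncurry S))
    (hψ : Measurable ψ) (hD : ∀ b, ∫⁻ a, ‖φ a‖ₑ * ‖S a b‖ₑ ∂μ ≤ D b)
    (hfin : ∫⁻ b, D b * ‖ψ b‖ₑ ∂ν < ∞) (hc : ∀ b, ∫ a, φ a * S a b ∂μ = c * U b) :
    Integrable (fun a => φ a * ∫ b, S a b * ψ b ∂ν) μ ∧
      ∫ a, φ a * ∫ b, S a b * ψ b ∂ν ∂μ = c * ∫ b, U b * ψ b ∂ν := by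
  have hm : Measurable fun t : α × β => φ t.1 * (S t.1 t.2 * ψ t.2) :=
    (hφ.comp measurable_fst).mul (hS.mul (hψ.comp measurable_snd))
  have hi : Integrable (fun t : α × β => φ t.1 * (S t.1 t.2 * ψ t.2)) (μ.prod ν) := by
    refine ⟨hm.aestronglyMeasurable, ?_⟩
    rw [hasFiniteIntegral_iff_enorm, lintegral_prod_symm _ hm.enorm.aemeasurable]
    refine lt_of_le_of_lt (lintegral_mono fun b => ?_) hfin
    have h1 : Measurable fun a => ‖φ a‖ₑ * ‖S a b‖ₑ :=
      hφ.enorm.mul (hS.comp measurable_prodMk_right).enorm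
    calc ∫⁻ a, ‖φ a * (S a b * ψ b)‖ₑ ∂μ = ∫⁻ a, ‖φ a‖ₑ * ‖S a b‖ₑ * ‖ψ b‖ₑ ∂μ := by
          simp only [enorm_mul, mul_assoc]
      _ = (∫⁻ a, ‖φ a‖ₑ * ‖S a b‖ₑ ∂μ) * ‖ψ b‖ₑ := lintegral_mul_const _ h1
      _ ≤ D b * ‖ψ b‖ₑ := by gcongr; exact hD b
  have e : ∀ a, φ a * ∫ b, S a b * ψ b ∂ν = ∫ b, φ a * (S a b * ψ b) ∂ν := fun a =>
    (integral_const_mul _ _).symm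
  simp only [e]
  refine ⟨hi.integral_prod_left, ?_⟩
  rw [integral_integral_swap hi, ← integral_const_mul]
  refine integral_congr_ae (Eventually.of_forall fun b => ?_)
  have h2 : ∀ a, φ a * (S a b * ψ b) = φ a * S a b * ψ b := fun a => (mul_assoc _ _ _).symm
  simp only [h2]
  rw [integral_mul_const, hc, mul_assoc]

theorem continuous_stft_shiftS (γ γ' : 𝓢(V, ℂ)) : Continuous fun t : (V × V) × (V × V) =>
    stft γ ((shiftS t.1 γ' : 𝓢(V, ℂ)) : 𝓢'(V, ℂ)) t.2.1 t.2.2 := by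
  have e : (fun t : (V × V) × (V × V) =>
      stft γ ((shiftS t.1 γ' : 𝓢(V, ℂ)) : 𝓢'(V, ℂ)) t.2.1 t.2.2) = fun t =>
      character (t.1.2 - t.2.2) t.1.1 *
        stft γ (γ' : 𝓢'(V, ℂ)) (t.2.1 - t.1.1) (t.2.2 - t.1.2) := by
    funext t
    exact bracket_shiftS_shiftS t.1 t.2 γ γ'
  rw [e]
  have h1 : Continuous fun t : (V × V) × (V × V) => (t.1.2 - t.2.2, t.1.1) := by fun_prop
  have h2 : Continuous fun t : (V × V) × (V × V) => (t.2.1 - t.1.1, t.2.2 - t.1.2) := by fun_prop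
  have h3 : Continuous fun t : (V × V) × (V × V) => character (t.1.2 - t.2.2) t.1.1 :=
    continuous_character.comp h1
  have h4 : Continuous fun t : (V × V) × (V × V) =>
      stft γ (γ' : 𝓢'(V, ℂ)) (t.2.1 - t.1.1) (t.2.2 - t.1.2) := by
    have h := (continuous_stft γ (γ' : 𝓢'(V, ℂ))).comp h2
    simp only [Function.comp_def] at h
    exact h
  exact h3.mul h4

theorem exists_lintegral_stft_mul_shiftS_le (γ γ' : 𝓢(V, ℂ)) (n : ℕ) : ∃ C : ℝ≥0,
    ∀ (f : 𝓢'(V, ℂ)) (u : V × V), ∫⁻ y : V × V, ‖stft γ' f y.1 y.2‖ₑ *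
      ‖stft γ ((shiftS y γ' : 𝓢(V, ℂ)) : 𝓢'(V, ℂ)) u.1 u.2‖ₑ ≤
      C * smear n (fun x ξ => ‖stft γ' f x ξ‖ₑ) u.1 u.2 := by
  obtain ⟨Q, -, hQ⟩ := exists_norm_stft_coe_le_decay γ n
  refine ⟨(Q γ').toNNReal, fun f u => ?_⟩
  have hGm : Measurable (Function.uncurry fun x ξ => ‖stft γ' f x ξ‖ₑ) :=
    (continuous_stft γ' f).enorm.measurable
  rw [smear_eq hGm, ← lintegral_const_mul' _ _ ENNReal.coe_ne_top]
  refine lintegral_mono fun y => ?_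
  have h3 : ‖stft γ ((shiftS y γ' : 𝓢(V, ℂ)) : 𝓢'(V, ℂ)) u.1 u.2‖ₑ ≤
      ENNReal.ofReal (Q γ') * (decayE n (u.1 - y.1) * decayE n (u.2 - y.2)) := by
    rw [← ofReal_norm, norm_stft_shiftS, decayE, decayE,
      ← ENNReal.ofReal_mul (decay_pos _ _).le, ← ENNReal.ofReal_mul (apply_nonneg _ _)]
    exact ENNReal.ofReal_le_ofReal (hQ γ' _ _)
  refine (mul_le_mul_right h3 _).trans_eq ?_
  change _ = ENNReal.ofReal (Q γ') * _
  ring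

theorem integral_stft_mul_stft_shiftS (f : 𝓢'(V, ℂ)) (γ γ' : 𝓢(V, ℂ)) (u : V × V) :
    ∫ y : V × V, stft γ' f y.1 y.2 *
      stft γ ((shiftS y γ' : 𝓢(V, ℂ)) : 𝓢'(V, ℂ)) u.1 u.2 =
      (∫ t, ‖γ' t‖ ^ 2 : ℝ) * stft γ f u.1 u.2 := by
  have h := (integral_stft_mul_conj_stft f γ' γ' (shiftS u γ)).2
  rw [bracket_coe_self, ← stft_eq] at h
  rw [← h]
  refine integral_congr_ae (Eventually.of_forall fun y => ?_)
  simp only [stft_eq]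
  rw [bracket_coe_conj]

theorem measurable_kernel_mul_conj_stft (hk : Measurable (Function.uncurry k)) (γ g : 𝓢(V, ℂ)) :
    Measurable fun t : (V × V) × (V × V) =>
      k t.1 t.2 * conj (stft γ (g : 𝓢'(V, ℂ)) t.2.1 t.2.2) := by
  have h1 : Continuous fun w : V × V => conj (stft γ (g : 𝓢'(V, ℂ)) w.1 w.2) :=
    Complex.continuous_conj.comp (continuous_stft γ _)
  exact hk.mul (h1.measurable.comp measurable_snd)

theorem measurable_stft_shiftS_fst (γ γ' : 𝓢(V, ℂ)) :
    Measurable (Function.uncurry fun (y : V × V) (t : (V × V) × (V × V)) =>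
      stft γ ((shiftS y γ' : 𝓢(V, ℂ)) : 𝓢'(V, ℂ)) t.1.1 t.1.2) := by
  have h1 : Measurable fun t : (V × V) × ((V × V) × (V × V)) => (t.1, t.2.1) := by fun_prop
  have h := (continuous_stft_shiftS γ γ').measurable.comp h1
  simp only [Function.comp_def] at h
  exact h

/-- Expansion of the form defined by a kernel into time-frequency shifts. -/
theorem IsBoundedKernel.kernelForm_expansion (hK : IsBoundedKernel K m a₁ a₂ b₁ b₂ C)
    (hk : Measurable (Function.uncurry k))
    (hkK : ∀ u w, ‖k u w‖ₑ ≤ K u w) (hm : IsModerate m) (ha₁ : 1 ≤ a₁) (ha₂ : 1 ≤ a₂)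
    (hb₁ : 1 ≤ b₁) (hb₂ : 1 ≤ b₂) {γ : 𝓢(V, ℂ)} (hγ : γ ≠ 0) (γ' g : 𝓢(V, ℂ)) {f : 𝓢'(V, ℂ)}
    (hfin : modulationNorm γ a₁ a₂ m f < ∞) :
    Integrable (fun y : V × V => stft γ' f y.1 y.2 *
      kernelForm k γ ((shiftS y γ' : 𝓢(V, ℂ)) : 𝓢'(V, ℂ)) g) ∧
    ∫ y : V × V, stft γ' f y.1 y.2 * kernelForm k γ ((shiftS y γ' : 𝓢(V, ℂ)) : 𝓢'(V, ℂ)) g =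
      (∫ t, ‖γ' t‖ ^ 2 : ℝ) * kernelForm k γ f g := by
  obtain ⟨C₁, n, h₁⟩ := hm.exists_mixedLpNorm_le (p := a₁) (q := a₂) ha₁ le_rfl ha₂ le_rfl
  obtain ⟨C₂, h₂⟩ := exists_mixedLpNorm_stft_le hγ γ' hm (p := a₁) (q := a₂) ha₁ le_rfl ha₂ le_rfl
  obtain ⟨C₃, h₃⟩ := exists_lintegral_stft_mul_shiftS_le γ γ' n
  have hGm : Measurable (Function.uncurry fun x ξ => ‖stft γ' f x ξ‖ₑ) :=
    (continuous_stft γ' f).enorm.measurable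
  have hsm := measurable_smear n hGm
  have hfin' : mixedLpNorm a₁ a₂ (fun x ξ => ENNReal.ofReal (m x ξ) *
      smear n (fun x ξ => ‖stft γ' f x ξ‖ₑ) x ξ) < ∞ :=
    (h₁ _ hGm).trans_lt (ENNReal.mul_lt_top ENNReal.coe_lt_top ((h₂ f).trans_lt
      (ENNReal.mul_lt_top ENNReal.coe_lt_top hfin)))
  have hlint := hK.lintegral_lt_top hm hb₁ hb₂ γ g hsm hfin'
  have hψ := measurable_kernel_mul_conj_stft hk γ g
  have hS := measurable_stft_shiftS_fst γ γ'
  -- Averaging the transforms of the shifts of γ' against V_{γ'} f reproduces V_γ f. The absolute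
  -- version is a smearing of |V_{γ'} f|, which has finite weighted norm and is therefore admissible
  -- for the kernel.
  have key := integral_mul_integral_eq (μ := (volume : Measure (V × V)))
    (ν := (volume : Measure ((V × V) × (V × V))))
    (φ := fun y => stft γ' f y.1 y.2)
    (S := fun y t => stft γ ((shiftS y γ' : 𝓢(V, ℂ)) : 𝓢'(V, ℂ)) t.1.1 t.1.2)
    (ψ := fun t => k t.1 t.2 * conj (stft γ (g : 𝓢'(V, ℂ)) t.2.1 t.2.2))
    (U := fun t => stft γ f t.1.1 t.1.2) (c := (∫ t, ‖γ' t‖ ^ 2 : ℝ))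
    (D := fun t => C₃ * smear n (fun x ξ => ‖stft γ' f x ξ‖ₑ) t.1.1 t.1.2)
    (continuous_stft γ' f).measurable hS hψ (fun t => h₃ f t.1) ?_
    (fun t => integral_stft_mul_stft_shiftS f γ γ' t.1)
  · have e1 : ∀ f' : 𝓢'(V, ℂ), kernelForm k γ f' g = ∫ t : (V × V) × (V × V),
        stft γ f' t.1.1 t.1.2 * (k t.1 t.2 * conj (stft γ (g : 𝓢'(V, ℂ)) t.2.1 t.2.2)) := by
      intro f'
      refine integral_congr_ae (Eventually.of_forall fun t => ?_)
      ring
    simp only [e1]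
    exact key
  · have e : ∀ t : (V × V) × (V × V), C₃ * smear n (fun x ξ => ‖stft γ' f x ξ‖ₑ) t.1.1 t.1.2 *
        ‖k t.1 t.2 * conj (stft γ (g : 𝓢'(V, ℂ)) t.2.1 t.2.2)‖ₑ ≤
        C₃ * (K t.1 t.2 * smear n (fun x ξ => ‖stft γ' f x ξ‖ₑ) t.1.1 t.1.2 *
          ‖stft γ (g : 𝓢'(V, ℂ)) t.2.1 t.2.2‖ₑ) := by
      intro t
      rw [enorm_mul, RCLike.enorm_conj, mul_assoc, mul_comm (K t.1 t.2), mul_assoc]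
      gcongr
      exact hkK _ _
    refine (lintegral_mono e).trans_lt ?_
    rw [lintegral_const_mul' _ _ ENNReal.coe_ne_top]
    exact ENNReal.mul_lt_top ENNReal.coe_lt_top hlint

/-- V_g F at a point is the form tested on a shift of g, hence dominated by a smearing of the
kernel's majorant; smearing also raises the exponents from b₁, b₂ to p, q. The constant is chosen
before the kernel, which keeps the final bound uniform in symbol and windows. -/
theorem exists_modulationNorm_kernelForm_le (g : 𝓢(V, ℂ)) (γ : 𝓢(V, ℂ)) (hm : IsModerate m)
    {p q : ℝ≥0∞} (hb₁ : 1 ≤ b₁) (hb₂ : 1 ≤ b₂) (hbp : b₁ ≤ p) (hbq : b₂ ≤ q) :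
    ∃ C' : ℝ≥0, ∀ (k : V × V → V × V → ℂ) (K : V × V → V × V → ℝ≥0∞) (C : ℝ≥0∞),
      IsBoundedKernel K m a₁ a₂ b₁ b₂ C → (∀ u w, ‖k u w‖ₑ ≤ K u w) → ∀ f F : 𝓢'(V, ℂ),
      (∀ h, bracket F h = kernelForm k γ f h) →
        modulationNorm g p q m F ≤ C' * (C * modulationNorm γ a₁ a₂ m f) := by
  obtain ⟨C₁, n, h₁⟩ := hm.exists_mixedLpNorm_le hb₁ hbp hb₂ hbq
  obtain ⟨Q, -, hQ⟩ := exists_lintegral_kernel_le γ n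
  refine ⟨(Q g).toNNReal * C₁, fun k K C hK hkK f F hF => ?_⟩
  have hG : Measurable (Function.uncurry fun x ξ => ‖stft γ f x ξ‖ₑ) :=
    (continuous_stft γ f).enorm.measurable
  have hKG := measurable_kernelMajorant hK.measurable hG
  have hpt : ∀ x ξ, ‖stft g F x ξ‖ₑ ≤ ENNReal.ofReal (Q g) *
      smear n (kernelMajorant K fun x ξ => ‖stft γ f x ξ‖ₑ) x ξ := by
    intro x ξ
    rw [stft_eq, hF]
    exact (enorm_kernelForm_le hkK γ _ f).trans (hQ K hK.measurable _ hG g (x, ξ))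
  rw [modulationNorm_eq g p q hm, modulationNorm_eq γ a₁ a₂ hm]
  refine (mixedLpNorm_mono fun x ξ => mul_le_mul_right (hpt x ξ) _).trans ?_
  simp only [mul_left_comm _ (ENNReal.ofReal (Q g))]
  refine (mixedLpNorm_const_mul (hm.measurable.mul (measurable_smear n hKG)) _).trans ?_
  rw [ENNReal.coe_mul, mul_assoc]
  exact mul_le_mul_right ((h₁ _ hKG).trans (mul_le_mul_right (hK.bound _ hG) _)) _

end KernelOperators

/-! ### The kernel of a localization operator and its weighted bounds. -/

section SymbolKernel

open Filter Module

variable {V : Type*} [NormedAddCommGroup V] [InnerProductSpace ℝ V]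

theorem vWeight_add_le {s : ℝ} (hs : 0 ≤ s) (x ξ y η : V) :
    vWeight s (x + y) (ξ + η) ≤ 2 ^ (s / 2) * (vWeight s x ξ * vWeight s y η) := by
  have h1 := sq_add_sq_le_of_le (norm_nonneg (x + y)) (norm_add_le x y)
  have h2 := sq_add_sq_le_of_le (norm_nonneg (ξ + η)) (norm_add_le ξ η)
  rw [vWeight, vWeight, vWeight, ← Real.mul_rpow (by positivity) (by positivity),
    ← Real.mul_rpow (by positivity) (by positivity)]
  refine Real.rpow_le_rpow (by positivity) ?_ (by linarith)
  have : 0 ≤ (‖x‖ ^ 2 + ‖ξ‖ ^ 2) * (‖y‖ ^ 2 + ‖η‖ ^ 2) := by positivity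
  nlinarith

theorem vWeight_mul_vWeight (s t : ℝ) (x ξ : V) :
    vWeight s x ξ * vWeight t x ξ = vWeight (s + t) x ξ := by
  rw [vWeight, vWeight, vWeight, ← Real.rpow_add (by positivity)]
  congr 1
  ring

theorem vWeight_neg (s : ℝ) (x ξ : V) : vWeight s (-x) (-ξ) = vWeight s x ξ := by
  simp [vWeight]

theorem vWeight_nonneg (s : ℝ) (x ξ : V) : 0 ≤ vWeight s x ξ := by
  unfold vWeight
  positivity

/-- The weight `v_s` as a function on the product with values in `ℝ≥0∞`. -/
def phaseWeight (s : ℝ) (w : V × V) : ℝ≥0∞ := ENNReal.ofReal (vWeight s w.1 w.2)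

theorem phaseWeight_add_le {s : ℝ} (hs : 0 ≤ s) (w u : V × V) :
    phaseWeight s (w + u) ≤ ENNReal.ofReal (2 ^ (s / 2)) * (phaseWeight s w * phaseWeight s u) := by
  rw [phaseWeight, phaseWeight, phaseWeight, ← ENNReal.ofReal_mul (vWeight_nonneg _ _ _),
    ← ENNReal.ofReal_mul (by positivity)]
  exact ENNReal.ofReal_le_ofReal (vWeight_add_le hs _ _ _ _)

theorem phaseWeight_neg (s : ℝ) (w : V × V) : phaseWeight s (-w) = phaseWeight s w := by
  rw [phaseWeight, phaseWeight, Prod.fst_neg, Prod.snd_neg, vWeight_neg]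

theorem phaseWeight_mul (s t : ℝ) (w : V × V) :
    phaseWeight s w * phaseWeight t w = phaseWeight (s + t) w := by
  rw [phaseWeight, phaseWeight, phaseWeight, ← ENNReal.ofReal_mul (vWeight_nonneg _ _ _),
    vWeight_mul_vWeight]

variable [FiniteDimensional ℝ V] [MeasurableSpace V] [BorelSpace V]

instance isAddLeftInvariant_volume_prod : (volume : Measure (V × V)).IsAddLeftInvariant :=
  inferInstanceAs ((volume : Measure V).prod (volume : Measure V)).IsAddLeftInvariant

instance isAddRightInvariant_volume_prod : (volume : Measure (V × V)).IsAddRightInvariant :=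
  inferInstanceAs ((volume : Measure V).prod (volume : Measure V)).IsAddRightInvariant

theorem measurable_phaseWeight (s : ℝ) : Measurable (phaseWeight s : V × V → ℝ≥0∞) :=
  (isModerate_vWeight s).measurable

/-- The function `z ↦ ‖V a(z, ζ)‖` in product coordinates, with the frequency variable rotated. -/
def rotatedSTFT (a : 𝓢'(WithLp 2 (V × V), ℂ)) (z ζ : V × V) : ℂ :=
  stft (gaussian (WithLp 2 (V × V))) a (WithLp.toLp 2 z) (WithLp.toLp 2 (ζ.2, -ζ.1))

theorem continuous_rotatedSTFT (a : 𝓢'(WithLp 2 (V × V), ℂ)) :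
    Continuous (Function.uncurry (rotatedSTFT a)) := by
  have h1 : Continuous fun t : (V × V) × (V × V) =>
      ((WithLp.toLp 2 t.1 : WithLp 2 (V × V)), (WithLp.toLp 2 (t.2.2, -t.2.1) : WithLp 2 (V × V))) :=
    ((WithLp.prod_continuous_toLp 2 V V).comp continuous_fst).prodMk
      ((WithLp.prod_continuous_toLp 2 V V).comp (by fun_prop))
  have h := (continuous_stft (gaussian (WithLp 2 (V × V))) a).comp h1
  simp only [Function.comp_def] at h
  exact h

/-- The modulus of the short-time Fourier transform with Gaussian window. -/
def gaussSTFT (φ : 𝓢'(V, ℂ)) (y : V × V) : ℝ≥0∞ := ‖stft (gaussian V) φ y.1 y.2‖ₑ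

theorem measurable_gaussSTFT (φ : 𝓢'(V, ℂ)) : Measurable (gaussSTFT φ) :=
  (continuous_stft (gaussian V) φ).enorm.measurable

/-- The short-time Fourier transform of a window, with a translated Gaussian. -/
def translatedSTFT (φ : 𝓢'(V, ℂ)) (z u : V × V) : ℂ :=
  stft (shiftS (-z) (gaussian V)) φ u.1 u.2

theorem translatedSTFT_eq (φ : 𝓢'(V, ℂ)) (z u : V × V) : translatedSTFT φ z u =
    character (-z.2) u.1 * stft (gaussian V) φ (u.1 - z.1) (u.2 - z.2) := by
  rw [translatedSTFT, stft_shiftS_window, Prod.fst_neg, Prod.snd_neg, sub_eq_add_neg,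
    sub_eq_add_neg]

theorem enorm_translatedSTFT (φ : 𝓢'(V, ℂ)) (z u : V × V) :
    ‖translatedSTFT φ z u‖ₑ = gaussSTFT φ (u - z) := by
  rw [translatedSTFT_eq, enorm_mul, ← ofReal_norm, norm_character, ENNReal.ofReal_one, one_mul]
  rfl

theorem continuous_translatedSTFT (φ : 𝓢'(V, ℂ)) :
    Continuous (Function.uncurry (translatedSTFT φ)) := by
  have e : Function.uncurry (translatedSTFT φ) = fun t : (V × V) × (V × V) =>
      character (-t.1.2) t.2.1 * stft (gaussian V) φ (t.2.1 - t.1.1) (t.2.2 - t.1.2) := by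
    funext t
    exact translatedSTFT_eq φ t.1 t.2
  have h1 : Continuous fun t : (V × V) × (V × V) => (-t.1.2, t.2.1) := by fun_prop
  have h2 : Continuous fun t : (V × V) × (V × V) => (t.2.1 - t.1.1, t.2.2 - t.1.2) := by fun_prop
  have h3 := continuous_character.comp h1
  have h4 := (continuous_stft (gaussian V) φ).comp h2
  simp only [Function.comp_def] at h3 h4
  rw [e]
  exact h3.mul h4

/-- The integrand of the kernel of a localization operator. -/
def symbolIntegrand (a : 𝓢'(WithLp 2 (V × V), ℂ)) (φ₁ φ₂ : 𝓢'(V, ℂ)) (t : (V × V) × (V × V))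
    (z : V × V) : ℂ :=
  rotatedSTFT a z (t.2 - t.1) * (conj (translatedSTFT φ₁ z t.1) * translatedSTFT φ₂ z t.2)

theorem continuous_symbolIntegrand (a : 𝓢'(WithLp 2 (V × V), ℂ)) (φ₁ φ₂ : 𝓢'(V, ℂ)) :
    Continuous (Function.uncurry (symbolIntegrand a φ₁ φ₂)) := by
  have h1 : Continuous fun t : ((V × V) × (V × V)) × (V × V) => (t.2, t.1.2 - t.1.1) := by fun_prop
  have h2 : Continuous fun t : ((V × V) × (V × V)) × (V × V) => (t.2, t.1.1) := by fun_prop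
  have h3 : Continuous fun t : ((V × V) × (V × V)) × (V × V) => (t.2, t.1.2) := by fun_prop
  have h4 := (continuous_rotatedSTFT a).comp h1
  have h5 := Complex.continuous_conj.comp ((continuous_translatedSTFT φ₁).comp h2)
  have h6 := (continuous_translatedSTFT φ₂).comp h3
  exact h4.mul (h5.mul h6)

/-- The kernel of a localization operator with respect to the short-time Fourier transform. -/
def symbolKernel (κ : ℝ) (a : 𝓢'(WithLp 2 (V × V), ℂ)) (φ₁ φ₂ : 𝓢'(V, ℂ)) (u w : V × V) : ℂ :=
  κ * ∫ z, symbolIntegrand a φ₁ φ₂ (u, w) z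

theorem measurable_symbolKernel (κ : ℝ) (a : 𝓢'(WithLp 2 (V × V), ℂ)) (φ₁ φ₂ : 𝓢'(V, ℂ)) :
    Measurable (Function.uncurry (symbolKernel κ a φ₁ φ₂)) := by
  have h := (continuous_symbolIntegrand a φ₁ φ₂).stronglyMeasurable.integral_prod_right'
    (ν := (volume : Measure (V × V)))
  exact (h.const_mul (κ : ℂ)).measurable

/-- A function on the phase space in product coordinates, with the frequency variable rotated. -/
def rotated (α : WithLp 2 (V × V) → WithLp 2 (V × V) → ℝ≥0∞) (z ζ : V × V) : ℝ≥0∞ :=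
  α (WithLp.toLp 2 z) (WithLp.toLp 2 (ζ.2, -ζ.1))

theorem measurable_rotated {α : WithLp 2 (V × V) → WithLp 2 (V × V) → ℝ≥0∞}
    (hα : Measurable (Function.uncurry α)) : Measurable (Function.uncurry (rotated α)) := by
  have h1 : Continuous fun t : (V × V) × (V × V) =>
      ((WithLp.toLp 2 t.1 : WithLp 2 (V × V)), (WithLp.toLp 2 (t.2.2, -t.2.1) : WithLp 2 (V × V))) :=
    ((WithLp.prod_continuous_toLp 2 V V).comp continuous_fst).prodMk
      ((WithLp.prod_continuous_toLp 2 V V).comp (by fun_prop))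
  exact hα.comp h1.measurable

/-- A majorant of the kernel of a localization operator. -/
def symbolMajorant (α : WithLp 2 (V × V) → WithLp 2 (V × V) → ℝ≥0∞) (φ₁ φ₂ : 𝓢'(V, ℂ))
    (u ζ : V × V) : ℝ≥0∞ :=
  ∫⁻ z, rotated α z ζ * (gaussSTFT φ₁ (u - z) * gaussSTFT φ₂ (u + ζ - z))

theorem enorm_symbolIntegrand (a : 𝓢'(WithLp 2 (V × V), ℂ)) (φ₁ φ₂ : 𝓢'(V, ℂ))
    (t : (V × V) × (V × V)) (z : V × V) : ‖symbolIntegrand a φ₁ φ₂ t z‖ₑ =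
      rotated (fun z ζ => ‖stft (gaussian (WithLp 2 (V × V))) a z ζ‖ₑ) z (t.2 - t.1) *
        (gaussSTFT φ₁ (t.1 - z) * gaussSTFT φ₂ (t.2 - z)) := by
  rw [symbolIntegrand, enorm_mul, enorm_mul, RCLike.enorm_conj, enorm_translatedSTFT,
    enorm_translatedSTFT, rotatedSTFT, rotated]

theorem enorm_symbolKernel_le (κ : ℝ) (a : 𝓢'(WithLp 2 (V × V), ℂ)) (φ₁ φ₂ : 𝓢'(V, ℂ))
    (u w : V × V) :
    ‖symbolKernel κ a φ₁ φ₂ u w‖ₑ ≤ ‖κ‖₊ * symbolMajorant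
      (fun z ζ => ‖stft (gaussian (WithLp 2 (V × V))) a z ζ‖ₑ) φ₁ φ₂ u (w - u) := by
  rw [symbolKernel, symbolMajorant, enorm_mul, add_sub_cancel]
  have : ‖(κ : ℂ)‖ₑ = ‖κ‖₊ := by
    rw [← ofReal_norm, Complex.norm_real, ofReal_norm]
    rfl
  rw [this]
  refine mul_le_mul_right ((enorm_integral_le_lintegral_enorm _).trans_eq ?_) _
  simp only [enorm_symbolIntegrand]

theorem measurable_symbolMajorant {α : WithLp 2 (V × V) → WithLp 2 (V × V) → ℝ≥0∞}
    (hα : Measurable (Function.uncurry α)) (φ₁ φ₂ : 𝓢'(V, ℂ)) :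
    Measurable (Function.uncurry (symbolMajorant α φ₁ φ₂)) := by
  have h1 : Measurable fun t : ((V × V) × (V × V)) × (V × V) => (t.2, t.1.2) := by fun_prop
  have h2 : Measurable fun t : ((V × V) × (V × V)) × (V × V) => t.1.1 - t.2 := by fun_prop
  have h3 : Measurable fun t : ((V × V) × (V × V)) × (V × V) => t.1.1 + t.1.2 - t.2 := by fun_prop
  have h4 := ((measurable_rotated hα).comp h1).mul (((measurable_gaussSTFT φ₁).comp h2).mul
    ((measurable_gaussSTFT φ₂).comp h3))
  exact h4.lintegral_prod_right' (ν := (volume : Measure (V × V)))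

theorem phaseWeight_pos (s : ℝ) (w : V × V) : 0 < phaseWeight s w :=
  ENNReal.ofReal_pos.2 ((isModerate_vWeight s).pos w.1 w.2)

theorem phaseWeight_ne_top (s : ℝ) (w : V × V) : phaseWeight s w ≠ ∞ := ENNReal.ofReal_ne_top

attribute [irreducible] rotated rotatedSTFT translatedSTFT symbolIntegrand gaussSTFT phaseWeight

variable {α : WithLp 2 (V × V) → WithLp 2 (V × V) → ℝ≥0∞}

/-- For fixed ζ the majorant is a convolution in u, and Young's inequality from L¹ and L^P to L^P
applies. -/
theorem lpNorm_symbolMajorant_le (hα : Measurable (Function.uncurry α)) (φ₁ φ₂ : 𝓢'(V, ℂ))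
    {P : ℝ≥0∞} (hP : 1 ≤ P) (ζ : V × V) :
    eLpNorm (fun u => symbolMajorant α φ₁ φ₂ u ζ) P volume ≤
      (∫⁻ y, gaussSTFT φ₁ y * gaussSTFT φ₂ (y + ζ)) *
        eLpNorm (fun z => rotated α z ζ) P volume := by
  have hβ : Measurable fun y => gaussSTFT φ₁ y * gaussSTFT φ₂ (y + ζ) :=
    (measurable_gaussSTFT φ₁).mul ((measurable_gaussSTFT φ₂).comp (measurable_add_const ζ))
  have hα' : Measurable fun z => rotated α z ζ :=
    (measurable_rotated hα).comp measurable_prodMk_right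
  have e : (fun u => symbolMajorant α φ₁ φ₂ u ζ) =
      twistedOp (fun _ y => gaussSTFT φ₁ y * gaussSTFT φ₂ (y + ζ)) (fun z => rotated α z ζ) := by
    funext u
    refine lintegral_congr fun z => ?_
    rw [mul_comm, add_sub_right_comm]
  rw [e]
  have hinv : P⁻¹ ≤ 1 := ENNReal.inv_le_one.2 hP
  refine (lpNorm_twistedOp_le (P := ∞) (q := 1) (a := P) (b := P) le_rfl le_top
    (by simpa using hinv) (by simp) (by simp [add_comm])
    (H := fun _ y => gaussSTFT φ₁ y * gaussSTFT φ₂ (y + ζ)) (hβ.comp measurable_snd) hα').trans ?_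
  gcongr
  rw [lpNorm_one]
  exact lintegral_mono fun y => lpNorm_top_le (Eventually.of_forall fun _ => le_rfl)

/-- Writes v_s(ζ) = v_{-s}(ζ) v_{2s}(ζ) and, since ζ = (y+ζ) - y, bounds v_{2s}(ζ) by 2^s
v_{2s}(y+ζ) v_{2s}(y); the Cauchy-Schwarz inequality finishes. The windows pay with weight v_{2s} so
that the symbol needs only v_{-s}. -/
theorem phaseWeight_mul_lintegral_le {s : ℝ} (hs : 0 ≤ s) (φ₁ φ₂ : 𝓢'(V, ℂ)) (ζ : V × V) :
    phaseWeight s ζ * ∫⁻ y, gaussSTFT φ₁ y * gaussSTFT φ₂ (y + ζ) ≤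
      ENNReal.ofReal (2 ^ s) * phaseWeight (-s) ζ *
        (eLpNorm (fun y => phaseWeight (2 * s) y * gaussSTFT φ₁ y) 2 volume *
          eLpNorm (fun y => phaseWeight (2 * s) y * gaussSTFT φ₂ y) 2 volume) := by
  have hm : ∀ φ : 𝓢'(V, ℂ), Measurable fun y : V × V => phaseWeight (2 * s) y * gaussSTFT φ y :=
    fun φ => (measurable_phaseWeight _).mul (measurable_gaussSTFT φ)
  have hm2 : Measurable fun y : V × V =>
      phaseWeight (2 * s) (y + ζ) * gaussSTFT φ₂ (y + ζ) :=
    (hm φ₂).comp (measurable_add_const ζ)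
  have hH := lintegral_mul_le_lpNorm (μ := (volume : Measure (V × V))) (p := 2) (q := 2)
    ENNReal.inv_two_add_inv_two (hm φ₁) hm2
  rw [lpNorm_comp_measurePreserving (f := fun y => phaseWeight (2 * s) y * gaussSTFT φ₂ y) (hm φ₂)
    (measurePreserving_add_right volume ζ)] at hH
  have hw : ∀ y, phaseWeight s ζ ≤ ENNReal.ofReal (2 ^ s) * phaseWeight (-s) ζ *
      (phaseWeight (2 * s) y * phaseWeight (2 * s) (y + ζ)) := by
    intro y
    have h1 : phaseWeight s ζ = phaseWeight (-s) ζ * phaseWeight (2 * s) ζ := by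
      rw [phaseWeight_mul]
      congr 1
      ring
    have h2 := phaseWeight_add_le (s := 2 * s) (by linarith) (y + ζ) (-y)
    rw [phaseWeight_neg, show y + ζ + -y = ζ by abel, show 2 * s / 2 = s by ring] at h2
    rw [h1]
    refine (mul_le_mul_right h2 _).trans_eq ?_
    ring
  refine le_trans ?_ (mul_le_mul_right hH _)
  have hne : ENNReal.ofReal (2 ^ s) * phaseWeight (-s) ζ ≠ ∞ :=
    ENNReal.mul_ne_top ENNReal.ofReal_ne_top (phaseWeight_ne_top _ _)
  rw [← lintegral_const_mul' (phaseWeight s ζ) _ (phaseWeight_ne_top s ζ),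
    ← lintegral_const_mul' _ _ hne]
  refine lintegral_mono fun y => (mul_le_mul_left (hw y) _).trans_eq ?_
  ring

theorem lpNorm_weighted_symbolMajorant_le {s : ℝ} (hs : 0 ≤ s)
    (hα : Measurable (Function.uncurry α)) (φ₁ φ₂ : 𝓢'(V, ℂ)) {P q : ℝ≥0∞} (hP : 1 ≤ P) :
    eLpNorm (fun ζ => eLpNorm (fun u => phaseWeight s ζ * symbolMajorant α φ₁ φ₂ u ζ) P volume)
      q volume ≤
      ENNReal.ofReal (2 ^ s) * (eLpNorm (fun y => phaseWeight (2 * s) y * gaussSTFT φ₁ y) 2 volume *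
          eLpNorm (fun y => phaseWeight (2 * s) y * gaussSTFT φ₂ y) 2 volume) *
      eLpNorm (fun ζ => phaseWeight (-s) ζ * eLpNorm (fun z => rotated α z ζ) P volume)
        q volume := by
  have hα' : Measurable fun ζ : V × V => eLpNorm (fun z => rotated α z ζ) P volume :=
    measurable_lpNorm_left (measurable_rotated hα) P
  refine le_trans (lpNorm_mono fun ζ => ?_)
    (lpNorm_const_mul ((measurable_phaseWeight (-s)).mul hα') _)
  have hζ : Measurable fun u => symbolMajorant α φ₁ φ₂ u ζ :=
    (measurable_symbolMajorant hα φ₁ φ₂).comp measurable_prodMk_right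
  refine (lpNorm_const_mul hζ _).trans ((mul_le_mul_right
    (lpNorm_symbolMajorant_le hα φ₁ φ₂ hP ζ) _).trans ?_)
  rw [← mul_assoc]
  refine (mul_le_mul_left (phaseWeight_mul_lintegral_le hs φ₁ φ₂ ζ) _).trans_eq ?_
  simp only [Pi.mul_apply]
  ring

theorem lpNorm_eq_mixedLpNorm {f : V × V → ℝ≥0∞} (hf : Measurable f) {p : ℝ≥0∞}
    (h0 : p ≠ 0) (ht : p ≠ ∞) : eLpNorm f p volume = mixedLpNorm p p fun x ξ => f (x, ξ) := by
  have hp := ENNReal.toReal_pos h0 ht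
  have hfp : Measurable fun w => f w ^ p.toReal := hf.pow_const _
  rw [mixedLpNorm, lpNorm_eq_lintegral h0 ht, lpNorm_eq_lintegral h0 ht]
  congr 1
  rw [Measure.volume_eq_prod, lintegral_prod_symm _ hfp.aemeasurable]
  refine lintegral_congr fun ξ => ?_
  rw [lpNorm_eq_lintegral h0 ht, ← ENNReal.rpow_mul, inv_mul_cancel₀ hp.ne', ENNReal.rpow_one]

theorem measurePreserving_toLp : MeasurePreserving
    (fun z : V × V => (WithLp.toLp 2 z : WithLp 2 (V × V))) :=
  (measurePreserving_phaseEquiv (V := V)).symm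

theorem measurePreserving_rotate : MeasurePreserving
    (fun ζ : V × V => (WithLp.toLp 2 (ζ.2, -ζ.1) : WithLp 2 (V × V))) := by
  have h1 : MeasurePreserving (fun ζ : V × V => (ζ.2, -ζ.1)) :=
    ((MeasurePreserving.id (volume : Measure V)).prod
      (Measure.measurePreserving_neg (volume : Measure V))).comp Measure.measurePreserving_swap
  exact measurePreserving_toLp.comp h1

theorem mul_lpNorm_le {α : Type*} [MeasurableSpace α] {μ : Measure α} {p : ℝ≥0∞} {f : α → ℝ≥0∞}
    (hf : Measurable f) {c : ℝ≥0∞} (h0 : c ≠ 0) (ht : c ≠ ∞) :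
    c * eLpNorm f p μ ≤ eLpNorm (fun x => c * f x) p μ := by
  have h := lpNorm_const_mul (μ := μ) (p := p) (hf.const_mul c) c⁻¹
  simp only [← mul_assoc, ENNReal.inv_mul_cancel h0 ht, one_mul] at h
  refine (mul_le_mul_right h c).trans_eq ?_
  rw [← mul_assoc, ENNReal.mul_inv_cancel h0 ht, one_mul]

theorem lpNorm_lpNorm_phase (P q : ℝ≥0∞) {f : WithLp 2 (V × V) → WithLp 2 (V × V) → ℝ≥0∞}
    (hf : Measurable (Function.uncurry f)) :
    eLpNorm (fun ζ : V × V => eLpNorm (fun z : V × V =>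
      f (WithLp.toLp 2 z) (WithLp.toLp 2 (ζ.2, -ζ.1))) P volume) q volume = mixedLpNorm P q f := by
  have hG : Measurable fun η => eLpNorm (fun z => f z η) P volume := measurable_lpNorm_left hf P
  rw [mixedLpNorm, ← lpNorm_comp_measurePreserving hG measurePreserving_rotate]
  congr 1
  funext ζ
  have hz : Measurable fun z => f z (WithLp.toLp 2 (ζ.2, -ζ.1)) := hf.comp measurable_prodMk_right
  exact lpNorm_comp_measurePreserving hz measurePreserving_toLp

/-- The rotation of the frequency variable is an isometry, so the weight does not see it. -/
theorem phaseWeight_eq_oneTensorWeight (s : ℝ) (z ζ : V × V) : phaseWeight s ζ =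
    ENNReal.ofReal (oneTensorWeight s (WithLp.toLp 2 z : WithLp 2 (V × V))
      (WithLp.toLp 2 (ζ.2, -ζ.1))) := by
  rw [phaseWeight, vWeight, oneTensorWeight, WithLp.prod_norm_sq_eq_of_L2]
  congr 2
  change _ = 1 + (‖ζ.2‖ ^ 2 + ‖-ζ.1‖ ^ 2)
  rw [norm_neg]
  ring

theorem lpNorm_rotated_le (s : ℝ) (hα : Measurable (Function.uncurry α)) (P q : ℝ≥0∞) :
    eLpNorm (fun ζ => phaseWeight s ζ * eLpNorm (fun z => rotated α z ζ) P volume) q volume ≤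
      mixedLpNorm P q (fun z ζ => ENNReal.ofReal (oneTensorWeight s z ζ) * α z ζ) := by
  have hm : Measurable (Function.uncurry fun z ζ : WithLp 2 (V × V) =>
      ENNReal.ofReal (oneTensorWeight s z ζ) * α z ζ) :=
    (isModerate_oneTensorWeight s).measurable.mul hα
  rw [← lpNorm_lpNorm_phase P q hm]
  refine lpNorm_mono fun ζ => ?_
  have hr : Measurable fun z => rotated α z ζ :=
    (measurable_rotated hα).comp measurable_prodMk_right
  refine (mul_lpNorm_le hr (phaseWeight_pos s ζ).ne' (phaseWeight_ne_top s ζ)).trans ?_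
  refine lpNorm_mono fun z => le_of_eq ?_
  rw [phaseWeight_eq_oneTensorWeight s z, rotated]

/-- The embedding of M^r in M² for r ≤ 2, in the form required by the Cauchy-Schwarz step. -/
theorem exists_lpNorm_gaussSTFT_le {g : 𝓢(V, ℂ)} (hg : g ≠ 0) (s : ℝ) {r : ℝ≥0∞} (hr : 1 ≤ r)
    (hr₂ : r ≤ 2) : ∃ C : ℝ≥0, ∀ φ : 𝓢'(V, ℂ),
      eLpNorm (fun y => phaseWeight s y * gaussSTFT φ y) 2 volume ≤
        C * modulationNorm g r r (vWeight s) φ := by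
  obtain ⟨C, h⟩ := exists_mixedLpNorm_stft_le hg (gaussian V) (isModerate_vWeight s) hr hr₂ hr hr₂
  refine ⟨C, fun φ => ?_⟩
  rw [lpNorm_eq_mixedLpNorm (f := fun y => phaseWeight s y * gaussSTFT φ y)
    ((measurable_phaseWeight s).mul (measurable_gaussSTFT φ)) two_ne_zero (by simp)]
  refine le_trans (mixedLpNorm_mono fun x ξ => le_of_eq ?_) (h φ)
  rw [phaseWeight, gaussSTFT]

/-- Submultiplicativity, v_s(w) ≤ 2^{s/2} v_s(u) v_s(w-u), puts one factor on F and the other on the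
kernel, so that unweighted inequalities suffice. -/
theorem weight_mul_kernelMajorant_le (c : ℝ≥0) (φ₁ φ₂ : 𝓢'(V, ℂ)) {s : ℝ} (hs : 0 ≤ s)
    (F : V → V → ℝ≥0∞) (x ξ : V) :
    ENNReal.ofReal (vWeight s x ξ) *
      kernelMajorant (fun u w => c * symbolMajorant α φ₁ φ₂ u (w - u)) F x ξ ≤
      (c * ENNReal.ofReal (2 ^ (s / 2))) *
        twistedOp (fun u ζ => phaseWeight s ζ * symbolMajorant α φ₁ φ₂ u ζ)
          (Function.uncurry fun x ξ => ENNReal.ofReal (vWeight s x ξ) * F x ξ) (x, ξ) := by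
  have hne : c * ENNReal.ofReal (2 ^ (s / 2)) ≠ ∞ :=
    ENNReal.mul_ne_top ENNReal.coe_ne_top ENNReal.ofReal_ne_top
  rw [kernelMajorant, twistedOp, ← lintegral_const_mul' _ _ ENNReal.ofReal_ne_top,
    ← lintegral_const_mul' _ _ hne]
  refine lintegral_mono fun u => ?_
  have h2 := phaseWeight_add_le hs u ((x, ξ) - u)
  rw [add_sub_cancel] at h2
  have e : ∀ w : V × V, ENNReal.ofReal (vWeight s w.1 w.2) = phaseWeight s w := fun w => by
    rw [phaseWeight]
  rw [show ENNReal.ofReal (vWeight s x ξ) = phaseWeight s (x, ξ) from e (x, ξ)]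
  simp only [Function.uncurry]
  rw [e u]
  refine (mul_le_mul_left h2 _).trans_eq ?_
  ring

/-- The majorant of the kernel of a localization operator is bounded on weighted mixed Lebesgue
spaces. -/
theorem exists_isBoundedKernel_symbolMajorant (c : ℝ≥0) {g : 𝓢(V, ℂ)} (hg : g ≠ 0) {s : ℝ}
    (hs : 0 ≤ s) {q P r a₁ a₂ b₁ b₂ : ℝ≥0∞} (hq : 1 ≤ q) (hqP : q ≤ P) (hr : 1 ≤ r) (hr₂ : r ≤ 2)
    (hPa₁ : P⁻¹ + a₁⁻¹ ≤ 1) (hqa₁ : 1 ≤ q⁻¹ + a₁⁻¹) (hb₁ : b₁⁻¹ + 1 = P⁻¹ + q⁻¹ + a₁⁻¹)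
    (hPa₂ : P⁻¹ + a₂⁻¹ ≤ 1) (hqa₂ : 1 ≤ q⁻¹ + a₂⁻¹) (hb₂ : b₂⁻¹ + 1 = P⁻¹ + q⁻¹ + a₂⁻¹)
    (hb₁' : 1 ≤ b₁) :
    ∃ C : ℝ≥0, ∀ α : WithLp 2 (V × V) → WithLp 2 (V × V) → ℝ≥0∞, Measurable (Function.uncurry α) →
      mixedLpNorm P q (fun z ζ => ENNReal.ofReal (oneTensorWeight (-s) z ζ) * α z ζ) < ∞ →
      ∀ φ₁ ∈ modulationSpace g r r (vWeight (2 * s)),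
      ∀ φ₂ ∈ modulationSpace g r r (vWeight (2 * s)),
      IsBoundedKernel (fun u w => c * symbolMajorant α φ₁ φ₂ u (w - u)) (vWeight s) a₁ a₂ b₁ b₂
        (C * (mixedLpNorm P q (fun z ζ => ENNReal.ofReal (oneTensorWeight (-s) z ζ) * α z ζ) *
          modulationNorm g r r (vWeight (2 * s)) φ₁ *
          modulationNorm g r r (vWeight (2 * s)) φ₂)) := by
  obtain ⟨C₂, h₂⟩ := exists_lpNorm_gaussSTFT_le hg (2 * s) hr hr₂
  refine ⟨c * (2 ^ (s / 2) : ℝ).toNNReal * ((2 ^ s : ℝ).toNNReal * (C₂ * C₂)),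
    fun α hα hfin φ₁ hφ₁ φ₂ hφ₂ => ⟨?_, ?_, fun F hF => ?_⟩⟩
  · exact (measurable_twistedKernel (H := fun w u => symbolMajorant α φ₁ φ₂ w u)
      (measurable_symbolMajorant hα φ₁ φ₂)).comp measurable_swap |>.const_mul _
  · exact ENNReal.mul_ne_top ENNReal.coe_ne_top
      (ENNReal.mul_ne_top (ENNReal.mul_ne_top hfin.ne hφ₁.ne) hφ₂.ne)
  have hH : Measurable (Function.uncurry fun u ζ => phaseWeight s ζ * symbolMajorant α φ₁ φ₂ u ζ) :=
    ((measurable_phaseWeight s).comp measurable_snd).mul (measurable_symbolMajorant hα φ₁ φ₂)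
  have hmF : Measurable (Function.uncurry fun x ξ => ENNReal.ofReal (vWeight s x ξ) * F x ξ) :=
    (isModerate_vWeight s).measurable.mul hF
  have hT : Measurable (Function.uncurry fun x ξ =>
      twistedOp (fun u ζ => phaseWeight s ζ * symbolMajorant α φ₁ φ₂ u ζ)
        (Function.uncurry fun x ξ => ENNReal.ofReal (vWeight s x ξ) * F x ξ) (x, ξ)) :=
    measurable_twistedOp hH hmF
  have hN := lpNorm_weighted_symbolMajorant_le hs hα φ₁ φ₂ (q := q) (hq.trans hqP)
  have hN' := hN.trans (mul_le_mul' (mul_le_mul_right (mul_le_mul' (h₂ φ₁) (h₂ φ₂)) _)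
    (lpNorm_rotated_le (-s) hα P q))
  refine (mixedLpNorm_mono (weight_mul_kernelMajorant_le c φ₁ φ₂ hs F)).trans
    ((mixedLpNorm_const_mul hT _).trans ?_)
  refine (mul_le_mul_right ((mixedLpNorm_twistedOp_le hq hqP hPa₁ hqa₁ hb₁ hPa₂ hqa₂ hb₂ hb₁' hH
    hmF).trans (mul_le_mul_left hN' _)) _).trans_eq ?_
  push_cast
  have e2 : ∀ t : ℝ, ((t.toNNReal : ℝ≥0) : ℝ≥0∞) = ENNReal.ofReal t := fun _ => rfl
  rw [e2, e2]
  ring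

end SymbolKernel

/-! ### Functions of polynomial growth as distributions; symmetry of smearing. -/

section PolynomialGrowth

open Filter Module

variable {V : Type*} [NormedAddCommGroup V] [InnerProductSpace ℝ V] [FiniteDimensional ℝ V]
  [MeasurableSpace V] [BorelSpace V]

theorem norm_mul_conj_le {F : V → ℂ} {C : ℝ} (hC : 0 ≤ C) {n : ℕ}
    (hF : ∀ w, ‖F w‖ ≤ C * (1 + ‖w‖) ^ n) (h : 𝓢(V, ℂ)) (w : V) : ‖F w * conj (h w)‖ ≤
      C * (2 ^ (n + (finrank ℝ V + 1)) * supSeminorm V (n + (finrank ℝ V + 1)) h) *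
        decay (finrank ℝ V + 1) w := by
  have h1 := one_add_norm_pow_mul_le (n + (finrank ℝ V + 1)) (n + (finrank ℝ V + 1)) 0 le_rfl
    (Nat.zero_le _) h w
  rw [norm_iteratedFDeriv_zero] at h1
  have hp : 0 < (1 + ‖w‖) ^ (n + (finrank ℝ V + 1)) := by positivity
  have h2 : ‖h w‖ ≤ 2 ^ (n + (finrank ℝ V + 1)) * supSeminorm V (n + (finrank ℝ V + 1)) h *
      decay (n + (finrank ℝ V + 1)) w := by
    rw [decay, ← div_eq_mul_inv, le_div_iff₀ hp, mul_comm]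
    exact h1
  rw [norm_mul, RCLike.norm_conj]
  refine (mul_le_mul (hF w) h2 (norm_nonneg _) (by positivity)).trans_eq ?_
  rw [← one_add_norm_pow_mul_decay n (finrank ℝ V + 1) w]
  ring

/-- A continuous function of polynomial growth is a tempered distribution. -/
theorem exists_bracket_eq_integral {F : V → ℂ} (hc : Continuous F) {C : ℝ} (hC : 0 ≤ C) {n : ℕ}
    (hF : ∀ w, ‖F w‖ ≤ C * (1 + ‖w‖) ^ n) :
    ∃ G : 𝓢'(V, ℂ), ∀ h, bracket G h = ∫ w, F w * conj (h w) := by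
  have hdec := integrable_decay (V := V) (Nat.lt_succ_self (finrank ℝ V))
  have hint : ∀ h : 𝓢(V, ℂ), Integrable fun w => F w * conj (h w) := fun h =>
    (hdec.const_mul _).mono' (hc.mul (Complex.continuous_conj.comp h.continuous)).aestronglyMeasurable
      (Eventually.of_forall (norm_mul_conj_le hC hF h))
  refine exists_bracket_eq (q := supSeminorm V (n + (finrank ℝ V + 1)))
    (C := C * 2 ^ (n + (finrank ℝ V + 1)) * ∫ w : V, decay (finrank ℝ V + 1) w)
    (fun g g' => ?_) (fun c g => ?_) (continuous_supSeminorm _) fun g => ?_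
  · rw [← integral_add (hint g) (hint g')]
    refine integral_congr_ae (Eventually.of_forall fun w => ?_)
    simp [mul_add]
  · rw [← integral_const_mul]
    refine integral_congr_ae (Eventually.of_forall fun w => ?_)
    simp only [smul_apply, smul_eq_mul, map_mul]
    ring
  · refine (norm_integral_le_of_norm_le (hdec.const_mul _)
      (Eventually.of_forall (norm_mul_conj_le hC hF g))).trans_eq ?_
    rw [integral_const_mul]
    ring

theorem exists_norm_stftDistWindow_le (φ : 𝓢'(V, ℂ)) (f : 𝓢(V, ℂ)) : ∃ (n : ℕ) (C : ℝ), 0 ≤ C ∧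
    ∀ w : WithLp 2 (V × V), ‖stftDistWindow φ f w.fst w.snd‖ ≤ C * (1 + ‖w‖) ^ n := by
  obtain ⟨n, C, hC, h⟩ := norm_le_exists_seminorm φ f
  refine ⟨n + n, C, hC, fun w => ?_⟩
  rw [stftDistWindow_eq, norm_mul, RCLike.norm_conj, RCLike.norm_conj, norm_character, one_mul]
  refine (h _ _).trans ?_
  rw [norm_neg, norm_neg, pow_add]
  have h1 : ‖w.fst‖ ≤ ‖w‖ := WithLp.norm_fst_le V w
  have h2 : ‖w.snd‖ ≤ ‖w‖ := WithLp.norm_snd_le V w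
  gcongr

/-- The function `conj(V_{φ₁} f) · V_{φ₂} g` on the time-frequency plane. -/
def windowProduct (φ₁ φ₂ : 𝓢'(V, ℂ)) (f g : 𝓢(V, ℂ)) (w : WithLp 2 (V × V)) : ℂ :=
  conj (stftDistWindow φ₁ f w.fst w.snd) * stftDistWindow φ₂ g w.fst w.snd

theorem continuous_windowProduct (φ₁ φ₂ : 𝓢'(V, ℂ)) (f g : 𝓢(V, ℂ)) :
    Continuous (windowProduct φ₁ φ₂ f g) := by
  have h1 : Continuous fun w : WithLp 2 (V × V) => (w.fst, w.snd) :=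
    WithLp.prod_continuous_ofLp 2 V V
  have h2 := (continuous_stftDistWindow φ₁ f).comp h1
  have h3 := (continuous_stftDistWindow φ₂ g).comp h1
  simp only [Function.comp_def] at h2 h3
  exact (Complex.continuous_conj.comp h2).mul h3

/-- The product has polynomial growth, hence is a tempered distribution. Continuity and the change
of windows then apply to its transform. -/
theorem exists_stft_eq_stftFun_windowProduct (φ₁ φ₂ : 𝓢'(V, ℂ)) (f g : 𝓢(V, ℂ)) :
    ∃ G : 𝓢'(WithLp 2 (V × V), ℂ), ∀ Ψ z ζ, stft Ψ G z ζ = stftFun Ψ (windowProduct φ₁ φ₂ f g) z ζ := by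
  obtain ⟨n₁, C₁, hC₁, h₁⟩ := exists_norm_stftDistWindow_le φ₁ f
  obtain ⟨n₂, C₂, hC₂, h₂⟩ := exists_norm_stftDistWindow_le φ₂ g
  obtain ⟨G, hG⟩ := exists_bracket_eq_integral (continuous_windowProduct φ₁ φ₂ f g)
    (C := C₁ * C₂) (by positivity) (n := n₁ + n₂) fun w => by
      rw [windowProduct, norm_mul, RCLike.norm_conj]
      refine (mul_le_mul (h₁ w) (h₂ w) (norm_nonneg _) (by positivity)).trans_eq ?_
      rw [pow_add]
      ring
  exact ⟨G, fun Ψ z ζ => hG _⟩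

/-- The decay profile is even, so smearing is symmetric under Tonelli. -/
theorem lintegral_mul_smear_comm (n : ℕ) {F G : V → V → ℝ≥0∞} (hF : Measurable (Function.uncurry F))
    (hG : Measurable (Function.uncurry G)) :
    ∫⁻ w : V × V, F w.1 w.2 * smear n G w.1 w.2 = ∫⁻ w : V × V, smear n F w.1 w.2 * G w.1 w.2 := by
  have hm : Measurable fun t : (V × V) × (V × V) =>
      F t.1.1 t.1.2 * (decayE n (t.1.1 - t.2.1) * decayE n (t.1.2 - t.2.2) * G t.2.1 t.2.2) :=
    (hF.comp measurable_fst).mul ((((measurable_decayE n).comp (by fun_prop)).mul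
      ((measurable_decayE n).comp (by fun_prop))).mul (hG.comp measurable_snd))
  have e1 : ∀ w : V × V, F w.1 w.2 * smear n G w.1 w.2 = ∫⁻ v : V × V, F w.1 w.2 *
      (decayE n (w.1 - v.1) * decayE n (w.2 - v.2) * G v.1 v.2) := by
    intro w
    rw [smear_eq hG, lintegral_const_mul]
    exact (((measurable_decayE n).comp (by fun_prop)).mul
      ((measurable_decayE n).comp (by fun_prop))).mul hG
  have e2 : ∀ v : V × V, smear n F v.1 v.2 * G v.1 v.2 = ∫⁻ w : V × V, F w.1 w.2 *
      (decayE n (w.1 - v.1) * decayE n (w.2 - v.2) * G v.1 v.2) := by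
    intro v
    rw [smear_eq hF, ← lintegral_mul_const]
    · refine lintegral_congr fun w => ?_
      rw [decayE_sub_comm n v.1, decayE_sub_comm n v.2]
      ring
    · exact (((measurable_decayE n).comp (by fun_prop)).mul
        ((measurable_decayE n).comp (by fun_prop))).mul hF
  simp only [e1, e2]
  exact lintegral_lintegral_swap hm.aemeasurable

end PolynomialGrowth

/-! ### Changes of variables between the pairing and the kernel form. -/

section WeakFormula

open Filter Module

/-- The change of variables `((z, ζ), u) ↦ ((u, u + ζ), z)`. -/
def shearPerm {G : Type*} [Add G] (t : (G × G) × G) : (G × G) × G := ((t.2, t.2 + t.1.2), t.1.1)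

theorem measurePreserving_shearPerm {G : Type*} [AddGroup G] [MeasurableSpace G] [MeasurableAdd₂ G]
    (μ : Measure G) [SFinite μ] [μ.IsAddLeftInvariant] :
    MeasurePreserving (shearPerm : (G × G) × G → (G × G) × G) ((μ.prod μ).prod μ)
      ((μ.prod μ).prod μ) := by
  have h1 : MeasurePreserving (fun t : (G × G) × G => (t.1.1, (t.1.2, t.2))) ((μ.prod μ).prod μ)
    (μ.prod (μ.prod μ)) := measurePreserving_prodAssoc μ μ μ
  have h2 : MeasurePreserving (fun t : G × (G × G) => (t.2, t.1)) (μ.prod (μ.prod μ))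
    ((μ.prod μ).prod μ) := Measure.measurePreserving_swap
  have h3 : MeasurePreserving (fun t : G × G => (t.2, t.2 + t.1)) (μ.prod μ) (μ.prod μ) :=
    (measurePreserving_prod_add μ μ).comp Measure.measurePreserving_swap
  exact (h3.prod (MeasurePreserving.id μ)).comp (h2.comp h1)

variable {V : Type*} [NormedAddCommGroup V] [InnerProductSpace ℝ V] [FiniteDimensional ℝ V]
  [MeasurableSpace V] [BorelSpace V]

theorem measurePreserving_shearPerm_volume : MeasurePreserving
    (shearPerm : ((V × V) × (V × V)) × (V × V) → ((V × V) × (V × V)) × (V × V)) :=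
  measurePreserving_shearPerm (volume : Measure (V × V))

/-- The map `(z, ζ) ↦ (z, Jζ)` into the time-frequency plane of the time-frequency plane. -/
def rotatePair (t : (V × V) × (V × V)) : WithLp 2 (V × V) × WithLp 2 (V × V) :=
  (WithLp.toLp 2 t.1, WithLp.toLp 2 (t.2.2, -t.2.1))

theorem measurePreserving_rotatePair :
    MeasurePreserving (rotatePair : (V × V) × (V × V) → WithLp 2 (V × V) × WithLp 2 (V × V)) :=
  measurePreserving_toLp.prod measurePreserving_rotate

/-- The rotation undoes the symplectic twist of frequencies, so the second point becomes u + ζ. -/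
theorem exists_stftFun_windowProduct_eq : ∃ c : ℝ, 0 < c ∧ ∀ (φ₁ φ₂ : 𝓢'(V, ℂ)) (f g : 𝓢(V, ℂ))
    (t : (V × V) × (V × V)), c * stftFun (gaussian (WithLp 2 (V × V)))
      (windowProduct φ₁ φ₂ f g) (rotatePair t).1 (rotatePair t).2 =
    ∫ u : V × V, translatedSTFT φ₁ t.1 u * conj (stft (gaussian V) (f : 𝓢'(V, ℂ)) u.1 u.2) *
      (conj (translatedSTFT φ₂ t.1 (u + t.2)) *
        stft (gaussian V) (g : 𝓢'(V, ℂ)) (u + t.2).1 (u + t.2).2) := by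
  obtain ⟨c, hc, h⟩ := exists_stftFun_gaussian_eq (V := V)
  refine ⟨c, hc, fun φ₁ φ₂ f g t => (h φ₁ φ₂ f g _ _).trans ?_⟩
  refine integral_congr_ae (Eventually.of_forall fun u => ?_)
  simp only [translatedSTFT, rotatePair, WithLp.toLp_fst, WithLp.toLp_snd, sub_neg_eq_add,
    Prod.fst_add, Prod.snd_add, Prod.mk.eta]

end WeakFormula

/-! ### Absolute convergence of the pairing and its identification with the kernel form. -/

section WeakFormula

open Filter Module

variable {V : Type*} [NormedAddCommGroup V] [InnerProductSpace ℝ V] [FiniteDimensional ℝ V]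
  [MeasurableSpace V] [BorelSpace V]

/-- The nonnegative integrand which dominates the pairing of a symbol with a product of short-time
Fourier transforms. -/
def pairingMajorant (α : WithLp 2 (V × V) → WithLp 2 (V × V) → ℝ≥0∞) (φ₁ φ₂ : 𝓢'(V, ℂ))
    (f g : 𝓢(V, ℂ)) (t : ((V × V) × (V × V)) × (V × V)) : ℝ≥0∞ :=
  rotated α t.2 (t.1.2 - t.1.1) * (gaussSTFT φ₁ (t.1.1 - t.2) * gaussSTFT φ₂ (t.1.2 - t.2)) *
    (gaussSTFT (f : 𝓢'(V, ℂ)) t.1.1 * gaussSTFT (g : 𝓢'(V, ℂ)) t.1.2)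

variable {α : WithLp 2 (V × V) → WithLp 2 (V × V) → ℝ≥0∞} {φ₁ φ₂ : 𝓢'(V, ℂ)}

theorem measurable_pairingMajorant (hα : Measurable (Function.uncurry α)) (φ₁ φ₂ : 𝓢'(V, ℂ))
    (f g : 𝓢(V, ℂ)) : Measurable (pairingMajorant α φ₁ φ₂ f g) := by
  have h1 : Measurable fun t : ((V × V) × (V × V)) × (V × V) => (t.2, t.1.2 - t.1.1) := by fun_prop
  have h2 : Measurable fun t : ((V × V) × (V × V)) × (V × V) => t.1.1 - t.2 := by fun_prop
  have h3 : Measurable fun t : ((V × V) × (V × V)) × (V × V) => t.1.2 - t.2 := by fun_prop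
  have h4 : Measurable fun t : ((V × V) × (V × V)) × (V × V) => t.1.1 := by fun_prop
  have h5 : Measurable fun t : ((V × V) × (V × V)) × (V × V) => t.1.2 := by fun_prop
  exact (((measurable_rotated hα).comp h1).mul (((measurable_gaussSTFT φ₁).comp h2).mul
    ((measurable_gaussSTFT φ₂).comp h3))).mul (((measurable_gaussSTFT _).comp h4).mul
      ((measurable_gaussSTFT _).comp h5))

theorem pairingMajorant_shearPerm (f g : 𝓢(V, ℂ)) (t : (V × V) × (V × V)) (u : V × V) :
    pairingMajorant α φ₁ φ₂ f g (shearPerm (t, u)) = rotated α t.1 t.2 *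
      (gaussSTFT φ₁ (u - t.1) * gaussSTFT φ₂ (u + t.2 - t.1) *
        (gaussSTFT (f : 𝓢'(V, ℂ)) u * gaussSTFT (g : 𝓢'(V, ℂ)) (u + t.2))) := by
  simp only [pairingMajorant, shearPerm, add_sub_cancel_left]
  ring

variable {m : V → V → ℝ} {a₁ a₂ b₁ b₂ C : ℝ≥0∞}

/-- Integrating over z before the other variables produces `symbolMajorant`, whose boundedness as a
kernel handles the rest. -/
theorem lintegral_pairingMajorant_lt_top (hα : Measurable (Function.uncurry α))
    (hK : IsBoundedKernel (fun u w => ((1 : ℝ≥0) : ℝ≥0∞) * symbolMajorant α φ₁ φ₂ u (w - u))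
      m a₁ a₂ b₁ b₂ C) (hm : IsModerate m) (ha₁ : 1 ≤ a₁) (ha₂ : 1 ≤ a₂) (hb₁ : 1 ≤ b₁)
    (hb₂ : 1 ≤ b₂) (f g : 𝓢(V, ℂ)) : ∫⁻ t, pairingMajorant α φ₁ φ₂ f g t < ∞ := by
  have hf := coe_mem_modulationSpace (gaussian V) f ha₁ ha₂ hm
  rw [modulationSpace, Set.mem_ofPred_eq, modulationNorm_eq _ _ _ hm] at hf
  have hF : Measurable (Function.uncurry fun x ξ => ‖stft (gaussian V) (f : 𝓢'(V, ℂ)) x ξ‖ₑ) :=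
    (continuous_stft _ _).enorm.measurable
  refine lt_of_eq_of_lt ?_ (hK.lintegral_lt_top hm hb₁ hb₂ (gaussian V) g hF hf)
  rw [show (volume : Measure (((V × V) × (V × V)) × (V × V))) =
    (volume : Measure ((V × V) × (V × V))).prod (volume : Measure (V × V)) from rfl,
    lintegral_prod _ (measurable_pairingMajorant hα φ₁ φ₂ f g).aemeasurable]
  refine lintegral_congr fun t => ?_
  have h1 : Measurable fun z : V × V => rotated α z (t.2 - t.1) *
      (gaussSTFT φ₁ (t.1 - z) * gaussSTFT φ₂ (t.2 - z)) :=
    ((measurable_rotated hα).comp measurable_prodMk_right).mul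
      (((measurable_gaussSTFT φ₁).comp (measurable_const.sub measurable_id)).mul
        ((measurable_gaussSTFT φ₂).comp (measurable_const.sub measurable_id)))
  simp only [pairingMajorant]
  rw [lintegral_mul_const _ h1, ENNReal.coe_one, one_mul, mul_assoc, symbolMajorant,
    add_sub_cancel, gaussSTFT, gaussSTFT]

/-- A symbol and a product of short-time Fourier transforms pair absolutely. -/
theorem lintegral_mul_stftFun_lt_top (hα : Measurable (Function.uncurry α))
    {f g : 𝓢(V, ℂ)} (hfin : ∫⁻ t, pairingMajorant α φ₁ φ₂ f g t < ∞) :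
    ∫⁻ w : WithLp 2 (V × V) × WithLp 2 (V × V), α w.1 w.2 *
      ‖stftFun (gaussian (WithLp 2 (V × V))) (windowProduct φ₁ φ₂ f g) w.1 w.2‖ₑ < ∞ := by
  obtain ⟨c, hc, h⟩ := exists_stftFun_windowProduct_eq (V := V)
  obtain ⟨G, hG⟩ := exists_stft_eq_stftFun_windowProduct φ₁ φ₂ f g
  have hc' : ‖(c : ℂ)‖ₑ ≠ 0 := by simpa using hc.ne'
  have hm : Measurable fun w : WithLp 2 (V × V) × WithLp 2 (V × V) => α w.1 w.2 *
      ‖stftFun (gaussian (WithLp 2 (V × V))) (windowProduct φ₁ φ₂ f g) w.1 w.2‖ₑ := by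
    simp only [← hG]
    exact hα.mul (continuous_stft _ G).enorm.measurable
  have hmP := measurable_pairingMajorant hα φ₁ φ₂ f g
  have hmS : Measurable fun t => pairingMajorant α φ₁ φ₂ f g (shearPerm t) :=
    hmP.comp measurePreserving_shearPerm_volume.measurable
  rw [← measurePreserving_rotatePair.lintegral_comp hm]
  refine lt_of_le_of_lt ?_ (ENNReal.mul_lt_top (ENNReal.inv_lt_top.2 (pos_iff_ne_zero.2 hc')) hfin)
  rw [← measurePreserving_shearPerm_volume.lintegral_comp hmP,
    show (volume : Measure (((V × V) × (V × V)) × (V × V))) =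
    (volume : Measure ((V × V) × (V × V))).prod (volume : Measure (V × V)) from rfl,
    lintegral_prod _ hmS.aemeasurable,
    ← lintegral_const_mul' _ _ (ENNReal.inv_ne_top.2 hc')]
  refine lintegral_mono fun t => ?_
  have hmu : Measurable fun u : V × V => gaussSTFT φ₁ (u - t.1) * gaussSTFT φ₂ (u + t.2 - t.1) *
      (gaussSTFT (f : 𝓢'(V, ℂ)) u * gaussSTFT (g : 𝓢'(V, ℂ)) (u + t.2)) :=
    (((measurable_gaussSTFT φ₁).comp (by fun_prop)).mul
      ((measurable_gaussSTFT φ₂).comp (by fun_prop))).mul ((measurable_gaussSTFT _).mul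
        ((measurable_gaussSTFT _).comp (by fun_prop)))
  simp only [pairingMajorant_shearPerm]
  rw [lintegral_const_mul _ hmu, mul_left_comm]
  have e : rotated α t.1 t.2 = α (rotatePair t).1 (rotatePair t).2 := by rw [rotated, rotatePair]
  rw [e]
  refine mul_le_mul_right ?_ _
  rw [← ENNReal.mul_le_iff_le_inv hc' (by simp), ← enorm_mul, h]
  refine (enorm_integral_le_lintegral_enorm _).trans_eq (lintegral_congr fun u => ?_)
  rw [enorm_mul, enorm_mul, enorm_mul, RCLike.enorm_conj, RCLike.enorm_conj, enorm_translatedSTFT,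
    enorm_translatedSTFT, ← gaussSTFT, ← gaussSTFT]
  ring

variable {a : 𝓢'(WithLp 2 (V × V), ℂ)}

/-- The integrand of the kernel form of a localization operator. -/
def pairingIntegrand (a : 𝓢'(WithLp 2 (V × V), ℂ)) (φ₁ φ₂ : 𝓢'(V, ℂ)) (f g : 𝓢(V, ℂ))
    (t : ((V × V) × (V × V)) × (V × V)) : ℂ :=
  symbolIntegrand a φ₁ φ₂ t.1 t.2 * (stft (gaussian V) (f : 𝓢'(V, ℂ)) t.1.1.1 t.1.1.2 *
    conj (stft (gaussian V) (g : 𝓢'(V, ℂ)) t.1.2.1 t.1.2.2))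

theorem enorm_pairingIntegrand (f g : 𝓢(V, ℂ)) (t : ((V × V) × (V × V)) × (V × V)) :
    ‖pairingIntegrand a φ₁ φ₂ f g t‖ₑ = pairingMajorant
      (fun z ζ => ‖stft (gaussian (WithLp 2 (V × V))) a z ζ‖ₑ) φ₁ φ₂ f g t := by
  rw [pairingIntegrand, pairingMajorant, enorm_mul, enorm_mul, RCLike.enorm_conj,
    enorm_symbolIntegrand, gaussSTFT, gaussSTFT, gaussSTFT, gaussSTFT]

theorem continuous_pairingIntegrand (a : 𝓢'(WithLp 2 (V × V), ℂ)) (φ₁ φ₂ : 𝓢'(V, ℂ))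
    (f g : 𝓢(V, ℂ)) : Continuous (pairingIntegrand a φ₁ φ₂ f g) := by
  have h1 : Continuous fun t : ((V × V) × (V × V)) × (V × V) => t.1.1 := by fun_prop
  have h2 : Continuous fun t : ((V × V) × (V × V)) × (V × V) => t.1.2 := by fun_prop
  have h3 := (continuous_stft (gaussian V) (f : 𝓢'(V, ℂ))).comp h1
  have h4 := Complex.continuous_conj.comp
    ((continuous_stft (gaussian V) (g : 𝓢'(V, ℂ))).comp h2)
  exact (continuous_symbolIntegrand a φ₁ φ₂).mul (h3.mul h4)

theorem integrable_pairingIntegrand {f g : 𝓢(V, ℂ)}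
    (hfin : ∫⁻ t, pairingMajorant (fun z ζ => ‖stft (gaussian (WithLp 2 (V × V))) a z ζ‖ₑ)
      φ₁ φ₂ f g t < ∞) : Integrable (pairingIntegrand a φ₁ φ₂ f g) := by
  refine ⟨(continuous_pairingIntegrand a φ₁ φ₂ f g).aestronglyMeasurable, ?_⟩
  rw [hasFiniteIntegral_iff_enorm]
  simpa only [enorm_pairingIntegrand] using hfin

theorem kernelForm_symbolKernel (κ : ℝ) {f g : 𝓢(V, ℂ)}
    (hi : Integrable (pairingIntegrand a φ₁ φ₂ f g)) :
    kernelForm (symbolKernel κ a φ₁ φ₂) (gaussian V) (f : 𝓢'(V, ℂ)) g =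
      κ * ∫ t, pairingIntegrand a φ₁ φ₂ f g t := by
  have e := integral_prod (μ := (volume : Measure ((V × V) × (V × V))))
    (ν := (volume : Measure (V × V))) _ hi
  rw [show (volume : Measure (((V × V) × (V × V)) × (V × V))) =
    (volume : Measure ((V × V) × (V × V))).prod (volume : Measure (V × V)) from rfl, e,
    ← integral_const_mul, kernelForm]
  refine integral_congr_ae (Eventually.of_forall fun t => ?_)
  simp only [pairingIntegrand, symbolKernel]
  rw [integral_mul_const]
  ring

theorem pairingIntegrand_shearPerm (f g : 𝓢(V, ℂ)) (t : (V × V) × (V × V)) (u : V × V) :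
    pairingIntegrand a φ₁ φ₂ f g (shearPerm (t, u)) = rotatedSTFT a t.1 t.2 *
      conj (translatedSTFT φ₁ t.1 u * conj (stft (gaussian V) (f : 𝓢'(V, ℂ)) u.1 u.2) *
      (conj (translatedSTFT φ₂ t.1 (u + t.2)) *
        stft (gaussian V) (g : 𝓢'(V, ℂ)) (u + t.2).1 (u + t.2).2)) := by
  simp only [pairingIntegrand, shearPerm, symbolIntegrand, add_sub_cancel_left, map_mul,
    Complex.conj_conj]
  ring

/-- Two orders of integration of one absolutely convergent integral: over u after the shear this is
the transform of the product, over z it is the kernel. -/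
theorem exists_integral_stft_mul_conj_stftFun_eq : ∃ c : ℝ, 0 < c ∧
    ∀ (a : 𝓢'(WithLp 2 (V × V), ℂ)) (φ₁ φ₂ : 𝓢'(V, ℂ)) (f g : 𝓢(V, ℂ)),
      Integrable (pairingIntegrand a φ₁ φ₂ f g) →
      c * ∫ w : WithLp 2 (V × V) × WithLp 2 (V × V),
        stft (gaussian (WithLp 2 (V × V))) a w.1 w.2 *
        conj (stftFun (gaussian (WithLp 2 (V × V))) (windowProduct φ₁ φ₂ f g) w.1 w.2) =
      ∫ t, pairingIntegrand a φ₁ φ₂ f g t := by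
  obtain ⟨c, hc, h⟩ := exists_stftFun_windowProduct_eq (V := V)
  refine ⟨c, hc, fun a φ₁ φ₂ f g hi => ?_⟩
  obtain ⟨G, hG⟩ := exists_stft_eq_stftFun_windowProduct φ₁ φ₂ f g
  have hcont : Continuous fun w : WithLp 2 (V × V) × WithLp 2 (V × V) =>
      stft (gaussian (WithLp 2 (V × V))) a w.1 w.2 *
        conj (stftFun (gaussian (WithLp 2 (V × V))) (windowProduct φ₁ φ₂ f g) w.1 w.2) := by
    simp only [← hG]
    exact (continuous_stft _ a).mul (Complex.continuous_conj.comp (continuous_stft _ G))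
  have e1 := integral_map (μ := (volume : Measure ((V × V) × (V × V))))
    measurePreserving_rotatePair.measurable.aemeasurable hcont.aestronglyMeasurable
  rw [measurePreserving_rotatePair.map_eq] at e1
  have e2 := integral_map (μ := (volume : Measure (((V × V) × (V × V)) × (V × V))))
    measurePreserving_shearPerm_volume.measurable.aemeasurable
    (continuous_pairingIntegrand a φ₁ φ₂ f g).aestronglyMeasurable
  rw [measurePreserving_shearPerm_volume.map_eq] at e2
  have hi' := measurePreserving_shearPerm_volume.integrable_comp_of_integrable hi
  have e3 := integral_prod (μ := (volume : Measure ((V × V) × (V × V))))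
    (ν := (volume : Measure (V × V))) _ hi'
  rw [e1, e2, ← integral_const_mul]
  refine Eq.trans ?_ e3.symm
  refine integral_congr_ae (Eventually.of_forall fun t => ?_)
  simp only [Function.comp_apply, pairingIntegrand_shearPerm]
  rw [integral_const_mul, integral_conj, ← h, map_mul, Complex.conj_ofReal, rotatedSTFT,
    rotatePair]
  ring

end WeakFormula

/-! ### Independence of the extended pairing from the window. -/

section WindowChange

open Filter Module

variable {V : Type*} [NormedAddCommGroup V] [InnerProductSpace ℝ V] [FiniteDimensional ℝ V]
  [MeasurableSpace V] [BorelSpace V]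

/-- The pairing of two tempered distributions through their short-time Fourier transforms does not
depend on the window. -/
theorem integral_stft_mul_conj_stft_change_window {Ψ₀ : 𝓢(V, ℂ)} (hΨ₀ : Ψ₀ ≠ 0) (Ψ : 𝓢(V, ℂ))
    {a G : 𝓢'(V, ℂ)} {n : ℕ} (hfin : ∫⁻ w : V × V,
      smear n (smear n fun x ξ => ‖stft Ψ₀ a x ξ‖ₑ) w.1 w.2 * ‖stft Ψ₀ G w.1 w.2‖ₑ < ∞) {c : ℂ}
    (hc : ∫ w : V × V, stft Ψ₀ a w.1 w.2 * conj (stft Ψ₀ G w.1 w.2) =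
      (∫ t, ‖Ψ₀ t‖ ^ 2 : ℝ) * c) :
    Integrable (fun w : V × V => stft Ψ a w.1 w.2 * conj (stft Ψ G w.1 w.2)) ∧
      ∫ w : V × V, stft Ψ a w.1 w.2 * conj (stft Ψ G w.1 w.2) = (∫ t, ‖Ψ t‖ ^ 2 : ℝ) * c := by
  obtain ⟨C₁, h₁⟩ := exists_lintegral_stft_mul_shiftS_le Ψ₀ Ψ n
  obtain ⟨C₂, h₂⟩ := exists_enorm_stft_le_smear hΨ₀ Ψ n
  have hm : ∀ (γ : 𝓢(V, ℂ)) (F : 𝓢'(V, ℂ)), Measurable (Function.uncurry fun x ξ => ‖stft γ F x ξ‖ₑ) :=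
    fun γ F => (continuous_stft γ F).enorm.measurable
  have hS : Measurable (Function.uncurry fun w' w : V × V =>
      conj (stft Ψ₀ ((shiftS w' Ψ : 𝓢(V, ℂ)) : 𝓢'(V, ℂ)) w.1 w.2)) :=
    (Complex.continuous_conj.comp (continuous_stft_shiftS Ψ₀ Ψ)).measurable
  have h0 := integral_norm_sq_pos hΨ₀
  -- Integrating S over w against V_{Ψ₀} a gives ‖Ψ₀‖² V_Ψ a; integrating it over w' against
  -- conj(V_Ψ G) gives ‖Ψ‖² conj(V_{Ψ₀} G). Comparing the two orders relates the pairings.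
  have key := integral_mul_integral_eq (μ := (volume : Measure (V × V)))
    (ν := (volume : Measure (V × V))) (φ := fun w' => conj (stft Ψ G w'.1 w'.2))
    (S := fun w' w => conj (stft Ψ₀ ((shiftS w' Ψ : 𝓢(V, ℂ)) : 𝓢'(V, ℂ)) w.1 w.2))
    (ψ := fun w => stft Ψ₀ a w.1 w.2) (U := fun w => conj (stft Ψ₀ G w.1 w.2))
    (c := (∫ t, ‖Ψ t‖ ^ 2 : ℝ))
    (D := fun w => C₁ * smear n (fun x ξ => ‖stft Ψ G x ξ‖ₑ) w.1 w.2)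
    (Complex.continuous_conj.comp (continuous_stft Ψ G)).measurable hS
    (continuous_stft Ψ₀ a).measurable (fun w => ?_) ?_ (fun w => ?_)
  · have e : ∀ w' : V × V, ∫ w : V × V,
        conj (stft Ψ₀ ((shiftS w' Ψ : 𝓢(V, ℂ)) : 𝓢'(V, ℂ)) w.1 w.2) * stft Ψ₀ a w.1 w.2 =
        (∫ t, ‖Ψ₀ t‖ ^ 2 : ℝ) * stft Ψ a w'.1 w'.2 := by
      intro w'
      have h := (integral_stft_mul_conj_stft a Ψ₀ Ψ₀ (shiftS w' Ψ)).2
      rw [bracket_coe_self, ← stft_eq] at h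
      rw [← h]
      exact integral_congr_ae (Eventually.of_forall fun w => mul_comm _ _)
    have e' : ∀ w' : V × V, conj (stft Ψ G w'.1 w'.2) *
        ((∫ t, ‖Ψ₀ t‖ ^ 2 : ℝ) * stft Ψ a w'.1 w'.2) =
        ((∫ t, ‖Ψ₀ t‖ ^ 2 : ℝ) : ℂ) * (stft Ψ a w'.1 w'.2 * conj (stft Ψ G w'.1 w'.2)) := by
      intro w'
      ring
    have h0' : ((∫ t, ‖Ψ₀ t‖ ^ 2 : ℝ) : ℂ) ≠ 0 := Complex.ofReal_ne_zero.2 h0.ne'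
    simp only [e, e'] at key
    have hc' : ∫ w : V × V, conj (stft Ψ₀ G w.1 w.2) * stft Ψ₀ a w.1 w.2 =
        (∫ t, ‖Ψ₀ t‖ ^ 2 : ℝ) * c := by
      rw [← hc]
      exact integral_congr_ae (Eventually.of_forall fun w => mul_comm _ _)
    rw [hc', integral_const_mul] at key
    refine ⟨?_, mul_left_cancel₀ h0' ?_⟩
    · have h := key.1.const_mul ((∫ t, ‖Ψ₀ t‖ ^ 2 : ℝ) : ℂ)⁻¹
      simpa only [← mul_assoc, inv_mul_cancel₀ h0', one_mul] using h
    · rw [key.2]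
      ring
  · simp only [RCLike.enorm_conj]
    exact h₁ G w
  · have hsm := measurable_smear n (hm Ψ₀ a)
    -- One smearing comes from the integral over w', another from replacing Ψ by Ψ₀ in the transform
    -- of G. Symmetry moves both onto a, which explains the double smearing in `hfin`.
    calc ∫⁻ w : V × V, C₁ * smear n (fun x ξ => ‖stft Ψ G x ξ‖ₑ) w.1 w.2 * ‖stft Ψ₀ a w.1 w.2‖ₑ
        = C₁ * ∫⁻ w : V × V, ‖stft Ψ G w.1 w.2‖ₑ *
            smear n (fun x ξ => ‖stft Ψ₀ a x ξ‖ₑ) w.1 w.2 := by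
          rw [lintegral_mul_smear_comm n (hm Ψ G) (hm Ψ₀ a),
            ← lintegral_const_mul' _ _ ENNReal.coe_ne_top]
          simp only [mul_assoc]
      _ ≤ C₁ * ∫⁻ w : V × V, C₂ * (smear n (fun x ξ => ‖stft Ψ₀ G x ξ‖ₑ) w.1 w.2 *
            smear n (fun x ξ => ‖stft Ψ₀ a x ξ‖ₑ) w.1 w.2) := by
          refine mul_le_mul_right (lintegral_mono fun w => ?_) _
          rw [← mul_assoc]
          exact mul_le_mul_left (h₂ G _ _) _
      _ = C₁ * (C₂ * ∫⁻ w : V × V, ‖stft Ψ₀ G w.1 w.2‖ₑ *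
            smear n (smear n fun x ξ => ‖stft Ψ₀ a x ξ‖ₑ) w.1 w.2) := by
          rw [lintegral_const_mul' _ _ ENNReal.coe_ne_top,
            lintegral_mul_smear_comm n (hm Ψ₀ G) hsm]
      _ < ∞ := by
          simp only [mul_comm ‖stft Ψ₀ G _ _‖ₑ]
          exact ENNReal.mul_lt_top ENNReal.coe_lt_top (ENNReal.mul_lt_top ENNReal.coe_lt_top hfin)
  · rw [← integral_congr_ae (Eventually.of_forall fun w' => map_mul conj _ _), integral_conj,
      integral_stft_mul_stft_shiftS, map_mul, Complex.conj_ofReal]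

end WindowChange

/-! ### The weak formula for every window; assembling the operator. -/

section WeakFormula

open Filter Module

variable {V : Type*} [NormedAddCommGroup V] [InnerProductSpace ℝ V] [FiniteDimensional ℝ V]
  [MeasurableSpace V] [BorelSpace V]

/-- The first finiteness condition identifies the pairing for the Gaussian window; the one with the
twice smeared symbol transfers it to every window. The constant κ cancels both the squared norm of
the Gaussian and the constant of the product formula. -/
theorem exists_isExtendedPairing_kernelForm : ∃ κ : ℝ, ∀ (a : 𝓢'(WithLp 2 (V × V), ℂ))
    (φ₁ φ₂ : 𝓢'(V, ℂ)) (f g : 𝓢(V, ℂ)) (n : ℕ),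
    ∫⁻ t, pairingMajorant (fun z ζ => ‖stft (gaussian (WithLp 2 (V × V))) a z ζ‖ₑ) φ₁ φ₂ f g t < ∞ →
    ∫⁻ t, pairingMajorant (smear n (smear n fun z ζ =>
      ‖stft (gaussian (WithLp 2 (V × V))) a z ζ‖ₑ)) φ₁ φ₂ f g t < ∞ →
    IsExtendedPairing a (windowProduct φ₁ φ₂ f g)
      (kernelForm (symbolKernel κ a φ₁ φ₂) (gaussian V) (f : 𝓢'(V, ℂ)) g) := by
  obtain ⟨c, hc, h⟩ := exists_integral_stft_mul_conj_stftFun_eq (V := V)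
  have h0 := integral_norm_sq_pos (gaussian_ne_zero (V := WithLp 2 (V × V)))
  refine ⟨((∫ t, ‖gaussian (WithLp 2 (V × V)) t‖ ^ 2) * c)⁻¹,
    fun a φ₁ φ₂ f g n hfin hfin' Ψ => ?_⟩
  have hi := integrable_pairingIntegrand hfin
  obtain ⟨G, hG⟩ := exists_stft_eq_stftFun_windowProduct φ₁ φ₂ f g
  have hm : Measurable (Function.uncurry fun z ζ => ‖stft (gaussian (WithLp 2 (V × V))) a z ζ‖ₑ) :=
    (continuous_stft _ a).enorm.measurable
  have hlt := lintegral_mul_stftFun_lt_top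
    (measurable_smear n (measurable_smear n hm)) hfin'
  have hI := h a φ₁ φ₂ f g hi
  simp only [← hG] at hlt hI ⊢
  refine integral_stft_mul_conj_stft_change_window gaussian_ne_zero Ψ hlt ?_
  rw [kernelForm_symbolKernel _ hi, ← hI]
  have h1 : ((∫ t, ‖gaussian (WithLp 2 (V × V)) t‖ ^ 2 : ℝ) : ℂ) ≠ 0 :=
    Complex.ofReal_ne_zero.2 h0.ne'
  have h2 : (c : ℂ) ≠ 0 := Complex.ofReal_ne_zero.2 hc.ne'
  rw [Complex.ofReal_inv, Complex.ofReal_mul]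
  field_simp

/-- A family of conjugate-linear forms which depends linearly on a parameter defines a partial
linear operator between spaces of tempered distributions. -/
theorem exists_linearPMap_bracket_eq (D : Submodule ℂ 𝓢'(V, ℂ)) (B : 𝓢'(V, ℂ) → 𝓢(V, ℂ) → ℂ)
    (hB : ∀ f ∈ D, ∃ F : 𝓢'(V, ℂ), ∀ g, bracket F g = B f g)
    (hadd : ∀ f ∈ D, ∀ f' ∈ D, ∀ g, B (f + f') g = B f g + B f' g)
    (hsmul : ∀ (c : ℂ), ∀ f ∈ D, ∀ g, B (c • f) g = c * B f g) :
    ∃ T : 𝓢'(V, ℂ) →ₗ.[ℂ] 𝓢'(V, ℂ), T.domain = D ∧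
      ∀ (f : T.domain) g, bracket (T f) g = B f g := by
  choose! T hT using hB
  refine ⟨⟨D, ⟨⟨fun f => T f, fun f f' => ?_⟩, fun c f => ?_⟩⟩, rfl, fun f g => hT _ f.2 g⟩
  · refine bracket_injective fun g => ?_
    rw [bracket_add_left, hT _ f.2, hT _ f'.2, hT _ (f + f').2, ← hadd _ f.2 _ f'.2]
    rfl
  · refine bracket_injective fun g => ?_
    rw [RingHom.id_apply, bracket_smul_left, hT _ f.2, hT _ (c • f).2, ← hsmul _ _ f.2]
    rfl

end WeakFormula

/-! ### Arithmetic of the exponents. -/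

section Exponents

theorem exists_inv_eq_ofReal {x : ℝ≥0∞} (hx : 1 ≤ x) : ∃ u : ℝ, 0 ≤ u ∧ u ≤ 1 ∧
    x⁻¹ = ENNReal.ofReal u ∧ (x.conjExponent)⁻¹ = ENNReal.ofReal (1 - u) := by
  have h1 : x⁻¹ ≤ 1 := ENNReal.inv_le_one.2 hx
  have ht : x⁻¹ ≠ ∞ := ne_top_of_le_ne_top ENNReal.one_ne_top h1
  have h2 := ENNReal.toReal_mono ENNReal.one_ne_top h1
  rw [ENNReal.toReal_one] at h2
  refine ⟨x⁻¹.toReal, ENNReal.toReal_nonneg, h2, (ENNReal.ofReal_toReal ht).symm, ?_⟩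
  have := ENNReal.HolderConjugate.conjExponent hx
  have h := ENNReal.HolderConjugate.inv_add_inv_eq_one x x.conjExponent
  rw [ENNReal.ofReal_sub _ ENNReal.toReal_nonneg, ENNReal.ofReal_one, ENNReal.ofReal_toReal ht, ← h,
    ENNReal.add_sub_cancel_left ht]

/-- The exponents of the auxiliary Lebesgue spaces between which a localization operator acts. -/
theorem exists_exponents {p q p₁ p₂ : ℝ≥0∞} (hp : 1 ≤ p) (hq : 1 ≤ q) (hp₁ : 1 ≤ p₁)
    (hp₂ : 1 ≤ p₂)
    (h : (p.conjExponent)⁻¹ + (q.conjExponent)⁻¹ ≤ p₁⁻¹ + (p₂.conjExponent)⁻¹)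
    (h₁ : q ≤ p₁.conjExponent) (h₂ : q ≤ p₂) :
    ∃ a b : ℝ≥0∞, p₁ ≤ a ∧ 1 ≤ b ∧ b ≤ p₂ ∧ (max p q)⁻¹ + a⁻¹ ≤ 1 ∧ 1 ≤ q⁻¹ + a⁻¹ ∧
      b⁻¹ + 1 = (max p q)⁻¹ + q⁻¹ + a⁻¹ := by
  obtain ⟨y, hy0, hy1, hy, hy'⟩ := exists_inv_eq_ofReal hp
  obtain ⟨z, hz0, hz1, hz, hz'⟩ := exists_inv_eq_ofReal hq
  obtain ⟨x₁, hx₁0, hx₁1, hx₁, hx₁'⟩ := exists_inv_eq_ofReal hp₁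
  obtain ⟨x₂, hx₂0, hx₂1, hx₂, hx₂'⟩ := exists_inv_eq_ofReal hp₂
  rw [hy', hz', hx₁, hx₂', ← ENNReal.ofReal_add (by linarith) (by linarith),
    ← ENNReal.ofReal_add (by linarith) (by linarith),
    ENNReal.ofReal_le_ofReal_iff (by linarith)] at h
  rw [← ENNReal.inv_le_inv, hx₁', hz, ENNReal.ofReal_le_ofReal_iff (by linarith)] at h₁
  rw [← ENNReal.inv_le_inv, hx₂, hz, ENNReal.ofReal_le_ofReal_iff (by linarith)] at h₂
  -- Y is the reciprocal of P = max(p, q): the Young-type inequality needs q ≤ P, and enlarging p to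
  -- P is harmless by embedding.
  obtain ⟨Y, hY0, hYz, hYy, hYc, hY⟩ : ∃ Y : ℝ, 0 ≤ Y ∧ Y ≤ z ∧ Y ≤ y ∧ (Y = y ∨ Y = z) ∧
      (max p q)⁻¹ = ENNReal.ofReal Y := by
    refine ⟨min y z, le_min hy0 hz0, min_le_right _ _, min_le_left _ _, min_choice y z, ?_⟩
    rcases le_total p q with hpq | hpq
    · rw [max_eq_right hpq, hz, min_eq_right]
      rwa [← ENNReal.inv_le_inv, hy, hz, ENNReal.ofReal_le_ofReal_iff hy0] at hpq
    · rw [max_eq_left hpq, hy, min_eq_left]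
      rwa [← ENNReal.inv_le_inv, hy, hz, ENNReal.ofReal_le_ofReal_iff hz0] at hpq
  -- A = 1/a is the largest value allowed by p₁ ≤ a and 1/P + 1/a ≤ 1, which makes 1/b largest as
  -- well.
  obtain ⟨A, hA0, hAx, hAY, hA⟩ : ∃ A : ℝ, 0 ≤ A ∧ A ≤ x₁ ∧ A ≤ 1 - Y ∧ (A = x₁ ∨ A = 1 - Y) :=
    ⟨min x₁ (1 - Y), le_min hx₁0 (by linarith), min_le_left _ _, min_le_right _ _, min_choice _ _⟩
  have hzA : 1 ≤ z + A := by rcases hA with rfl | rfl <;> linarith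
  -- The sum condition is used when A = x₁ and Y = y. If Y = z, the bounds 1 - x₁ ≤ z and x₂ ≤ z
  -- suffice; if A = 1 - Y, the right side is z.
  have hB : x₂ ≤ Y + z + A - 1 := by
    rcases hA with rfl | rfl
    · rcases hYc with rfl | rfl <;> linarith
    · linarith
  refine ⟨(ENNReal.ofReal A)⁻¹, (ENNReal.ofReal (Y + z + A - 1))⁻¹, ?_, ?_, ?_, ?_, ?_, ?_⟩
  · rw [← ENNReal.inv_le_inv, inv_inv, hx₁]
    exact ENNReal.ofReal_le_ofReal hAx
  · rw [ENNReal.one_le_inv, ENNReal.ofReal_le_one]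
    linarith
  · rw [← ENNReal.inv_le_inv, inv_inv, hx₂]
    exact ENNReal.ofReal_le_ofReal hB
  · rw [inv_inv, hY, ← ENNReal.ofReal_add hY0 hA0, ENNReal.ofReal_le_one]
    linarith
  · rw [inv_inv, hz, ← ENNReal.ofReal_add hz0 hA0, ENNReal.one_le_ofReal]
    exact hzA
  · rw [inv_inv, inv_inv, hY, hz, ← ENNReal.ofReal_add hY0 hz0,
      ← ENNReal.ofReal_add (by linarith) hA0, ← ENNReal.ofReal_one,
      ← ENNReal.ofReal_add (by linarith) zero_le_one]
    congr 1
    ring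

end Exponents

end TimeFrequency

end
-- The boundedness theorem.
open TimeFrequency in
theorem theorem5p2 (d : ℕ) (s : ℝ) (hs : 0 ≤ s) (p₁ q₁ p₂ q₂ p q r : ℝ≥0∞)
    (hp₁ : 1 ≤ p₁) (hq₁ : 1 ≤ q₁) (hp₂ : 1 ≤ p₂) (hq₂ : 1 ≤ q₂) (hp : 1 ≤ p) (hq : 1 ≤ q)
    (h_sum : (p.conjExponent)⁻¹ + (q.conjExponent)⁻¹ ≤
      min (p₁⁻¹ + (p₂.conjExponent)⁻¹) (q₁⁻¹ + (q₂.conjExponent)⁻¹))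
    (h_min : q ≤ min (min p₁.conjExponent q₁.conjExponent) (min p₂ q₂))
    (hr : 1 ≤ r) (hr₂ : r ≤ 2)
    (g : 𝓢(Space d, ℂ)) (hg : g ≠ 0) (Φ : 𝓢(PhaseSpace d, ℂ)) (hΦ : Φ ≠ 0) :
    ∃ C : ℝ≥0,
      ∀ a ∈ modulationSpace Φ p q (oneTensorWeight (-s)),
      ∀ φ₁ ∈ modulationSpace g r r (vWeight (2 * s)),
      ∀ φ₂ ∈ modulationSpace g r r (vWeight (2 * s)),
      ∃ T : 𝓢'(Space d, ℂ) →ₗ.[ℂ] 𝓢'(Space d, ℂ),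
        (T.domain : Set 𝓢'(Space d, ℂ)) = modulationSpace g p₁ q₁ (vWeight s) ∧
        IsLocalizationOperator a φ₁ φ₂ T ∧
        ∀ f : T.domain,
          T f ∈ modulationSpace g p₂ q₂ (vWeight s) ∧
          modulationNorm g p₂ q₂ (vWeight s) (T f) ≤
            C * modulationNorm Φ p q (oneTensorWeight (-s)) a *
              modulationNorm g r r (vWeight (2 * s)) φ₁ *
              modulationNorm g r r (vWeight (2 * s)) φ₂ *
              modulationNorm g p₁ q₁ (vWeight s) (f : 𝓢'(Space d, ℂ)) := by
  obtain ⟨h_sum₁, h_sum₂⟩ := le_min_iff.1 h_sum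
  obtain ⟨hq', hq''⟩ := le_min_iff.1 h_min
  obtain ⟨a₁, b₁, hpa₁, hb₁, hbp₁, hPa₁, hqa₁, hab₁⟩ := exists_exponents hp hq hp₁ hp₂ h_sum₁
    (le_min_iff.1 hq').1 (le_min_iff.1 hq'').1
  obtain ⟨a₂, b₂, hpa₂, hb₂, hbp₂, hPa₂, hqa₂, hab₂⟩ := exists_exponents hp hq hq₁ hq₂ h_sum₂
    (le_min_iff.1 hq').2 (le_min_iff.1 hq'').2
  have hqP : q ≤ max p q := le_max_right _ _
  have hm : IsModerate (vWeight s : Space d → Space d → ℝ) := isModerate_vWeight s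
  have hmt : IsModerate (oneTensorWeight (-s) : PhaseSpace d → PhaseSpace d → ℝ) :=
    isModerate_oneTensorWeight (-s)
  obtain ⟨κ, hκ⟩ := exists_isExtendedPairing_kernelForm (V := Space d)
  -- The factor |κ| gives a majorant of the actual kernel; the version with factor 1 below controls
  -- the pairing integrals.
  obtain ⟨C₁, hC₁⟩ := exists_isBoundedKernel_symbolMajorant ‖κ‖₊ hg hs hq hqP hr hr₂ hPa₁ hqa₁ hab₁
    hPa₂ hqa₂ hab₂ hb₁
  obtain ⟨C₂, hC₂⟩ := exists_isBoundedKernel_symbolMajorant 1 hg hs hq hqP hr hr₂ hPa₁ hqa₁ hab₁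
    hPa₂ hqa₂ hab₂ hb₁
  obtain ⟨C₃, hC₃⟩ := exists_mixedLpNorm_stft_le hg (gaussian (Space d)) hm hp₁ hpa₁ hq₁ hpa₂
  obtain ⟨C₄, hC₄⟩ := exists_mixedLpNorm_stft_le hΦ (gaussian (PhaseSpace d)) hmt hp
    (le_max_left p q) hq le_rfl
  obtain ⟨C₅, n, hC₅⟩ := hmt.exists_mixedLpNorm_le (p := max p q) (q := q) (hq.trans hqP) le_rfl hq
    le_rfl
  obtain ⟨C₆, hC₆⟩ := exists_modulationNorm_kernelForm_le (a₁ := a₁) (a₂ := a₂) g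
    (gaussian (Space d)) hm hb₁ hb₂ hbp₁ hbp₂
  -- The factors come from the passage of the output to exponents p₂, q₂, the kernel bound, the
  -- embedding of the symbol class, and the embedding of the input into exponents a₁, a₂. All are
  -- fixed before the symbol and the windows.
  refine ⟨C₆ * C₁ * C₄ * C₃, fun a ha φ₁ hφ₁ φ₂ hφ₂ => ?_⟩
  have hV : Measurable (Function.uncurry fun z ζ => ‖stft (gaussian (PhaseSpace d)) a z ζ‖ₑ) :=
    (continuous_stft _ a).enorm.measurable
  have hVn := (hC₄ a).trans_lt (ENNReal.mul_lt_top ENNReal.coe_lt_top ha)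
  have hVs := (hC₅ _ hV).trans_lt (ENNReal.mul_lt_top ENNReal.coe_lt_top hVn)
  -- The twice smeared transform of the symbol satisfies the same norm condition, so the kernel
  -- bound applies to it too; the change of window requires this.
  have hVss := (hC₅ _ (measurable_smear n hV)).trans_lt (ENNReal.mul_lt_top ENNReal.coe_lt_top hVs)
  have hK := hC₁ _ hV hVn φ₁ hφ₁ φ₂ hφ₂
  have hkK := enorm_symbolKernel_le κ a φ₁ φ₂
  have hk := measurable_symbolKernel κ a φ₁ φ₂
  have hfin : ∀ f ∈ modulationSpace g p₁ q₁ (vWeight s),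
      modulationNorm (gaussian (Space d)) a₁ a₂ (vWeight s) f < ∞ := by
    intro f hf
    rw [modulationNorm_eq _ _ _ hm]
    exact (hC₃ f).trans_lt (ENNReal.mul_lt_top ENNReal.coe_lt_top hf)
  obtain ⟨T, hTD, hT⟩ := exists_linearPMap_bracket_eq (modulationSubmodule g hp₁ hq₁ hm)
    (kernelForm (symbolKernel κ a φ₁ φ₂) (gaussian (Space d)))
    (fun f hf => hK.exists_distribution hk hkK hm hb₁ hb₂ _ (hfin f hf))
    (fun f hf f' hf' h => hK.kernelForm_add hk hkK hm hb₁ hb₂ _ h (hfin f hf) (hfin f' hf'))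
    (fun c f _ h => kernelForm_smul c _ h f)
  have hTD' : (T.domain : Set 𝓢'(Space d, ℂ)) = modulationSpace g p₁ q₁ (vWeight s) := by
    rw [hTD]
    rfl
  have hmem : ∀ f : T.domain, (f : 𝓢'(Space d, ℂ)) ∈ modulationSpace g p₁ q₁ (vWeight s) :=
    fun f => hTD' ▸ f.2
  have hS : ∀ f : 𝓢(Space d, ℂ), (f : 𝓢'(Space d, ℂ)) ∈ T.domain := by
    intro f
    rw [hTD]
    exact coe_mem_modulationSpace g f hp₁ hq₁ hm
  have hbound : ∀ f : T.domain, modulationNorm g p₂ q₂ (vWeight s) (T f) ≤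
      ((C₆ * C₁ * C₄ * C₃ : ℝ≥0) : ℝ≥0∞) * modulationNorm Φ p q (oneTensorWeight (-s)) a *
        modulationNorm g r r (vWeight (2 * s)) φ₁ * modulationNorm g r r (vWeight (2 * s)) φ₂ *
        modulationNorm g p₁ q₁ (vWeight s) (f : 𝓢'(Space d, ℂ)) := by
    intro f
    have h3 : modulationNorm (gaussian (Space d)) a₁ a₂ (vWeight s) (f : 𝓢'(Space d, ℂ)) ≤
        C₃ * modulationNorm g p₁ q₁ (vWeight s) (f : 𝓢'(Space d, ℂ)) := by
      rw [modulationNorm_eq _ _ _ hm]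
      exact hC₃ f
    refine (hC₆ _ _ _ hK hkK f (T f) (hT f)).trans ?_
    refine (mul_le_mul_right (mul_le_mul' (mul_le_mul_right (mul_le_mul_left (mul_le_mul_left
      (hC₄ a) _) _) _) h3) _).trans_eq ?_
    push_cast
    ring
  refine ⟨T, hTD', ⟨hS, fun f h => ?_, fun f γ h => ?_⟩, fun f => ⟨?_, hbound f⟩⟩
  · rw [hT]
    exact hκ a φ₁ φ₂ f h n
      (lintegral_pairingMajorant_lt_top hV (hC₂ _ hV hVn φ₁ hφ₁ φ₂ hφ₂) hm (hp₁.trans hpa₁)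
        (hq₁.trans hpa₂) hb₁ hb₂ f h)
      (lintegral_pairingMajorant_lt_top (measurable_smear n (measurable_smear n hV))
        (hC₂ _ (measurable_smear n (measurable_smear n hV)) hVss φ₁ hφ₁ φ₂ hφ₂) hm (hp₁.trans hpa₁)
        (hq₁.trans hpa₂) hb₁ hb₂ f h)
  · simp only [hT]
    exact hK.kernelForm_expansion hk hkK hm (hp₁.trans hpa₁) (hq₁.trans hpa₂) hb₁ hb₂
      gaussian_ne_zero γ h (hfin _ (hmem f))
  · exact (hbound f).trans_lt (ENNReal.mul_lt_top (ENNReal.mul_lt_top (ENNReal.mul_lt_top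
      (ENNReal.mul_lt_top ENNReal.coe_lt_top ha) hφ₁) hφ₂) (hmem f))
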